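/- **Setting.** There are $K\ge 1$ arms and $T\ge 2$ rounds. An oblivious adversary fixes in advance, for every round $t$, an arbitrary distribution on reward vectors $(Y_t(a))_{a\in[K]}\in[0,1]^K$; rewards are independent across rounds, and $\mu_t(a)=\mathbb E[Y_t(a)]$. A policy $\pi$ plays an arm $\pi_t$ at round $t$ and observes only $Y_t(\pi_t)$. Its dynamic regret is $R(\pi,T)=\sum_{t=1}^T\max_{a}\mu_t(a)-\mathbb E\big[\sum_{t=1}^T\mu_t(\pi_t)\big]$. Let $\delta_t(a)=\max_{a'}(\mu_t(a')-\mu_t(a))$. **Significant shifts.** Let $\tau_0=1$. Recursively, $\tau_{i+1}$ is the earliest $\tau\in(\tau_i,T]$ such that for every arm $a$ there are rounds $s_1<s_2$ with $[s_1,s_2]\subseteq[\tau_i,\tau]$ and $\sum_{t=s_1}^{s_2}\delta_t(a)\ge\sqrt{K(s_2-s_1)}$. Let $\tilde L$ be the number of shifts $\tau_1,\dots,\tau_{\tilde L}$ so obtained, and put $\tau_{\tilde L+1}=T+1$. **The META procedure** (inputs: $K$, the horizon $T$ and a numerical constant $C_0>0$). Let $\mathcal A_s$ be the candidate set from which the arm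 of round $s$ is drawn, and $\hat\delta_s(a',a)=|\mathcal A_s|\,\big(Y_s(a')\mathbf 1\{\pi_s=a'\}-Y_s(a)\mathbf 1\{\pi_s=a\}\big)$. An arm $a$ is *rejected on* $[u,t)$ if there are rounds $s_1<s_2$ with $[s_1,s_2]\subseteq[u,t)$ and $$\max_{a'\in[K]}\sum_{s=s_1}^{s_2}\hat\delta_s(a',a)>\log(T)\sqrt{C_0\,\big(K(s_2-s_1)\vee K^2\big)}.$$ The variables $t$ (current round), $t_\ell$, $\mathcal A_{\rm master}$, $B_{s,m}$ and all past plays, observed rewards and candidate sets are global. *Main program.* Start with $t=1$. While $t\le T$, run an episode: put $t_\ell=t$, $\mathcal A_{\rm master}=[K]$, draw fresh independent $B_{s,m}\sim{\rm Bernoulli}\big(1/\sqrt{m(s-t_\ell)}\big)$ for $s=t_\ell+1,\dots,T$ and $m\in\{2,4,\dots,2^{\lceil\log_2T\rceil}\}$, and call Base-Alg$(t_\ell,T+1-t_\ell)$. *Base-Alg$(t_{\rm start},m_0)$.* Start with its candidate set $\mathcal A=[K]$. While $t\le T$: (1) play an arm drawn uniformly from $\mathcal A$ (so $\mathcal A_t=\mathcal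 A$), and increase $t$ by $1$; (2) if $t\le T$ and $B_{t,m}=1$ for some $m$, call Base-Alg$(t,m)$ with the largest such $m$, and wait for its return; (3) if $t>t_{\rm start}+m_0$, return; (4) remove from $\mathcal A_{\rm master}$ all arms rejected on $[t_\ell,t)$, and from $\mathcal A$ all arms rejected on $[t_{\rm start},t)$; (5) if $\mathcal A_{\rm master}=\emptyset$, return. **Theorem.** There is a universal constant $c>0$ such that for every $C_0\ge c$ there is a constant $C>0$, depending only on $C_0$, such that for all $K\ge1$, all $T\ge2$ and all environments as above, the META procedure $\pi$ (which knows neither the reward distributions nor the times $\tau_i$ nor $\tilde L$) satisfies $$R(\pi,T)\le C\,\log^3(T)\sum_{i=0}^{\tilde L}\sqrt{K(\tau_{i+1}-\tau_i)}.$$ -/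

import Mathlib

open MeasureTheory ProbabilityTheory

namespace MetaBandit

noncomputable section

/-! ## The environment

Rounds are `1, 2, …, T` and arms are the elements of `Fin K`.  An oblivious adversary fixes, for each
round `t`, the joint law `P t` of the reward vector `(Y_t(a))_a`; rewards are independent across rounds. -/

/-- The mean reward `μ_t(a) = 𝔼[Y_t(a)]`. -/
def meanReward {K : ℕ} (P : ℕ → Measure (Fin K → ℝ)) (t : ℕ) (a : Fin K) : ℝ :=
  ∫ y, y a ∂(P t)

/-- The worst gap `δ_t(a) = max_{a'} (μ_t(a') - μ_t(a))`. -/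
def worstGap {K : ℕ} (μ : ℕ → Fin K → ℝ) (t : ℕ) (a : Fin K) : ℝ :=
  ⨆ a' : Fin K, (μ t a' - μ t a)

/-- Dynamic regret over `T` rounds of the (random) arm sequence `π`, under the probability `Q`. -/
def dynamicRegret {K : ℕ} {Ω : Type*} [MeasurableSpace Ω] (Q : Measure Ω) (T : ℕ)
    (μ : ℕ → Fin K → ℝ) (π : ℕ → Ω → Fin K) : ℝ :=
  (∑ t ∈ Finset.Icc 1 T, ⨆ a : Fin K, μ t a) - ∫ ω, ∑ t ∈ Finset.Icc 1 T, μ t (π t ω) ∂Q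

/-! ## Significant shifts -/

/-- Arm `a` incurs significant regret on the interval of rounds `[s₁, s₂]`. -/
def SignificantRegret {K : ℕ} (μ : ℕ → Fin K → ℝ) (a : Fin K) (s₁ s₂ : ℕ) : Prop :=
  √((K : ℝ) * ((s₂ : ℝ) - (s₁ : ℝ))) ≤ ∑ t ∈ Finset.Icc s₁ s₂, worstGap μ t a

/-- No arm is safe on `[σ, τ]`: every arm incurs significant regret on some `[s₁, s₂] ⊆ [σ, τ]`
with `s₁ < s₂`. -/
def NoSafeArm {K : ℕ} (μ : ℕ → Fin K → ℝ) (σ τ : ℕ) : Prop :=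
  ∀ a : Fin K, ∃ s₁ s₂ : ℕ, σ ≤ s₁ ∧ s₁ < s₂ ∧ s₂ ≤ τ ∧ SignificantRegret μ a s₁ s₂

open Classical in
/-- The first significant shift after the phase start `σ`, i.e. the earliest `τ ∈ (σ, T]` such that no
arm is safe on `[σ, τ]`; it is `T + 1` if there is none. -/
def nextShift {K : ℕ} (T : ℕ) (μ : ℕ → Fin K → ℝ) (σ : ℕ) : ℕ :=
  if ∃ τ, σ < τ ∧ τ ≤ T ∧ NoSafeArm μ σ τ then sInf {τ | σ < τ ∧ τ ≤ T ∧ NoSafeArm μ σ τ} else T + 1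

/-- The sequence `τ_0 = 1, τ_1, τ_2, …` of significant shift times; it equals `T + 1` from the index
`numShifts + 1` on. -/
def shiftTime {K : ℕ} (T : ℕ) (μ : ℕ → Fin K → ℝ) : ℕ → ℕ
  | 0 => 1
  | i + 1 => nextShift T μ (shiftTime T μ i)

/-- The number `L̃` of significant shifts: `[τ_L̃, τ_{L̃+1}) = [τ_L̃, T + 1)` is the last phase. -/
def numShifts {K : ℕ} (T : ℕ) (μ : ℕ → Fin K → ℝ) : ℕ :=
  sInf {i | shiftTime T μ (i + 1) = T + 1}

/-! ## The algorithm

The recursive calls of the base algorithm are unfolded into an explicit call stack. -/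

/-- A call of the base algorithm: its starting round, its scheduled duration, and its current
candidate arm set (for a call that is interrupted by a child: the saved set). -/
structure Frame (K : ℕ) where
  start : ℕ
  dur : ℕ
  arms : Finset (Fin K)

/-- The state of the algorithm between two rounds. `est s a` is the importance-weighted reward
`|𝒜_s| · Y_s(a) · 𝟙{π_s = a}` recorded at an elapsed round `s`. -/
structure State (K : ℕ) where
  /-- first round of the current episode -/
  episode : ℕ
  /-- master candidate arm set of the current episode -/
  master : Finset (Fin K)
  /-- the call that is currently active; its candidate set is `𝒜_t` -/
  active : Frame K
  /-- its suspended ancestors, innermost first -/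
  suspended : List (Frame K)
  est : ℕ → Fin K → ℝ

open Classical in
/-- The arms that satisfy the eviction criterion on some `[s₁, s₂] ⊆ [lo, t)` with `s₁ < s₂`:
`max_{a'} ∑_{s=s₁}^{s₂} δ̂_s(a', a) > log T · √(C₀ · (K (s₂ - s₁) ∨ K²))`,
where `δ̂_s(a', a) = est s a' - est s a`. -/
def evicted {K : ℕ} (C₀ : ℝ) (T : ℕ) (est : ℕ → Fin K → ℝ) (lo t : ℕ) : Finset (Fin K) :=
  Finset.univ.filter fun a => ∃ s₁ s₂ : ℕ, lo ≤ s₁ ∧ s₁ < s₂ ∧ s₂ < t ∧ ∃ a' : Fin K,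
    Real.log T * √(C₀ * max ((K : ℝ) * ((s₂ : ℝ) - (s₁ : ℝ))) ((K : ℝ) ^ 2))
      < ∑ s ∈ Finset.Icc s₁ s₂, (est s a' - est s a)

/-- Start a new episode at round `t`, by calling the base algorithm with duration `T + 1 - t`. -/
def newEpisode {K : ℕ} (T t : ℕ) (est : ℕ → Fin K → ℝ) : State K where
  episode := t
  master := Finset.univ
  active := ⟨t, T + 1 - t, Finset.univ⟩
  suspended := []
  est := est

/-- What happens at the beginning of round `t` when no replay starts there, for a given call stack
(innermost call first). An expired call returns to its parent. The first call that has not expired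
evicts arms from the master set and from its own set; if the master set is then empty, all calls
return and a new episode starts at round `t`, and otherwise this call goes on. -/
def resume {K : ℕ} (C₀ : ℝ) (T t : ℕ) (S : State K) : List (Frame K) → State K
  | [] => newEpisode T t S.est
  | f :: rest =>
    if f.start + f.dur < t then resume C₀ T t S rest
    else
      let master' := S.master \ evicted C₀ T S.est S.episode t
      if master' = ∅ then newEpisode T t S.est
      else
        { S with
          master := master'
          active := ⟨f.start, f.dur, f.arms \ evicted C₀ T S.est f.start t⟩
          suspended := rest }

/-- The possible replay durations `2, 4, …, 2 ^ ⌈log₂ T⌉`. -/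
def durations (T : ℕ) : Finset ℕ :=
  (Finset.Icc 1 (Nat.clog 2 T)).image fun n => 2 ^ n

/-- The transition from round `t` to round `t + 1`, after `arm` was played at round `t` and `reward`
was observed. `B e m` is the replay indicator `B_{t+1,m}` of the episode that starts at round `e`.
If some indicator of the current episode is on, a replay of the longest such duration starts at round
`t + 1` and the active call is suspended. -/
def step {K : ℕ} (C₀ : ℝ) (T t : ℕ) (S : State K) (arm : Fin K) (reward : ℝ)
    (B : ℕ × ℕ → Bool) : State K :=
  let S' : State K :=
    { S with
      est := Function.update S.est t fun a =>
        if arm = a then (S.active.arms.card : ℝ) * reward else 0 }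
  let due : Finset ℕ := (durations T).filter fun m => B (S.episode, m) = true
  if h : due.Nonempty then
    { S' with
      active := ⟨t + 1, due.max' h, Finset.univ⟩
      suspended := S.active :: S.suspended }
  else resume C₀ T (t + 1) S' (S.active :: S.suspended)

/-! ## The probability space of the interaction -/

/-- The random elements attached to a round `s`: the reward vector `Y_s`; for each candidate set `A`
the arm that is drawn if `𝒜_s = A`; and the replay indicators, where the entry `(e, m)` is the
indicator `B_{s,m}` of an episode that starts at round `e`. -/
abbrev RoundSeed (K : ℕ) : Type :=
  (Fin K → ℝ) × (Finset (Fin K) → Fin K) × (ℕ × ℕ → Bool)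

/-- Independent uniform draws, one from each nonempty candidate set. (The algorithm never consults
the entry at `∅`, which is given the uniform law on all arms.) -/
def drawLaw (K : ℕ) : Measure (Finset (Fin K) → Fin K) :=
  Measure.pi fun A =>
    uniformOn (if A.Nonempty then (A : Set (Fin K)) else (Set.univ : Set (Fin K)))

theorem one_div_sqrt_mem (n : ℕ) : 1 / √(n : ℝ) ∈ Set.Icc (0 : ℝ) 1 := by
  refine ⟨by positivity, ?_⟩
  rcases Nat.eq_zero_or_pos n with rfl | h
  · simp
  · have h1 : (1 : ℝ) ≤ √(n : ℝ) := Real.one_le_sqrt.mpr (by exact_mod_cast h)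
    exact (div_le_one (by linarith)).mpr h1

/-- Independent replay indicators at round `s`: for an episode that starts at `e < s` and a duration
`m ≥ 1`, the indicator is on with probability `1 / √(m (s - e))`. -/
def replayLaw (s : ℕ) : Measure (ℕ × ℕ → Bool) :=
  Measure.infinitePi fun p : ℕ × ℕ =>
    bernoulliMeasure true false
      (⟨1 / √((p.2 * (s - p.1) : ℕ) : ℝ), one_div_sqrt_mem _⟩ : unitInterval)

/-- The law of all random elements: independent across rounds, and within a round the rewards, the
draws and the replay indicators are independent. -/
def seedLaw {K : ℕ} (P : ℕ → Measure (Fin K → ℝ)) : Measure (ℕ → RoundSeed K) :=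
  Measure.infinitePi fun s => (P s).prod ((drawLaw K).prod (replayLaw s))

/-- The laws above are probability measures (so that the product in `seedLaw` is a genuine one). -/
theorem isProbabilityMeasure_drawLaw {K : ℕ} (hK : 1 ≤ K) : IsProbabilityMeasure (drawLaw K) := by
  have : Nonempty (Fin K) := ⟨⟨0, hK⟩⟩
  have h : ∀ A : Finset (Fin K), IsProbabilityMeasure
      (uniformOn (if A.Nonempty then (A : Set (Fin K)) else (Set.univ : Set (Fin K)))) := by
    intro A
    refine isProbabilityMeasure_uniformOn (Set.toFinite _) ?_
    split_ifs with h
    · exact h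
    · exact Set.univ_nonempty
  unfold drawLaw
  infer_instance

instance isProbabilityMeasure_replayLaw (s : ℕ) : IsProbabilityMeasure (replayLaw s) := by
  unfold replayLaw
  infer_instance

theorem isProbabilityMeasure_seedLaw {K : ℕ} (hK : 1 ≤ K) (P : ℕ → Measure (Fin K → ℝ))
    [∀ t, IsProbabilityMeasure (P t)] : IsProbabilityMeasure (seedLaw P) := by
  have := isProbabilityMeasure_drawLaw hK
  unfold seedLaw
  infer_instance

/-- The state of the algorithm after `n` completed rounds, i.e. just before it plays round `n + 1`. -/
def stateAfter {K : ℕ} (C₀ : ℝ) (T : ℕ) (ω : ℕ → RoundSeed K) : ℕ → State K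
  | 0 => newEpisode T 1 fun _ _ => 0
  | n + 1 =>
    let S := stateAfter C₀ T ω n
    let arm := (ω (n + 1)).2.1 S.active.arms
    step C₀ T (n + 1) S arm ((ω (n + 1)).1 arm) (ω (n + 2)).2.2

/-- The arm `π_t` that the algorithm plays at round `t ≥ 1`. Of the reward vectors, the state only ever
receives the entries of the arms that were played. -/
def metaArm {K : ℕ} (C₀ : ℝ) (T : ℕ) (t : ℕ) (ω : ℕ → RoundSeed K) : Fin K :=
  (ω t).2.1 (stateAfter C₀ T ω (t - 1)).active.arms

end

end MetaBandit

/-!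
The regret bound rests on three facts, of which the first two hold with probability `1 - O(1 / T)`
and the last one in expectation. If `K > T`, the bound is trivial, as `√(K T) ≥ T`.

*Concentration* (`Concentrated`, `measure_not_concentrated_le`). The sums of the estimated gaps over
all intervals of rounds are within `O(log T √(K n ∨ K²))` of the sums of their conditional means. The
conditional second moment of an estimate is at most `2 K`, and the exponential moments are multiplied
up by resampling one round of the product space at a time (`measurePreserving_resample`). For large
`C₀`, only arms with significant regret are then evicted (`exists_significantRegret`). Hence no episode
that ends lies within a single phase, and a phase meets at most two episodes.

*Replays are found* (`ReplaysFound`, `measure_not_replaysFound_le`). Fix the first round `e` of an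
episode and an arm `b`, and cut the rounds from `e` on greedily into segments: a segment is bad if the
gaps of `b` on it sum to a large multiple of `log T √(K n)`, where `n` is its number of rounds. These
segments depend on `e`, `b` and the environment only. A replay that starts in the first half of a bad segment and
covers the rest of it evicts `b` from the master set (`mem_evicted_of_replay`). If the square roots of
the lengths of the bad segments before round `t` sum to more than `20 log T √(t - e)`, then such a
replay is scheduled with probability at least `1 - T⁻⁴`. Hence the gaps of an arm that is still in the master
set are controlled by the phases that the episode meets (`sum_worstGap_le`).

*Cost of the replays* (`integral_replayCost_le`). A replay of length `m` costs `O(log² T √(K m))` and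
is scheduled with probability `1 / √(m (r - e))`, so that the expected cost at a round is of order
`√(K / (r - e))` for each of the `O(log T)` durations; these sum to `√K` times the square root of the
length of the episode.

On the good event, `sum_avgGap_le` bounds the regret of a trajectory, episode by episode. At the rounds
where a call evicts arms (check rounds), the played arms are compared with an arm that stays in the
master set until the last check round. As long as both are candidates of the active call, their rewards
have differed little over the rounds played by this call, and averaging over the shrinking candidate
set costs a factor `1 + log K` (`sum_average_le`). The gaps of the comparison arm are controlled as
above. The intervals in which a call is suspended are charged to the replays that interrupt it, each
replay being charged at most once.

The recursion is first rewritten without a call stack: `IsRun` describes a trajectory by the episode,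
the first round of the active call, the candidate set and the length of the scheduled replay of each
round, and `isRun` shows that the call stack evolves in this way.
-/

namespace MetaBandit

/-! ### Weighted sums along shrinking candidate sets -/

/-- Abel summation: nondecreasing weights in `[0, W]`, applied to a sequence whose tail sums are at
most `M`, give a sum of at most `W M`. -/
theorem sum_mul_le_of_tail_sum_le (S : Finset ℕ) (w x : ℕ → ℝ) (M : ℝ)
    (hx : ∀ j, ∑ t ∈ S with j ≤ t, x t ≤ M) (W : ℝ) (hW : 0 ≤ W)
    (hw0 : ∀ i ∈ S, 0 ≤ w i) (hwW : ∀ i ∈ S, w i ≤ W)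
    (hw : ∀ i ∈ S, ∀ j ∈ S, i ≤ j → w i ≤ w j) (hM : 0 ≤ M) :
    ∑ t ∈ S, w t * x t ≤ W * M := by
  induction S using Finset.induction_on_min generalizing w W with
  | empty => simpa using mul_nonneg hW hM
  | insert a s has ih =>
    have hna : a ∉ s := fun h => lt_irrefl _ (has a h)
    have htot : x a + ∑ t ∈ s, x t ≤ M := by
      have := hx a
      rw [Finset.filter_true_of_mem] at this
      · rwa [Finset.sum_insert hna] at this
      · intro t ht
        rcases Finset.mem_insert.1 ht with rfl | h
        exacts [le_rfl, (has t h).le]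
    have htail : ∀ j, ∑ t ∈ s with j ≤ t, x t ≤ M := by
      intro j
      by_cases hj : j ≤ a
      · by_cases hs : s.Nonempty
        · have := hx (s.min' hs)
          rw [Finset.filter_insert, if_neg (not_le.2 (has _ (s.min'_mem hs)))] at this
          rw [Finset.filter_true_of_mem] at this ⊢
          · exact this
          · exact fun t ht => hj.trans (has t ht).le
          · exact fun t ht => s.min'_le t ht
        · rw [Finset.not_nonempty_iff_eq_empty.1 hs]; simpa using hM
      · have := hx j
        rwa [Finset.filter_insert, if_neg hj] at this
    have ha : a ∈ insert a s := Finset.mem_insert_self _ _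
    have hmem : ∀ i ∈ s, i ∈ insert a s := fun i hi => Finset.mem_insert_of_mem hi
    have key := ih (fun t => w t - w a) htail (W - w a) (by linarith [hwW a ha])
      (fun i hi => by have := hw a ha i (hmem i hi) (has i hi).le; simpa using this)
      (fun i hi => by have := hwW i (hmem i hi); simpa using this)
      (fun i hi j hj hij => by have := hw i (hmem i hi) j (hmem j hj) hij; simpa using this)
    rw [Finset.sum_insert hna]
    simp only [sub_mul, Finset.sum_sub_distrib, ← Finset.mul_sum] at key
    nlinarith [mul_le_mul_of_nonneg_left htot (hw0 a ha)]

/-- The ranks with respect to `l` are at least `1, 2, …, |U|` in some order; ties only increase them. -/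
theorem sum_one_div_rank_le {α : Type*} [DecidableEq α] (U : Finset α) (l : α → ℕ) :
    ∑ a ∈ U, 1 / ((U.filter fun b => l a ≤ l b).card : ℝ) ≤
      ∑ k ∈ Finset.range U.card, 1 / ((k : ℝ) + 1) := by
  induction U using Finset.induction_on_min_value l with
  | empty => simp
  | insert a s hna has ih =>
    rw [Finset.sum_insert hna, Finset.card_insert_of_notMem hna, Finset.sum_range_succ, add_comm]
    refine add_le_add (le_trans (Finset.sum_le_sum fun c hc => ?_) ih) ?_
    · have hpos : 0 < (s.filter fun b => l c ≤ l b).card :=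
        Finset.card_pos.2 ⟨c, by simp [hc]⟩
      refine one_div_le_one_div_of_le (by exact_mod_cast hpos) ?_
      exact_mod_cast Finset.card_le_card
        (Finset.filter_subset_filter _ (Finset.subset_insert _ _))
    · rw [Finset.filter_true_of_mem, Finset.card_insert_of_notMem hna]
      · push_cast; exact le_rfl
      · intro b hb
        rcases Finset.mem_insert.1 hb with rfl | h
        exacts [le_rfl, has b h]

/-- If each arm `a` contributes at most `M` over every final part of the rounds of `S` at which it is
a candidate, then the average over a shrinking candidate set contributes at most `M (1 + log K)`. -/
theorem sum_average_le {K : ℕ} (S : Finset ℕ) (A : ℕ → Finset (Fin K))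
    (hA : ∀ i ∈ S, ∀ j ∈ S, i ≤ j → A j ⊆ A i) (X : ℕ → Fin K → ℝ) (M : ℝ) (hM : 0 ≤ M)
    (hX : ∀ a j, ∑ t ∈ S with j ≤ t ∧ a ∈ A t, X t a ≤ M) :
    ∑ t ∈ S, (∑ a ∈ A t, X t a) / ((A t).card : ℝ) ≤ (1 + Real.log K) * M := by
  classical
  set O : Fin K → Finset ℕ := fun a => S.filter fun t => a ∈ A t with hO
  set U : Finset (Fin K) := Finset.univ.filter fun a => (O a).Nonempty with hU
  -- the last round at which `a` is a candidate
  set l : Fin K → ℕ := fun a => (O a).sup id with hl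
  have hlmem : ∀ a ∈ U, l a ∈ S ∧ a ∈ A (l a) := by
    intro a ha
    have hne : (O a).Nonempty := by simpa [hU] using ha
    obtain ⟨t, ht, hte⟩ := Finset.exists_mem_eq_sup (O a) hne id
    have : l a = t := hte
    rw [this]
    simpa [hO] using ht
  have hlmax : ∀ a, ∀ t ∈ O a, t ≤ l a := fun a t ht => Finset.le_sup (f := id) ht
  have hswap : ∑ t ∈ S, (∑ a ∈ A t, X t a) / ((A t).card : ℝ) =
      ∑ a ∈ U, ∑ t ∈ O a, (1 / ((A t).card : ℝ)) * X t a := by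
    have h1 : ∑ a ∈ U, ∑ t ∈ O a, (1 / ((A t).card : ℝ)) * X t a =
        ∑ a, ∑ t ∈ O a, (1 / ((A t).card : ℝ)) * X t a := by
      refine Finset.sum_subset (Finset.subset_univ _) fun a _ ha => ?_
      have : O a = ∅ := by
        rw [← Finset.not_nonempty_iff_eq_empty]; simpa [hU] using ha
      simp [this]
    rw [h1]
    simp only [hO, Finset.sum_filter]
    rw [Finset.sum_comm]
    refine Finset.sum_congr rfl fun t _ => ?_
    rw [Finset.sum_div, ← Finset.sum_filter]
    refine Finset.sum_congr (by ext; simp) fun a _ => by ring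
  -- when `a` leaves for good, the candidate set contains all the arms that stay at least as long
  have hone : ∀ a ∈ U, ∑ t ∈ O a, (1 / ((A t).card : ℝ)) * X t a ≤
      1 / ((U.filter fun b => l a ≤ l b).card : ℝ) * M := by
    intro a ha
    have hsub : (U.filter fun b => l a ≤ l b) ⊆ A (l a) := by
      intro b hb
      obtain ⟨hbU, hab⟩ := Finset.mem_filter.1 hb
      exact hA _ (hlmem a ha).1 _ (hlmem b hbU).1 hab (hlmem b hbU).2
    have hpos : 0 < (U.filter fun b => l a ≤ l b).card := Finset.card_pos.2 ⟨a, by simp [ha]⟩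
    have hcard : ∀ t ∈ O a, (0 : ℝ) < (A t).card := fun t ht => by
      exact_mod_cast Finset.card_pos.2 ⟨a, (Finset.mem_filter.1 ht).2⟩
    refine sum_mul_le_of_tail_sum_le (O a) _ (fun t => X t a) M (fun j => ?_) _ (by positivity)
      (fun t ht => by have := hcard t ht; positivity) (fun t ht => ?_) (fun i hi j hj hij => ?_) hM
    · have := hX a j
      rw [hO, Finset.filter_filter]
      convert this using 2
      ext t; simp [and_comm]
    · refine one_div_le_one_div_of_le (by exact_mod_cast hpos) ?_
      have h2 : A (l a) ⊆ A t :=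
        hA _ (Finset.mem_filter.1 ht).1 _ (hlmem a ha).1 (hlmax a t ht)
      exact_mod_cast Finset.card_le_card (hsub.trans h2)
    · refine one_div_le_one_div_of_le (hcard j hj) ?_
      exact_mod_cast Finset.card_le_card
        (hA _ (Finset.mem_filter.1 hi).1 _ (Finset.mem_filter.1 hj).1 hij)
  rw [hswap]
  refine (Finset.sum_le_sum hone).trans ?_
  rw [← Finset.sum_mul]
  refine mul_le_mul_of_nonneg_right ((sum_one_div_rank_le U l).trans ?_) hM
  have hUK : U.card ≤ K := by simpa using Finset.card_le_univ U
  calc ∑ k ∈ Finset.range U.card, 1 / ((k : ℝ) + 1)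
      ≤ ∑ k ∈ Finset.range K, 1 / ((k : ℝ) + 1) :=
        Finset.sum_le_sum_of_subset_of_nonneg (Finset.range_mono hUK) fun _ _ _ => by positivity
    _ = (harmonic K : ℝ) := by simp [harmonic]
    _ ≤ 1 + Real.log K := harmonic_le_one_add_log K

theorem eq_Icc_of_ordConnected (F : Finset ℕ) (hF : F.Nonempty)
    (h : ∀ a ∈ F, ∀ b ∈ F, ∀ c, a ≤ c → c ≤ b → c ∈ F) : F = Finset.Icc (F.min' hF) (F.max' hF) := by
  ext c
  rw [Finset.mem_Icc]
  exact ⟨fun hc => ⟨F.min'_le c hc, F.le_max' c hc⟩,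
    fun hc => h _ (F.min'_mem hF) _ (F.max'_mem hF) c hc.1 hc.2⟩

/-! ### Gaps and eviction -/

theorem worstGap_eq {K : ℕ} (hK : 1 ≤ K) (μ : ℕ → Fin K → ℝ) (t : ℕ) (a : Fin K) :
    worstGap μ t a = (⨆ a', μ t a') - μ t a := by
  have : Nonempty (Fin K) := ⟨⟨0, hK⟩⟩
  unfold worstGap
  rw [← ciSup_sub (Finite.bddAbove_range _)]

theorem sub_le_worstGap {K : ℕ} (μ : ℕ → Fin K → ℝ) (t : ℕ) (a a' : Fin K) :
    μ t a' - μ t a ≤ worstGap μ t a :=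
  le_ciSup (f := fun a' => μ t a' - μ t a) (Finite.bddAbove_range _) a'

theorem worstGap_nonneg {K : ℕ} (μ : ℕ → Fin K → ℝ) (t : ℕ) (a : Fin K) : 0 ≤ worstGap μ t a := by
  simpa using sub_le_worstGap μ t a a

theorem worstGap_le_one {K : ℕ} (μ : ℕ → Fin K → ℝ) (hμ : ∀ t a, μ t a ∈ Set.Icc (0 : ℝ) 1)
    (t : ℕ) (a : Fin K) : worstGap μ t a ≤ 1 := by
  have : Nonempty (Fin K) := ⟨a⟩
  exact ciSup_le fun a' => by linarith [(hμ t a').2, (hμ t a).1]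

theorem worstGap_sub {K : ℕ} (μ : ℕ → Fin K → ℝ) (t : ℕ) (a b : Fin K) :
    worstGap μ t a - worstGap μ t b = μ t b - μ t a := by
  have hK : 1 ≤ K := by have := a.pos; omega
  rw [worstGap_eq hK, worstGap_eq hK]; ring

theorem mem_evicted {K : ℕ} {C₀ : ℝ} {T : ℕ} {est : ℕ → Fin K → ℝ} {lo t : ℕ} {a : Fin K} :
    a ∈ evicted C₀ T est lo t ↔ ∃ s₁ s₂ : ℕ, lo ≤ s₁ ∧ s₁ < s₂ ∧ s₂ < t ∧ ∃ a' : Fin K,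
    Real.log T * √(C₀ * max ((K : ℝ) * ((s₂ : ℝ) - (s₁ : ℝ))) ((K : ℝ) ^ 2))
      < ∑ s ∈ Finset.Icc s₁ s₂, (est s a' - est s a) := by
  simp [evicted]

theorem evicted_mono {K : ℕ} {C₀ : ℝ} {T : ℕ} {est : ℕ → Fin K → ℝ} {lo lo' t t' : ℕ}
    (h : lo' ≤ lo) (h' : t ≤ t') : evicted C₀ T est lo t ⊆ evicted C₀ T est lo' t' := by
  intro a ha
  obtain ⟨s₁, s₂, h1, h2, h3, h4⟩ := mem_evicted.1 ha
  exact mem_evicted.2 ⟨s₁, s₂, h.trans h1, h2, h3.trans_le h', h4⟩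

theorem evicted_congr {K : ℕ} {C₀ : ℝ} {T : ℕ} {est est' : ℕ → Fin K → ℝ} {lo t : ℕ}
    (h : ∀ s, lo ≤ s → s < t → est s = est' s) :
    evicted C₀ T est lo t = evicted C₀ T est' lo t := by
  ext a
  rw [mem_evicted, mem_evicted]
  refine exists_congr fun s₁ => exists_congr fun s₂ => ?_
  refine and_congr_right fun h1 => and_congr_right fun h2 => and_congr_right fun h3 => ?_
  refine exists_congr fun a' => ?_
  rw [Finset.sum_congr rfl fun s hs => ?_]
  rw [Finset.mem_Icc] at hs
  rw [h s (by omega) (by omega)]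

theorem evicted_self {K : ℕ} {C₀ : ℝ} {T : ℕ} {est : ℕ → Fin K → ℝ} (t : ℕ) :
    evicted C₀ T est t t = ∅ := by
  ext a
  simp only [mem_evicted, Finset.notMem_empty, iff_false]
  rintro ⟨s₁, s₂, h1, h2, h3, -⟩
  omega

/-! ### Trajectories without a call stack -/

/-- A trajectory of the algorithm over the rounds `1, …, T` in stack-free form. Round `t` belongs to
the episode started at `ep t`; a replay of duration `rlen t` starts at `t` if `rlen t ≠ 0`; the call
active at round `t` is the one started at `act t`, the latest call of the episode that has not
expired; and `arms t` is the candidate set at round `t`.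

The candidate set is a function of `est` and `act` alone: eviction is monotone in the interval of
rounds, so that the arms removed earlier by the active call are evicted again. The master set needs no
component of its own for the same reason: once updated at round `t`, it consists of the arms that are
not evicted on `[ep t, t)`. -/
structure IsRun {K : ℕ} (C₀ : ℝ) (T : ℕ) (ep rlen act : ℕ → ℕ) (arms : ℕ → Finset (Fin K))
    (est : ℕ → Fin K → ℝ) : Prop where
  ep_one : ep 1 = 1
  rlen_one : rlen 1 = 0
  ep_succ : ∀ t, 1 ≤ t → t < T → ep (t + 1) = ep t ∨
    (ep (t + 1) = t + 1 ∧ rlen (t + 1) = 0 ∧ evicted C₀ T est (ep t) (t + 1) = Finset.univ)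
  check : ∀ t, 1 ≤ t → t ≤ T → ep t < t → rlen t = 0 → evicted C₀ T est (ep t) t ≠ Finset.univ
  act_ge : ∀ t, 1 ≤ t → t ≤ T → ep t ≤ act t
  act_le : ∀ t, 1 ≤ t → t ≤ T → act t ≤ t
  act_live : ∀ t, 1 ≤ t → t ≤ T →
    act t = ep t ∨ (ep t < act t ∧ 0 < rlen (act t) ∧ t ≤ act t + rlen (act t))
  act_last : ∀ t, 1 ≤ t → t ≤ T → ∀ s, act t < s → s ≤ t → 0 < rlen s → s + rlen s < t
  arms_eq : ∀ t, 1 ≤ t → t ≤ T → arms t = Finset.univ \ evicted C₀ T est (act t) t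

namespace IsRun

variable {K : ℕ} {C₀ : ℝ} {T : ℕ} {ep rlen act : ℕ → ℕ} {arms : ℕ → Finset (Fin K)}
  {est : ℕ → Fin K → ℝ}

theorem ep_bounds (h : IsRun C₀ T ep rlen act arms est) {t : ℕ} (h1 : 1 ≤ t) (hT : t ≤ T) :
    1 ≤ ep t ∧ ep t ≤ t := by
  induction t, h1 using Nat.le_induction with
  | base => simp [h.ep_one]
  | succ t h1 ih =>
    have := ih (by omega)
    rcases h.ep_succ t h1 (by omega) with h2 | h2 <;> omega

theorem ep_eq (h : IsRun C₀ T ep rlen act arms est) {s t : ℕ} (h1 : 1 ≤ t) (hT : t ≤ T)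
    (hs : ep t ≤ s) (hst : s ≤ t) : ep s = ep t := by
  induction t, h1 using Nat.le_induction with
  | base =>
    have := h.ep_one
    obtain rfl : s = 1 := by omega
    rfl
  | succ t h1 ih =>
    rcases Nat.lt_or_ge t s with h3 | h3
    · obtain rfl : s = t + 1 := by omega
      rfl
    · rcases h.ep_succ t h1 (by omega) with h2 | h2
      · rw [h2] at hs ⊢
        exact ih (by omega) hs h3
      · omega

theorem ep_mono (h : IsRun C₀ T ep rlen act arms est) {s t : ℕ} (h1 : 1 ≤ s) (hst : s ≤ t)
    (hT : t ≤ T) : ep s ≤ ep t := by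
  by_contra hc
  have h2 := h.ep_bounds h1 (hst.trans hT)
  have := h.ep_eq (h1.trans hst) hT (by omega) hst
  omega

theorem ep_ep (h : IsRun C₀ T ep rlen act arms est) {t : ℕ} (h1 : 1 ≤ t) (hT : t ≤ T) :
    ep (ep t) = ep t :=
  h.ep_eq h1 hT le_rfl (h.ep_bounds h1 hT).2

/-- Between the start of a call and a round at which it is active, no call that started earlier is
active. -/
theorem act_le_act (h : IsRun C₀ T ep rlen act arms est) {s t : ℕ} (h1 : 1 ≤ t) (hT : t ≤ T)
    (hs : act t ≤ s) (hst : s ≤ t) : act t ≤ act s := by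
  have hb := h.ep_bounds h1 hT
  have hge := h.act_ge t h1 hT
  rcases h.act_live t h1 hT with h2 | ⟨-, h3, h4⟩
  · have := h.ep_eq h1 hT (by omega) hst
    have := h.act_ge s (by omega) (by omega)
    omega
  · by_contra hc
    have := h.act_last s (by omega) (by omega) (act t) (by omega) hs h3
    omega

theorem le_act_of_replay (h : IsRun C₀ T ep rlen act arms est) {r s : ℕ} (h1 : 1 ≤ s) (hT : s ≤ T)
    (hr : 0 < rlen r) (hrs : r ≤ s) (hs : s ≤ r + rlen r) : r ≤ act s := by
  by_contra hc
  have := h.act_last s h1 hT r (by omega) hrs hr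
  omega

theorem act_eq_of_replay (h : IsRun C₀ T ep rlen act arms est) {r : ℕ} (h1 : 1 ≤ r) (hT : r ≤ T)
    (hr : 0 < rlen r) : act r = r :=
  le_antisymm (h.act_le r h1 hT) (h.le_act_of_replay h1 hT hr le_rfl (by omega))

theorem act_lt_of_check (h : IsRun C₀ T ep rlen act arms est) {t : ℕ} (h1 : 1 ≤ t) (hT : t ≤ T)
    (he : ep t < t) (hr : rlen t = 0) : act t < t := by
  refine lt_of_le_of_ne (h.act_le t h1 hT) fun hc => ?_
  rcases h.act_live t h1 hT with h2 | ⟨-, h3, -⟩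
  · omega
  · rw [hc] at h3; omega

theorem mem_arms (h : IsRun C₀ T ep rlen act arms est) {t : ℕ} (h1 : 1 ≤ t) (hT : t ≤ T)
    {a : Fin K} : a ∈ arms t ↔ a ∉ evicted C₀ T est (act t) t := by
  simp [h.arms_eq t h1 hT]

theorem mem_arms_of_notMem_evicted (h : IsRun C₀ T ep rlen act arms est) {lo s t : ℕ} (h1 : 1 ≤ s)
    (hT : s ≤ T) (hlo : lo ≤ act s) (hst : s ≤ t) {a : Fin K} (ha : a ∉ evicted C₀ T est lo t) :
    a ∈ arms s :=
  (h.mem_arms h1 hT).2 fun hc => ha (evicted_mono hlo hst hc)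

theorem arms_eq_univ_of_act_eq (h : IsRun C₀ T ep rlen act arms est) {t : ℕ} (h1 : 1 ≤ t)
    (hT : t ≤ T) (ht : act t = t) : arms t = Finset.univ := by
  rw [h.arms_eq t h1 hT, ht, evicted_self, Finset.sdiff_empty]

theorem arms_nonempty (h : IsRun C₀ T ep rlen act arms est) (hK : 1 ≤ K) {t : ℕ} (h1 : 1 ≤ t)
    (hT : t ≤ T) : (arms t).Nonempty := by
  have : Nonempty (Fin K) := ⟨⟨0, hK⟩⟩
  by_cases hc : ep t < t ∧ rlen t = 0
  · have hne := h.check t h1 hT hc.1 hc.2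
    obtain ⟨a, ha⟩ : ∃ a, a ∉ evicted C₀ T est (ep t) t := by
      by_contra hcon
      push Not at hcon
      exact hne (Finset.eq_univ_iff_forall.2 hcon)
    exact ⟨a, h.mem_arms_of_notMem_evicted h1 hT (h.act_ge t h1 hT) le_rfl ha⟩
  · rw [h.arms_eq_univ_of_act_eq h1 hT]
    · exact Finset.univ_nonempty
    · rcases Nat.eq_zero_or_pos (rlen t) with h0 | h0
      · have := h.act_ge t h1 hT
        have := h.act_le t h1 hT
        omega
      · exact h.act_eq_of_replay h1 hT h0

end IsRun

/-! ### Consequences of concentration -/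

/-- The conditional mean of the importance-weighted reward of arm `a` at round `s`. -/
noncomputable def estMean {K : ℕ} (μ : ℕ → Fin K → ℝ) (arms : ℕ → Finset (Fin K)) (s : ℕ)
    (a : Fin K) : ℝ :=
  if a ∈ arms s then μ s a else 0

/-- All interval sums of estimated gaps are close to the sums of their conditional means. The
one-sided bound suffices, since the roles of `a` and `a'` can be exchanged. -/
def Concentrated {K : ℕ} (T : ℕ) (μ : ℕ → Fin K → ℝ) (arms : ℕ → Finset (Fin K))
    (est : ℕ → Fin K → ℝ) : Prop :=
  ∀ s₁ s₂ : ℕ, 1 ≤ s₁ → s₁ ≤ s₂ → s₂ ≤ T → ∀ a a' : Fin K,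
    ∑ s ∈ Finset.Icc s₁ s₂, ((est s a' - est s a) - (estMean μ arms s a' - estMean μ arms s a)) ≤
      12 * Real.log T * √(max ((K : ℝ) * ((s₂ : ℝ) - s₁ + 1)) ((K : ℝ) ^ 2))

theorem sixty_nine_le_log {T : ℕ} (hT : 2 ≤ T) : (0.69 : ℝ) ≤ Real.log T := by
  have h1 := Real.log_two_gt_d9
  have h2 : Real.log 2 ≤ Real.log T := Real.log_le_log (by norm_num) (by exact_mod_cast hT)
  linarith

/-- The form of concentration that matches the eviction threshold. The constant grows from `12` to
`17 ≥ 12 √2`, since an interval of `n ≥ 2` rounds enters the threshold with `n - 1 ≥ n / 2`. -/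
theorem Concentrated.le_of_lt {K : ℕ} {T : ℕ} {μ : ℕ → Fin K → ℝ} {arms : ℕ → Finset (Fin K)}
    {est : ℕ → Fin K → ℝ} (hT : 2 ≤ T) (hc : Concentrated T μ arms est) {s₁ s₂ : ℕ} (h1 : 1 ≤ s₁)
    (h12 : s₁ < s₂) (h2 : s₂ ≤ T) (a a' : Fin K) :
    ∑ s ∈ Finset.Icc s₁ s₂, (est s a' - est s a) -
      ∑ s ∈ Finset.Icc s₁ s₂, (estMean μ arms s a' - estMean μ arms s a) ≤
      17 * Real.log T * √(max ((K : ℝ) * ((s₂ : ℝ) - s₁)) ((K : ℝ) ^ 2)) := by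
  have hL := sixty_nine_le_log hT
  rw [← Finset.sum_sub_distrib]
  refine (hc s₁ s₂ h1 h12.le h2 a a').trans ?_
  set X := max ((K : ℝ) * ((s₂ : ℝ) - s₁)) ((K : ℝ) ^ 2) with hX
  have h12' : (s₁ : ℝ) + 1 ≤ s₂ := by exact_mod_cast h12
  have hX0 : 0 ≤ X := le_max_of_le_right (by positivity)
  have hle : max ((K : ℝ) * ((s₂ : ℝ) - s₁ + 1)) ((K : ℝ) ^ 2) ≤ 2 * X := by
    refine max_le ?_ ?_
    · have : (K : ℝ) * ((s₂ : ℝ) - s₁ + 1) ≤ 2 * (K * ((s₂ : ℝ) - s₁)) := by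
        nlinarith [(Nat.cast_nonneg K : (0 : ℝ) ≤ K)]
      exact this.trans (by gcongr; exact le_max_left _ _)
    · have := le_max_right ((K : ℝ) * ((s₂ : ℝ) - s₁)) ((K : ℝ) ^ 2)
      linarith
  have hs : √(max ((K : ℝ) * ((s₂ : ℝ) - s₁ + 1)) ((K : ℝ) ^ 2)) ≤ 17 / 12 * √X := by
    rw [show (17 / 12 : ℝ) * √X = √((17 / 12) ^ 2 * X) by
      rw [Real.sqrt_mul (by positivity), Real.sqrt_sq (by positivity)]]
    exact Real.sqrt_le_sqrt (by linarith)
  have : 12 * Real.log T * (17 / 12 * √X) = 17 * Real.log T * √X := by ring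
  rw [← this]
  gcongr

section

variable {K : ℕ} {C₀ : ℝ} {T : ℕ} {ep rlen act : ℕ → ℕ} {arms : ℕ → Finset (Fin K)}
  {est : ℕ → Fin K → ℝ} {μ : ℕ → Fin K → ℝ}

/-- An arm that is evicted on the strength of the rounds `[lo, t)` has incurred significant regret
there, if no call started before `lo` is active in between. At the first eviction the arm is
a candidate throughout the offending interval, and then concentration applies. -/
theorem exists_significantRegret (h : IsRun C₀ T ep rlen act arms est) (hT : 2 ≤ T)
    (hC : 400 ≤ C₀) (hμ : ∀ t a, μ t a ∈ Set.Icc (0 : ℝ) 1) (hc : Concentrated T μ arms est)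
    {lo : ℕ} (h1 : 1 ≤ lo) (a : Fin K) (t : ℕ) (ht : t ≤ T + 1)
    (hlo : ∀ s, lo ≤ s → s < t → lo ≤ act s) (ha : a ∈ evicted C₀ T est lo t) :
    ∃ s₁ s₂, lo ≤ s₁ ∧ s₁ < s₂ ∧ s₂ < t ∧ SignificantRegret μ a s₁ s₂ := by
  induction t using Nat.strong_induction_on with
  | _ t ih =>
  obtain ⟨s₁, s₂, h2, h3, h4, a', h5⟩ := mem_evicted.1 ha
  by_cases hall : ∀ s ∈ Finset.Icc s₁ s₂, a ∈ arms s
  · refine ⟨s₁, s₂, h2, h3, h4, ?_⟩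
    have hL := sixty_nine_le_log hT
    have hcc := hc.le_of_lt hT (h1.trans h2) h3 (by omega) a a'
    set X := max ((K : ℝ) * ((s₂ : ℝ) - s₁)) ((K : ℝ) ^ 2) with hX
    -- `√C₀ ≥ 20` leaves `3 log T ≥ 1` on top of the deviation `17 log T`
    have h20 : 20 ≤ √C₀ := by
      rw [show (20 : ℝ) = √(20 ^ 2) by rw [Real.sqrt_sq (by norm_num)]]
      exact Real.sqrt_le_sqrt (by linarith)
    have h6 : 20 * Real.log T * √X ≤ Real.log T * √(C₀ * X) := by
      rw [Real.sqrt_mul (by linarith)]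
      have : 0 ≤ Real.log T * √X := by positivity
      nlinarith
    have h7 : √X ≤ 3 * Real.log T * √X := by
      have : 0 ≤ √X := Real.sqrt_nonneg _
      nlinarith
    have h8 : √((K : ℝ) * ((s₂ : ℝ) - s₁)) ≤ √X := Real.sqrt_le_sqrt (le_max_left _ _)
    unfold SignificantRegret
    have h9 : ∑ s ∈ Finset.Icc s₁ s₂, (estMean μ arms s a' - estMean μ arms s a) ≤
        ∑ s ∈ Finset.Icc s₁ s₂, worstGap μ s a := by
      refine Finset.sum_le_sum fun s hs => ?_
      refine le_trans ?_ (sub_le_worstGap μ s a a')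
      unfold estMean
      rw [if_pos (hall s hs)]
      split_ifs
      · exact le_rfl
      · linarith [(hμ s a').1]
    linarith
  -- otherwise `a` was evicted from a call within `[lo, t)` already before round `s ≤ s₂`
  · push Not at hall
    obtain ⟨s, hs, hsa⟩ := hall
    rw [Finset.mem_Icc] at hs
    have hsa' : a ∈ evicted C₀ T est (act s) s := by
      by_contra hcon
      exact hsa ((h.mem_arms (by omega) (by omega)).2 hcon)
    obtain ⟨r₁, r₂, g1, g2, g3, g4⟩ := ih s (by omega) (by omega)
      (fun r hr hrs => hlo r hr (by omega))
      (evicted_mono (hlo s (by omega) (by omega)) le_rfl hsa')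
    exact ⟨r₁, r₂, g1, g2, by omega, g4⟩

/-- Over an interval on which `a` and `b` are candidates, the reward of `b` cannot exceed that of `a`
by much if `a` is not evicted afterwards. Intervals of at most `K` rounds are trivial. -/
theorem sum_sub_le (hT : 2 ≤ T) (hC : 0 ≤ C₀) (hμ : ∀ t a, μ t a ∈ Set.Icc (0 : ℝ) 1)
    (hc : Concentrated T μ arms est) {lo t s₁ s₂ : ℕ} (h1 : 1 ≤ s₁)
    (hlo : lo ≤ s₁) (h12 : s₁ ≤ s₂) (h2 : s₂ < t) (h2T : s₂ ≤ T) {a b : Fin K}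
    (hev : a ∉ evicted C₀ T est lo t)
    (ha : ∀ s ∈ Finset.Icc s₁ s₂, a ∈ arms s) (hb : ∀ s ∈ Finset.Icc s₁ s₂, b ∈ arms s) :
    ∑ s ∈ Finset.Icc s₁ s₂, (μ s b - μ s a) ≤
      (√C₀ + 12) * Real.log T * √((K : ℝ) * ((s₂ : ℝ) - s₁ + 1)) := by
  have hL := sixty_nine_le_log hT
  have hK : (1 : ℝ) ≤ K := by exact_mod_cast a.pos
  have h12' : (s₁ : ℝ) ≤ s₂ := by exact_mod_cast h12
  set n : ℝ := (s₂ : ℝ) - s₁ + 1 with hn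
  have hn1 : 1 ≤ n := by linarith
  have hC' := Real.sqrt_nonneg C₀
  by_cases hnK : n ≤ K
  · have hsum : ∑ s ∈ Finset.Icc s₁ s₂, (μ s b - μ s a) ≤ n := by
      calc ∑ s ∈ Finset.Icc s₁ s₂, (μ s b - μ s a) ≤ ∑ s ∈ Finset.Icc s₁ s₂, (1 : ℝ) :=
            Finset.sum_le_sum fun s _ => by linarith [(hμ s b).2, (hμ s a).1]
        _ = n := by
            rw [Finset.sum_const, Nat.card_Icc, nsmul_eq_mul, mul_one, Nat.cast_sub (by omega)]
            push_cast; ring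
    have h3 : n ≤ √((K : ℝ) * n) := Real.le_sqrt_of_sq_le (by nlinarith)
    have h4 : 1 ≤ (√C₀ + 12) * Real.log T := by nlinarith
    nlinarith [Real.sqrt_nonneg ((K : ℝ) * n)]
  · push Not at hnK
    have hlt : s₁ < s₂ := by
      rcases h12.lt_or_eq with h | h
      · exact h
      · exfalso; rw [h] at hn; linarith
    have hest : ∑ s ∈ Finset.Icc s₁ s₂, (est s b - est s a) ≤
        Real.log T * √(C₀ * max ((K : ℝ) * ((s₂ : ℝ) - (s₁ : ℝ))) ((K : ℝ) ^ 2)) := by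
      by_contra hcon
      exact hev (mem_evicted.2 ⟨s₁, s₂, hlo, hlt, h2, b, not_le.1 hcon⟩)
    have hX : max ((K : ℝ) * ((s₂ : ℝ) - (s₁ : ℝ))) ((K : ℝ) ^ 2) ≤ K * n :=
      max_le (by nlinarith) (by nlinarith)
    have hcc := hc s₁ s₂ h1 h12 h2T b a
    rw [max_eq_left (by nlinarith), Finset.sum_sub_distrib] at hcc
    have hmean : ∑ s ∈ Finset.Icc s₁ s₂, (estMean μ arms s a - estMean μ arms s b) =
        -∑ s ∈ Finset.Icc s₁ s₂, (μ s b - μ s a) := by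
      rw [← Finset.sum_neg_distrib]
      refine Finset.sum_congr rfl fun s hs => ?_
      unfold estMean
      rw [if_pos (ha s hs), if_pos (hb s hs)]; ring
    have hneg : ∑ s ∈ Finset.Icc s₁ s₂, (est s a - est s b) =
        -∑ s ∈ Finset.Icc s₁ s₂, (est s b - est s a) := by
      rw [← Finset.sum_neg_distrib]
      exact Finset.sum_congr rfl fun s hs => by ring
    rw [hmean, hneg] at hcc
    have hest2 : Real.log T * √(C₀ * max ((K : ℝ) * ((s₂ : ℝ) - (s₁ : ℝ))) ((K : ℝ) ^ 2)) ≤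
        √C₀ * Real.log T * √((K : ℝ) * n) := by
      rw [Real.sqrt_mul hC]
      have : √(max ((K : ℝ) * ((s₂ : ℝ) - (s₁ : ℝ))) ((K : ℝ) ^ 2)) ≤ √(K * n) :=
        Real.sqrt_le_sqrt hX
      have := mul_le_mul_of_nonneg_left this (mul_nonneg hC' (by linarith : 0 ≤ Real.log T))
      linarith
    linarith

end

/-! ### Regret at the check rounds of an episode -/

section

variable {K : ℕ} {C₀ : ℝ} {T : ℕ} {ep rlen act : ℕ → ℕ} {arms : ℕ → Finset (Fin K)}
  {est : ℕ → Fin K → ℝ} {μ : ℕ → Fin K → ℝ}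

/-- The check rounds of the episode that starts at `e`: those of its rounds at which no call starts,
so that the active call has just evicted arms. -/
def checkRounds (T : ℕ) (ep rlen : ℕ → ℕ) (e : ℕ) : Finset ℕ :=
  (Finset.Icc 1 T).filter fun t => ep t = e ∧ e < t ∧ rlen t = 0

/-- The check rounds of the episode `e` at which the call started at `s` is active. -/
def ownRounds (T : ℕ) (ep rlen act : ℕ → ℕ) (e s : ℕ) : Finset ℕ :=
  (checkRounds T ep rlen e).filter fun t => act t = s

/-- The replay started at `g` interrupts the call started at `s`, which resumes at some later round
`t`, and `g` is the first replay in this interruption that reaches some round `r`. The intervals of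
the replays charged to `s` cover the interruptions of `s`. -/
def Charged (T : ℕ) (ep rlen act : ℕ → ℕ) (e s g : ℕ) : Prop :=
  s < g ∧ 0 < rlen g ∧ ep g = e ∧ ∃ t ∈ ownRounds T ep rlen act e s, g + rlen g < t ∧
    ∃ r ≤ g + rlen g, ∀ u, s < u → u < g → 0 < rlen u → u + rlen u < r

theorem mem_ownRounds {e s t : ℕ} : t ∈ ownRounds T ep rlen act e s ↔
    1 ≤ t ∧ t ≤ T ∧ ep t = e ∧ e < t ∧ rlen t = 0 ∧ act t = s := by
  simp only [ownRounds, checkRounds, Finset.mem_filter, Finset.mem_Icc]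
  tauto

/-- If a replay were charged to two calls, the one that started later would itself reach beyond the
replay and hence be the first one to cover the round in question. -/
theorem Charged.unique (h : IsRun C₀ T ep rlen act arms est) {e s s' g : ℕ}
    (hs : Charged T ep rlen act e s g) (hs' : Charged T ep rlen act e s' g) : s = s' := by
  suffices H : ∀ s s', Charged T ep rlen act e s g → Charged T ep rlen act e s' g → ¬ s < s' from
    le_antisymm (not_lt.1 (H s' s hs' hs)) (not_lt.1 (H s s' hs hs'))
  rintro s s' ⟨h1, h2, -, t, ht, h3, r, hr, h4⟩ ⟨h1', -, -, t', ht', h3', -⟩ hlt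
  obtain ⟨a1, a2, a3, a4, a5, a6⟩ := mem_ownRounds.1 ht
  obtain ⟨b1, b2, b3, b4, b5, b6⟩ := mem_ownRounds.1 ht'
  have hge := h.act_ge t a1 a2
  rcases h.act_live t' b1 b2 with h5 | ⟨h5, h6, h7⟩
  · omega
  · rw [b6] at h5 h6 h7
    have := h4 s' hlt h1' h6
    omega

/-- The first replay started after `s` that covers round `r`. -/
noncomputable def coveringReplay (rlen : ℕ → ℕ) (s r : ℕ) : ℕ :=
  sInf {g | s < g ∧ g ≤ r ∧ 0 < rlen g ∧ r ≤ g + rlen g}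

theorem coveringReplay_mem {rlen : ℕ → ℕ} {s r g : ℕ}
    (hg : g ∈ {g | s < g ∧ g ≤ r ∧ 0 < rlen g ∧ r ≤ g + rlen g}) :
    coveringReplay rlen s r ∈ {g | s < g ∧ g ≤ r ∧ 0 < rlen g ∧ r ≤ g + rlen g} :=
  Nat.sInf_mem ⟨g, hg⟩

theorem coveringReplay_le {rlen : ℕ → ℕ} {s r g : ℕ}
    (hg : g ∈ {g | s < g ∧ g ≤ r ∧ 0 < rlen g ∧ r ≤ g + rlen g}) : coveringReplay rlen s r ≤ g :=
  Nat.sInf_le hg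

/-- Bound for the gaps to the arm `b` summed over the rounds of one call at which `a` is a
candidate: an interval minus the interruptions of the call, over each of which `a` and `b` collect
about the same reward. -/
theorem sum_ownRounds_le (h : IsRun C₀ T ep rlen act arms est) (hT : 2 ≤ T) (hC : 0 ≤ C₀)
    (hμ : ∀ t a, μ t a ∈ Set.Icc (0 : ℝ) 1) (hc : Concentrated T μ arms est) {e s : ℕ} {b : Fin K}
    (hb : ∀ t ∈ ownRounds T ep rlen act e s, b ∈ arms t) {D : ℝ} (hD0 : 0 ≤ D)
    (hD : ∀ t ∈ ownRounds T ep rlen act e s, (t : ℝ) - s ≤ D) (a : Fin K) (j : ℕ) :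
    open Classical in
    ∑ t ∈ ownRounds T ep rlen act e s with j ≤ t ∧ a ∈ arms t, (μ t b - μ t a) ≤
      (√C₀ + 14) * Real.log T * √(K * D) +
        ∑ g ∈ Finset.Icc 1 T with Charged T ep rlen act e s g,
          (√C₀ + 14) * Real.log T * √(K * ((rlen g : ℝ) + 1)) := by
  classical
  have hL := sixty_nine_le_log hT
  have hC' := Real.sqrt_nonneg C₀
  have hK : (1 : ℝ) ≤ K := by exact_mod_cast a.pos
  set O := ownRounds T ep rlen act e s with hO
  set F := O.filter fun t => j ≤ t ∧ a ∈ arms t with hF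
  have hrhs : ∀ x : ℝ, 0 ≤ x → 0 ≤ (√C₀ + 14) * Real.log T * √(K * x) := fun x hx => by positivity
  have hrhs2 : 0 ≤ ∑ g ∈ Finset.Icc 1 T with Charged T ep rlen act e s g,
          (√C₀ + 14) * Real.log T * √(K * ((rlen g : ℝ) + 1)) :=
    Finset.sum_nonneg fun g _ => hrhs _ (by positivity)
  by_cases hne : F.Nonempty
  swap
  · rw [Finset.not_nonempty_iff_eq_empty.1 hne, Finset.sum_empty]
    have := hrhs D hD0
    linarith
  -- `a` and `b` have not been evicted before `tm`, the last round in question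
  set tm := F.max' hne with htm
  have htmF : tm ∈ F := F.max'_mem hne
  obtain ⟨htmO, hjtm, hatm⟩ := Finset.mem_filter.1 htmF
  obtain ⟨m1, m2, m3, m4, m5, m6⟩ := mem_ownRounds.1 htmO
  have hstm : s < tm := m6 ▸ h.act_lt_of_check m1 m2 (by omega) m5
  have hes : e ≤ s := by have := h.act_ge tm m1 m2; omega
  have he1 : 1 ≤ e := by have := (h.ep_bounds m1 m2).1; omega
  have hacts : ∀ r, s ≤ r → r ≤ tm → s ≤ act r := fun r h1 h2 => by
    have := h.act_le_act m1 m2 (by omega : act tm ≤ r) h2; omega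
  have heps : ∀ r, s ≤ r → r ≤ tm → ep r = e := fun r h1 h2 => by
    rw [← m3]; exact h.ep_eq m1 m2 (by omega) h2
  have hevA : a ∉ evicted C₀ T est s tm := by
    have := (h.mem_arms m1 m2).1 hatm; rwa [m6] at this
  have hevB : b ∉ evicted C₀ T est s tm := by
    have := (h.mem_arms m1 m2).1 (hb tm htmO); rwa [m6] at this
  have hA : ∀ r, s ≤ r → r ≤ tm → a ∈ arms r := fun r h1 h2 =>
    h.mem_arms_of_notMem_evicted (by omega) (by omega) (hacts r h1 h2) h2 hevA
  have hB : ∀ r, s ≤ r → r ≤ tm → b ∈ arms r := fun r h1 h2 =>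
    h.mem_arms_of_notMem_evicted (by omega) (by omega) (hacts r h1 h2) h2 hevB
  set j' := max j (s + 1) with hj'
  set J := Finset.Icc j' tm with hJ
  have hj'tm : j' ≤ tm := by omega
  have hFJ : F ⊆ J := by
    intro t ht
    have h1 := F.le_max' t ht
    obtain ⟨htO, hjt, -⟩ := Finset.mem_filter.1 ht
    obtain ⟨c1, c2, c3, c4, c5, c6⟩ := mem_ownRounds.1 htO
    have := h.act_lt_of_check c1 c2 (by omega) c5
    rw [hJ, Finset.mem_Icc]
    omega
  have hsplit : ∑ t ∈ F, (μ t b - μ t a) =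
      ∑ t ∈ J, (μ t b - μ t a) - ∑ t ∈ J \ F, (μ t b - μ t a) := by
    rw [← Finset.sum_sdiff hFJ]; ring
  -- the last round is split off, since eviction at `tm` only takes the rounds before `tm` into account
  have htotal : ∑ t ∈ J, (μ t b - μ t a) ≤ (√C₀ + 14) * Real.log T * √(K * D) := by
    have hDle : (tm : ℝ) - s ≤ D := hD tm htmO
    have hstm' : (s : ℝ) + 1 ≤ tm := by exact_mod_cast hstm
    have hD1 : 1 ≤ D := by linarith
    have hsq1 : 1 ≤ √(K * D) := Real.one_le_sqrt.2 (by nlinarith)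
    rw [hJ, ← Finset.Ico_insert_right hj'tm, Finset.sum_insert Finset.right_notMem_Ico]
    have hlast : μ tm b - μ tm a ≤ 1 := by linarith [(hμ tm b).2, (hμ tm a).1]
    have hrest : ∑ t ∈ Finset.Ico j' tm, (μ t b - μ t a) ≤
        (√C₀ + 12) * Real.log T * √(K * D) := by
      rcases hj'tm.eq_or_lt with heq | hlt
      · rw [heq, Finset.Ico_self, Finset.sum_empty]; positivity
      · have hIco : Finset.Ico j' tm = Finset.Icc j' (tm - 1) := by ext; simp; omega
        rw [hIco]
        refine (sum_sub_le (lo := s) (t := tm) hT hC hμ hc (by omega) (by omega) (by omega)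
          (by omega) (by omega) hevA (fun r hr => ?_) (fun r hr => ?_)).trans ?_
        · rw [Finset.mem_Icc] at hr; exact hA r (by omega) (by omega)
        · rw [Finset.mem_Icc] at hr; exact hB r (by omega) (by omega)
        · have hle : ((tm - 1 : ℕ) : ℝ) - j' + 1 ≤ D := by
            have h1 : (j' : ℝ) ≥ s + 1 := by exact_mod_cast le_max_right _ _
            rw [Nat.cast_sub (by omega)]; push_cast; linarith
          gcongr
    nlinarith
  -- each round of an interruption is covered by a replay that is charged to the call
  have hgap : ∀ r ∈ J \ F, Charged T ep rlen act e s (coveringReplay rlen s r) ∧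
      coveringReplay rlen s r ∈ {g | s < g ∧ g ≤ r ∧ 0 < rlen g ∧ r ≤ g + rlen g} ∧ r < tm := by
    intro r hr
    obtain ⟨hrJ, hrF⟩ := Finset.mem_sdiff.1 hr
    have hrtm : r ≠ tm := fun hcon => hrF (hcon ▸ htmF)
    rw [hJ, Finset.mem_Icc] at hrJ
    have hr1 : 1 ≤ r := by omega
    have hrT : r ≤ T := by omega
    have hsr := hacts r (by omega) (by omega)
    have her := heps r (by omega) (by omega)
    have hlt : s < act r := by
      refine lt_of_le_of_ne hsr fun hcon => ?_
      have hrl : rlen r = 0 := by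
        by_contra hpos
        have := h.act_eq_of_replay hr1 hrT (Nat.pos_of_ne_zero hpos)
        omega
      refine hrF (Finset.mem_filter.2 ⟨mem_ownRounds.2 ⟨hr1, hrT, her, by omega, hrl, hcon.symm⟩,
        by omega, hA r (by omega) (by omega)⟩)
    have hne' : (act r) ∈ {g | s < g ∧ g ≤ r ∧ 0 < rlen g ∧ r ≤ g + rlen g} := by
      refine ⟨hlt, h.act_le r hr1 hrT, ?_⟩
      rcases h.act_live r hr1 hrT with h5 | h5
      · omega
      · exact h5.2
    have hmem := coveringReplay_mem hne'
    refine ⟨⟨hmem.1, hmem.2.2.1, ?_, tm, htmO, ?_, r, hmem.2.2.2, ?_⟩, hmem, by omega⟩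
    · have h1 := hmem.1
      have h2 := hmem.2.1
      exact heps _ (by omega) (by omega)
    · have h1 := hmem.1
      have h2 := hmem.2.1
      exact h.act_last tm m1 m2 _ (by omega) (by omega) hmem.2.2.1
    · intro u hu hug hup
      by_contra hcon
      have h2 := hmem.2.1
      have := coveringReplay_le (show u ∈ {g | s < g ∧ g ≤ r ∧ 0 < rlen g ∧ r ≤ g + rlen g} from
        ⟨hu, by omega, hup, by omega⟩)
      omega
  have hholes : -∑ t ∈ J \ F, (μ t b - μ t a) ≤
      ∑ g ∈ Finset.Icc 1 T with Charged T ep rlen act e s g,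
          (√C₀ + 14) * Real.log T * √(K * ((rlen g : ℝ) + 1)) := by
    rw [← Finset.sum_neg_distrib, ← Finset.sum_fiberwise_of_maps_to
      (t := (Finset.Icc 1 T).filter fun g => Charged T ep rlen act e s g)
      (g := coveringReplay rlen s)]
    swap
    · intro r hr
      obtain ⟨hch, hmem, hrtm⟩ := hgap r hr
      have h1 := hmem.1
      have h2 := hmem.2.1
      exact Finset.mem_filter.2 ⟨Finset.mem_Icc.2 ⟨by omega, by omega⟩, hch⟩
    refine Finset.sum_le_sum fun g hg => ?_
    set G := (J \ F).filter fun r => coveringReplay rlen s r = g with hG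
    by_cases hGne : G.Nonempty
    swap
    · rw [Finset.not_nonempty_iff_eq_empty.1 hGne, Finset.sum_empty]
      exact hrhs _ (by positivity)
    have hGmem : ∀ r ∈ G, j' ≤ r ∧ r < tm ∧ g ≤ r ∧ s < g ∧ 0 < rlen g ∧ r ≤ g + rlen g := by
      intro r hr
      obtain ⟨hr1, hr2⟩ := Finset.mem_filter.1 hr
      obtain ⟨hch, hmem, hrtm⟩ := hgap r hr1
      rw [hr2] at hmem
      have := (Finset.mem_Icc.1 (Finset.mem_sdiff.1 hr1).1).1
      exact ⟨this, hrtm, hmem.2.1, hmem.1, hmem.2.2⟩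
    -- the rounds whose first covering replay is `g` form an interval
    have hGconn : ∀ p ∈ G, ∀ q ∈ G, ∀ c, p ≤ c → c ≤ q → c ∈ G := by
      intro p hp q hq c hpc hcq
      obtain ⟨p1, p2, p3, p4, p5, p6⟩ := hGmem p hp
      obtain ⟨q1, q2, q3, q4, q5, q6⟩ := hGmem q hq
      have hcg : g ∈ {g | s < g ∧ g ≤ c ∧ 0 < rlen g ∧ c ≤ g + rlen g} :=
        ⟨p4, by omega, p5, by omega⟩
      refine Finset.mem_filter.2 ⟨Finset.mem_sdiff.2 ⟨Finset.mem_Icc.2 ⟨by omega, by omega⟩,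
        fun hcF => ?_⟩, le_antisymm (coveringReplay_le hcg) ?_⟩
      · obtain ⟨c1, c2, c3, c4, c5, c6⟩ := mem_ownRounds.1 (Finset.mem_filter.1 hcF).1
        have := h.act_last c c1 c2 g (by omega) (by omega) p5
        omega
      · have hmem := coveringReplay_mem hcg
        by_contra hlt
        have h2 := hmem.2.1
        have h5 := coveringReplay_le
          (show coveringReplay rlen s c ∈ {g | s < g ∧ g ≤ p ∧ 0 < rlen g ∧ p ≤ g + rlen g} from
            ⟨hmem.1, by omega, hmem.2.2.1, by have := hmem.2.2.2; omega⟩)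
        have h6 := (Finset.mem_filter.1 hp).2
        omega
    have hIcc := eq_Icc_of_ordConnected G hGne hGconn
    obtain ⟨p1, p2, p3, p4, p5, p6⟩ := hGmem _ (G.min'_mem hGne)
    obtain ⟨q1, q2, q3, q4, q5, q6⟩ := hGmem _ (G.max'_mem hGne)
    have hpq := G.min'_le _ (G.max'_mem hGne)
    set p := G.min' hGne
    set q := G.max' hGne
    rw [hIcc]
    have := sum_sub_le (lo := s) (t := tm) (a := b) (b := a) hT hC hμ hc (s₁ := p) (s₂ := q)
      (by omega) (by omega) hpq (by omega) (by omega) hevB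
      (fun r hr => by rw [Finset.mem_Icc] at hr; exact hB r (by omega) (by omega))
      (fun r hr => by rw [Finset.mem_Icc] at hr; exact hA r (by omega) (by omega))
    simp only [neg_sub]
    refine this.trans ?_
    have hlen : (q : ℝ) - p + 1 ≤ (rlen g : ℝ) + 1 := by
      have h1 : (q : ℝ) ≤ g + rlen g := by exact_mod_cast q6
      have h2 : (g : ℝ) ≤ p := by exact_mod_cast p3
      linarith
    gcongr
    linarith
  linarith

theorem arms_subset_of_ownRounds (h : IsRun C₀ T ep rlen act arms est) {e s i j : ℕ}
    (hi : i ∈ ownRounds T ep rlen act e s) (hj : j ∈ ownRounds T ep rlen act e s) (hij : i ≤ j) :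
    arms j ⊆ arms i := by
  obtain ⟨a1, a2, a3, a4, a5, a6⟩ := mem_ownRounds.1 hi
  obtain ⟨b1, b2, b3, b4, b5, b6⟩ := mem_ownRounds.1 hj
  intro a ha
  have := (h.mem_arms b1 b2).1 ha
  exact h.mem_arms_of_notMem_evicted a1 a2 (by omega) hij this

/-- The expected regret of round `t` given the candidate set. -/
noncomputable def avgGap {K : ℕ} (μ : ℕ → Fin K → ℝ) (arms : ℕ → Finset (Fin K)) (t : ℕ) : ℝ :=
  (∑ a ∈ arms t, worstGap μ t a) / ((arms t).card : ℝ)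

theorem avgGap_le_one (hμ : ∀ t a, μ t a ∈ Set.Icc (0 : ℝ) 1) (t : ℕ) : avgGap μ arms t ≤ 1 := by
  unfold avgGap
  refine div_le_one_of_le₀ ?_ (Nat.cast_nonneg _)
  refine (Finset.sum_le_sum fun a _ => worstGap_le_one μ hμ t a).trans ?_
  simp

theorem avgGap_nonneg (t : ℕ) : 0 ≤ avgGap μ arms t :=
  div_nonneg (Finset.sum_nonneg fun a _ => worstGap_nonneg μ t a) (Nat.cast_nonneg _)

/-- Regret of the check rounds of an episode, relative to an arm `b` that stays a candidate. -/
theorem sum_checkRounds_le (h : IsRun C₀ T ep rlen act arms est) (hT : 2 ≤ T) (hC : 0 ≤ C₀)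
    (hμ : ∀ t a, μ t a ∈ Set.Icc (0 : ℝ) 1) (hc : Concentrated T μ arms est) {e : ℕ} {b : Fin K}
    (hb : ∀ t ∈ checkRounds T ep rlen e, b ∈ arms t) {D : ℝ} (hD0 : 0 ≤ D)
    (hD : ∀ t ∈ checkRounds T ep rlen e, (t : ℝ) - e ≤ D) :
    ∑ t ∈ checkRounds T ep rlen e, avgGap μ arms t ≤
      ∑ t ∈ checkRounds T ep rlen e, worstGap μ t b +
        (1 + Real.log K) * ((√C₀ + 14) * Real.log T * (√(K * D) +
          2 * ∑ g ∈ Finset.Icc 1 T with ep g = e ∧ 0 < rlen g, √(K * ((rlen g : ℝ) + 1)))) := by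
  classical
  have hL := sixty_nine_le_log hT
  have hK : 1 ≤ K := by have := b.pos; omega
  have hKlog : 0 ≤ Real.log K := Real.log_natCast_nonneg K
  set κ : ℝ := (√C₀ + 14) * Real.log T with hκ
  have hκ0 : 0 ≤ κ := by positivity
  have hsub : ∀ t ∈ checkRounds T ep rlen e, avgGap μ arms t =
      worstGap μ t b + (∑ a ∈ arms t, (μ t b - μ t a)) / ((arms t).card : ℝ) := by
    intro t ht
    have hpos : (0 : ℝ) < (arms t).card := by exact_mod_cast Finset.card_pos.2 ⟨b, hb t ht⟩
    unfold avgGap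
    rw [← Finset.sum_congr rfl fun a _ => worstGap_sub μ t a b, Finset.sum_sub_distrib,
      Finset.sum_const, nsmul_eq_mul]
    field_simp
    ring
  rw [Finset.sum_congr rfl hsub, Finset.sum_add_distrib]
  gcongr
  -- group the check rounds by the active call
  have hmaps : ∀ t ∈ checkRounds T ep rlen e, act t ∈ Finset.Icc e T := by
    intro t ht
    simp only [checkRounds, Finset.mem_filter, Finset.mem_Icc] at ht
    have h1 := h.act_ge t ht.1.1 ht.1.2
    have h2 := h.act_le t ht.1.1 ht.1.2
    exact Finset.mem_Icc.2 ⟨by omega, by omega⟩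
  rw [← Finset.sum_fiberwise_of_maps_to hmaps]
  set Dur : ℕ → ℝ := fun s => if s = e then D else if 0 < rlen s ∧ ep s = e then rlen s else 0 with hDur
  have hDur0 : ∀ s, 0 ≤ Dur s := by intro s; simp only [hDur]; split_ifs <;> positivity
  have hframe : ∀ s ∈ Finset.Icc e T,
      ∑ t ∈ checkRounds T ep rlen e with act t = s,
        (∑ a ∈ arms t, (μ t b - μ t a)) / ((arms t).card : ℝ) ≤
      (1 + Real.log K) * (κ * √(K * Dur s) + ∑ g ∈ Finset.Icc 1 T with Charged T ep rlen act e s g,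
          κ * √(K * ((rlen g : ℝ) + 1))) := by
    intro s hs
    have hb' : ∀ t ∈ ownRounds T ep rlen act e s, b ∈ arms t := fun t ht =>
      hb t (Finset.mem_filter.1 ht).1
    refine sum_average_le (ownRounds T ep rlen act e s) arms
      (fun i hi j hj hij => arms_subset_of_ownRounds h hi hj hij) (fun t a => μ t b - μ t a) _
      ?_ (fun a j => ?_)
    · exact add_nonneg (by positivity) (Finset.sum_nonneg fun g _ => by positivity)
    · refine le_trans (le_of_eq ?_)
        (sum_ownRounds_le h hT hC hμ hc hb' (hDur0 s) (fun t ht => ?_) a j)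
      · exact Finset.sum_congr (by ext; simp) fun _ _ => rfl
      · obtain ⟨a1, a2, a3, a4, a5, a6⟩ := mem_ownRounds.1 ht
        simp only [hDur]
        split_ifs with h1 h2
        · rw [h1]; exact hD t (Finset.mem_filter.1 ht).1
        · rcases h.act_live t a1 a2 with h5 | ⟨h5, h6, h7⟩
          · omega
          · rw [a6] at h7
            have : (t : ℝ) ≤ s + rlen s := by exact_mod_cast h7
            linarith
        · exfalso
          rcases h.act_live t a1 a2 with h5 | ⟨h5, h6, h7⟩
          · omega
          · rw [a6] at h5 h6 h7
            exact h2 ⟨h6, by rw [← a3]; exact h.ep_eq a1 a2 h5.le (by have := h.act_le t a1 a2; omega)⟩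
  refine (Finset.sum_le_sum hframe).trans ?_
  rw [← Finset.mul_sum, Finset.sum_add_distrib, ← Finset.mul_sum]
  refine mul_le_mul_of_nonneg_left ?_ (by positivity)
  have hown : ∑ s ∈ Finset.Icc e T, √(K * Dur s) ≤ √(K * D) +
      ∑ g ∈ Finset.Icc 1 T with ep g = e ∧ 0 < rlen g, √(K * ((rlen g : ℝ) + 1)) := by
    have hpt : ∀ s ∈ Finset.Icc e T, √(K * Dur s) ≤ (if s = e then √(K * D) else 0) +
        if 1 ≤ s ∧ ep s = e ∧ 0 < rlen s then √(K * ((rlen s : ℝ) + 1)) else 0 := by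
      intro s hs
      have hs' := Finset.mem_Icc.1 hs
      simp only [hDur]
      by_cases h1 : s = e
      · rw [if_pos h1, if_pos h1]
        have : 0 ≤ (if 1 ≤ s ∧ ep s = e ∧ 0 < rlen s then √(K * ((rlen s : ℝ) + 1)) else 0) := by
          split_ifs <;> positivity
        linarith
      · rw [if_neg h1, if_neg h1, zero_add]
        by_cases h2 : 0 < rlen s ∧ ep s = e
        · rw [if_pos h2, if_pos ⟨by omega, h2.2, h2.1⟩]
          gcongr; linarith
        · rw [if_neg h2]
          simp only [mul_zero, Real.sqrt_zero]
          split_ifs <;> positivity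
    refine (Finset.sum_le_sum hpt).trans ?_
    rw [Finset.sum_add_distrib]
    gcongr
    · rw [Finset.sum_ite_eq']
      split_ifs
      · exact le_rfl
      · positivity
    · rw [← Finset.sum_filter]
      refine Finset.sum_le_sum_of_subset_of_nonneg (fun s hs => ?_) fun _ _ _ => by positivity
      simp only [Finset.mem_filter, Finset.mem_Icc] at hs ⊢
      exact ⟨⟨hs.2.1, hs.1.2⟩, hs.2.2⟩
  have hcharged : ∑ s ∈ Finset.Icc e T, ∑ g ∈ Finset.Icc 1 T with Charged T ep rlen act e s g,
      κ * √(K * ((rlen g : ℝ) + 1)) ≤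
      κ * ∑ g ∈ Finset.Icc 1 T with ep g = e ∧ 0 < rlen g, √(K * ((rlen g : ℝ) + 1)) := by
    simp only [Finset.sum_filter]
    rw [Finset.sum_comm, Finset.mul_sum]
    refine Finset.sum_le_sum fun g _ => ?_
    by_cases hg : ∃ s ∈ Finset.Icc e T, Charged T ep rlen act e s g
    · obtain ⟨s, hs, hsg⟩ := hg
      rw [Finset.sum_eq_single_of_mem s hs, if_pos hsg, if_pos ⟨hsg.2.2.1, hsg.2.1⟩]
      intro s' _ hne
      exact if_neg fun hcon => hne (hcon.unique h hsg)
    · rw [Finset.sum_eq_zero]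
      · split_ifs <;> positivity
      · exact fun s hs => if_neg fun hcon => hg ⟨s, hs, hcon⟩
  have := mul_le_mul_of_nonneg_left hown hκ0
  linarith

end

/-! ### Phases between significant shifts -/

section

variable {K : ℕ} {T : ℕ} {μ : ℕ → Fin K → ℝ}

theorem nextShift_bounds {σ : ℕ} (hσ : σ ≤ T) :
    σ < nextShift T μ σ ∧ nextShift T μ σ ≤ T + 1 := by
  unfold nextShift
  split_ifs with h
  · have := Nat.sInf_mem (s := {τ | σ < τ ∧ τ ≤ T ∧ NoSafeArm μ σ τ}) h
    exact ⟨this.1, this.2.1.trans (by omega)⟩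
  · omega

theorem nextShift_le {σ τ : ℕ} (h1 : σ < τ) (h2 : τ ≤ T) (h : NoSafeArm μ σ τ) :
    nextShift T μ σ ≤ τ := by
  unfold nextShift
  rw [if_pos ⟨τ, h1, h2, h⟩]
  exact Nat.sInf_le ⟨h1, h2, h⟩

theorem nextShift_of_le {σ : ℕ} (h : T ≤ σ) : nextShift T μ σ = T + 1 := by
  unfold nextShift
  rw [if_neg]
  rintro ⟨τ, h1, h2, -⟩
  omega

/-- Before the next significant shift some arm is safe. -/
theorem exists_safeArm (hK : 1 ≤ K) {σ : ℕ} (hσ : σ ≤ T) :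
    ∃ a : Fin K, ∀ s₁ s₂, σ ≤ s₁ → s₁ < s₂ → s₂ < nextShift T μ σ →
      ¬ SignificantRegret μ a s₁ s₂ := by
  by_contra hcon
  push Not at hcon
  obtain ⟨h1, h2⟩ := nextShift_bounds (μ := μ) hσ
  have hns : NoSafeArm μ σ (nextShift T μ σ - 1) := fun a => by
    obtain ⟨s₁, s₂, g1, g2, g3, g4⟩ := hcon a
    exact ⟨s₁, s₂, g1, g2, by omega, g4⟩
  obtain ⟨s₁, s₂, g1, g2, g3, -⟩ := hns ⟨0, hK⟩
  have h3 : nextShift T μ σ ≤ nextShift T μ σ - 1 := nextShift_le (by omega) (by omega) hns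
  omega

theorem shiftTime_bounds (hT : 1 ≤ T) (i : ℕ) : 1 ≤ shiftTime T μ i ∧ shiftTime T μ i ≤ T + 1 := by
  induction i with
  | zero => simp [shiftTime]
  | succ i ih =>
    rw [shiftTime]
    rcases Nat.lt_or_ge T (shiftTime T μ i) with h | h
    · rw [nextShift_of_le h.le]; omega
    · have := nextShift_bounds (μ := μ) h; omega

theorem lt_shiftTime_or (i : ℕ) : i < shiftTime T μ i ∨ shiftTime T μ i = T + 1 := by
  induction i with
  | zero => simp [shiftTime]
  | succ i ih =>
    rw [shiftTime]
    rcases Nat.lt_or_ge T (shiftTime T μ i) with h | h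
    · exact Or.inr (nextShift_of_le h.le)
    · have := nextShift_bounds (μ := μ) h
      left
      rcases ih with h | h <;> omega

theorem shiftTime_numShifts (hT : 1 ≤ T) : shiftTime T μ (numShifts T μ + 1) = T + 1 := by
  refine Nat.sInf_mem (s := {i | shiftTime T μ (i + 1) = T + 1}) ⟨T, ?_⟩
  have h1 := shiftTime_bounds (μ := μ) hT (T + 1)
  rcases lt_shiftTime_or (T := T) (μ := μ) (T + 1) with h | h
  · omega
  · exact h

theorem shiftTime_le_of_le_numShifts (hT : 1 ≤ T) {i : ℕ} (hi : i ≤ numShifts T μ) :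
    shiftTime T μ i ≤ T := by
  have h1 := shiftTime_bounds (μ := μ) hT i
  by_contra hcon
  rcases i with _ | i
  · simp [shiftTime] at hcon; omega
  · have : numShifts T μ ≤ i := Nat.sInf_le (show shiftTime T μ (i + 1) = T + 1 by omega)
    omega

/-- The index of the phase that contains round `t`. -/
noncomputable def phaseIndex {K : ℕ} (T : ℕ) (μ : ℕ → Fin K → ℝ) (t : ℕ) : ℕ :=
  sInf {i | t < shiftTime T μ (i + 1)}

theorem phaseIndex_spec (hT : 1 ≤ T) {t : ℕ} (h1 : 1 ≤ t) (ht : t ≤ T) :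
    phaseIndex T μ t ≤ numShifts T μ ∧ shiftTime T μ (phaseIndex T μ t) ≤ t ∧
      t < shiftTime T μ (phaseIndex T μ t + 1) := by
  have hN : numShifts T μ ∈ {i | t < shiftTime T μ (i + 1)} := by
    rw [Set.mem_ofPred_eq, shiftTime_numShifts hT]; omega
  refine ⟨Nat.sInf_le hN, ?_, Nat.sInf_mem ⟨_, hN⟩⟩
  by_contra hcon
  rcases h : phaseIndex T μ t with _ | i
  · rw [h] at hcon; simp [shiftTime] at hcon; omega
  · rw [h, not_le] at hcon
    have : phaseIndex T μ t ≤ i := Nat.sInf_le hcon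
    omega

theorem phaseIndex_mono (hT : 1 ≤ T) {s t : ℕ} (hst : s ≤ t) (ht : t ≤ T) :
    phaseIndex T μ s ≤ phaseIndex T μ t := by
  rcases Nat.eq_zero_or_pos t with rfl | h1
  · obtain rfl : s = 0 := by omega
    exact le_rfl
  · exact Nat.sInf_le (hst.trans_lt (phaseIndex_spec hT h1 ht).2.2)

/-- `Φ = ∑ᵢ √(K (τᵢ₊₁ - τᵢ))`, the main term of the regret bound. -/
noncomputable def phaseSum {K : ℕ} (T : ℕ) (μ : ℕ → Fin K → ℝ) : ℝ :=
  ∑ i ∈ Finset.range (numShifts T μ + 1),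
    √((K : ℝ) * ((shiftTime T μ (i + 1) : ℝ) - (shiftTime T μ i : ℝ)))

theorem sqrt_sum_le_sum_sqrt {ι : Type*} (s : Finset ι) (f : ι → ℝ) (hf : ∀ i ∈ s, 0 ≤ f i) :
    √(∑ i ∈ s, f i) ≤ ∑ i ∈ s, √(f i) := by
  classical
  induction s using Finset.induction_on with
  | empty => simp
  | insert a s ha ih =>
    rw [Finset.sum_insert ha, Finset.sum_insert ha]
    have h1 := ih fun i hi => hf i (Finset.mem_insert_of_mem hi)
    have h2 := hf a (Finset.mem_insert_self _ _)
    have h3 : 0 ≤ ∑ i ∈ s, f i := Finset.sum_nonneg fun i hi => hf i (Finset.mem_insert_of_mem hi)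
    have h4 : √(f a + ∑ i ∈ s, f i) ≤ √(f a) + √(∑ i ∈ s, f i) := by
      refine Real.sqrt_le_iff.2 ⟨by positivity, ?_⟩
      nlinarith [Real.sq_sqrt h2, Real.sq_sqrt h3, Real.sqrt_nonneg (f a),
        mul_nonneg (Real.sqrt_nonneg (f a)) (Real.sqrt_nonneg (∑ i ∈ s, f i))]
    linarith

theorem sqrt_mul_horizon_le_phaseSum (hT : 1 ≤ T) : √((K : ℝ) * T) ≤ phaseSum T μ := by
  have h : (K : ℝ) * T = ∑ i ∈ Finset.range (numShifts T μ + 1),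
      (K : ℝ) * ((shiftTime T μ (i + 1) : ℝ) - (shiftTime T μ i : ℝ)) := by
    rw [← Finset.mul_sum, Finset.sum_range_sub (fun i => (shiftTime T μ i : ℝ)),
      shiftTime_numShifts hT]
    simp [shiftTime]
  rw [h]
  refine sqrt_sum_le_sum_sqrt _ _ fun i hi => ?_
  have hi' := shiftTime_le_of_le_numShifts (μ := μ) hT (by simpa [Nat.lt_succ_iff] using hi : i ≤ numShifts T μ)
  have h2 := (nextShift_bounds (μ := μ) hi').1
  have : (shiftTime T μ i : ℝ) ≤ shiftTime T μ (i + 1) := by exact_mod_cast h2.le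
  exact mul_nonneg (Nat.cast_nonneg _) (by linarith)

end

/-! ### Bad segments -/

open Classical in
/-- Greedy partition of the rounds from `e` on: `segStart β d idx e t` is the first round of the
segment that contains round `t`. A segment ends when it becomes bad, i.e. when its sum of `d` reaches
`β` times the square root of its length, or when the phase ends. -/
noncomputable def segStart (β : ℝ) (d : ℕ → ℝ) (idx : ℕ → ℕ) (e : ℕ) : ℕ → ℕ
  | 0 => 0
  | t + 1 =>
    if t < e ∨ idx (t + 1) ≠ idx t ∨
      β * √((t : ℝ) - segStart β d idx e t + 1) ≤ ∑ s ∈ Finset.Icc (segStart β d idx e t) t, d s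
    then t + 1 else segStart β d idx e t

open Classical in
/-- The last rounds, before round `t`, of the bad segments. -/
noncomputable def badEnds (β : ℝ) (d : ℕ → ℝ) (idx : ℕ → ℕ) (e t : ℕ) : Finset ℕ :=
  (Finset.Ico e t).filter fun v =>
    β * √((v : ℝ) - segStart β d idx e v + 1) ≤ ∑ s ∈ Finset.Icc (segStart β d idx e v) v, d s

/-- The number of rounds of the segment containing `v`, up to `v`. -/
noncomputable def segLen (β : ℝ) (d : ℕ → ℝ) (idx : ℕ → ℕ) (e v : ℕ) : ℕ :=
  v + 1 - segStart β d idx e v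

section

variable {β : ℝ} {d : ℕ → ℝ} {idx : ℕ → ℕ} {e : ℕ}

theorem segStart_bounds (t : ℕ) (ht : e ≤ t) :
    e ≤ segStart β d idx e t ∧ segStart β d idx e t ≤ t := by
  induction t, ht using Nat.le_induction with
  | base =>
    rcases e with _ | e
    · simp [segStart]
    · rw [segStart, if_pos (Or.inl (Nat.lt_succ_self e))]; simp
  | succ t ht ih =>
    rw [segStart]
    split_ifs <;> omega

theorem cast_segLen {v : ℕ} (hv : e ≤ v) :
    (segLen β d idx e v : ℝ) = (v : ℝ) - segStart β d idx e v + 1 := by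
  have := segStart_bounds (β := β) (d := d) (idx := idx) v hv
  rw [segLen, Nat.cast_sub (by omega)]; push_cast; ring

/-- Within a segment, the segment is not bad before its end, and the phase is constant. -/
theorem segStart_eq (t : ℕ) (ht : e ≤ t) (s : ℕ) (hs : segStart β d idx e t ≤ s) (hst : s ≤ t) :
    segStart β d idx e s = segStart β d idx e t ∧ idx s = idx t ∧ (s < t →
      ∑ r ∈ Finset.Icc (segStart β d idx e t) s, d r < β * √((s : ℝ) - segStart β d idx e t + 1)) := by
  induction t, ht using Nat.le_induction with
  | base =>
    have := segStart_bounds (β := β) (d := d) (idx := idx) e le_rfl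
    obtain rfl : s = e := by omega
    exact ⟨rfl, rfl, fun h => absurd h (lt_irrefl _)⟩
  | succ t ht ih =>
    rcases Nat.lt_or_ge t s with h3 | h3
    · obtain rfl : s = t + 1 := by omega
      exact ⟨rfl, rfl, fun h => absurd h (lt_irrefl _)⟩
    · by_cases hc : t < e ∨ idx (t + 1) ≠ idx t ∨
        β * √((t : ℝ) - segStart β d idx e t + 1) ≤ ∑ s ∈ Finset.Icc (segStart β d idx e t) t, d s
      · rw [segStart, if_pos hc] at hs
        omega
      · have heq : segStart β d idx e (t + 1) = segStart β d idx e t := by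
          rw [segStart, if_neg hc]
        rw [heq] at hs ⊢
        push Not at hc
        obtain ⟨h4, h5, h6⟩ := ih hs h3
        refine ⟨h4, h5.trans hc.2.1.symm, fun _ => ?_⟩
        rcases h3.lt_or_eq with h7 | rfl
        · exact h6 h7
        · exact hc.2.2

/-- The last round of a segment adds at most `1` to a sum that was not yet bad. -/
theorem sum_segment_le (hβ : 0 ≤ β) (hd : ∀ t, d t ≤ 1) (t : ℕ) (ht : e ≤ t) :
    ∑ s ∈ Finset.Icc (segStart β d idx e t) t, d s ≤ (β + 1) * √(segLen β d idx e t : ℝ) := by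
  have hb := segStart_bounds (β := β) (d := d) (idx := idx) t ht
  rw [cast_segLen ht]
  set u := segStart β d idx e t with hu
  have hut : (u : ℝ) ≤ t := by exact_mod_cast hb.2
  have h1 : 1 ≤ √((t : ℝ) - u + 1) := Real.one_le_sqrt.2 (by linarith)
  rcases hb.2.lt_or_eq with hlt | heq
  · have h2 := (segStart_eq (β := β) (d := d) (idx := idx) t ht (t - 1) (by omega) (by omega)).2.2
      (by omega)
    rw [← hu] at h2
    have h3 : Finset.Icc u t = insert t (Finset.Icc u (t - 1)) := by ext; simp; omega
    rw [h3, Finset.sum_insert (by simp; omega)]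
    have h4 : √(((t - 1 : ℕ) : ℝ) - u + 1) ≤ √((t : ℝ) - u + 1) := by
      refine Real.sqrt_le_sqrt ?_
      rw [Nat.cast_sub (by omega)]; push_cast; linarith
    have h5 := mul_le_mul_of_nonneg_left h4 hβ
    linarith [hd t]
  · rw [heq, Finset.Icc_self, Finset.sum_singleton]
    rw [heq] at h1
    nlinarith [hd t]

/-- A segment that is not bad ends with its phase or is the last one, so that there is at most one of
them for each phase. -/
theorem sum_le_badEnds_add_phases (hβ : 0 ≤ β) (hd : ∀ t, d t ≤ 1) (T : ℕ)
    (hidx : ∀ s t, s ≤ t → t ≤ T → idx s ≤ idx t) (t : ℕ) (ht : e ≤ t) (htT : t ≤ T) :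
    ∑ s ∈ Finset.Icc e t, d s ≤ (β + 1) * (∑ v ∈ badEnds β d idx e t, √(segLen β d idx e v : ℝ) +
      ∑ i ∈ Finset.range (idx t + 1), √(((Finset.Icc e t).filter fun r => idx r = i).card : ℝ)) := by
  have hseg : ∀ t, e ≤ t → (segLen β d idx e t : ℝ) ≤
      ((Finset.Icc e t).filter fun r => idx r = idx t).card := by
    intro t ht
    have hb := segStart_bounds (β := β) (d := d) (idx := idx) t ht
    have : Finset.Icc (segStart β d idx e t) t ⊆ (Finset.Icc e t).filter fun r => idx r = idx t := by
      intro r hr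
      rw [Finset.mem_Icc] at hr
      exact Finset.mem_filter.2 ⟨Finset.mem_Icc.2 ⟨by omega, hr.2⟩,
        (segStart_eq (β := β) (d := d) t ht r hr.1 hr.2).2.1⟩
    have := Finset.card_le_card this
    rw [Nat.card_Icc] at this
    exact_mod_cast this
  have hmain : ∑ s ∈ Finset.Ico e (segStart β d idx e t), d s ≤
      (β + 1) * (∑ v ∈ badEnds β d idx e t, √(segLen β d idx e v : ℝ) +
      ∑ i ∈ Finset.range (idx t), √(((Finset.Icc e t).filter fun r => idx r = i).card : ℝ)) := by
    induction t, ht using Nat.le_induction with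
    | base =>
      have := segStart_bounds (β := β) (d := d) (idx := idx) e le_rfl
      rw [show segStart β d idx e e = e by omega, Finset.Ico_self, Finset.sum_empty]
      exact mul_nonneg (by linarith) (add_nonneg (Finset.sum_nonneg fun _ _ => Real.sqrt_nonneg _)
        (Finset.sum_nonneg fun _ _ => Real.sqrt_nonneg _))
    | succ t ht ih =>
      have ih := ih (by omega)
      have hb := segStart_bounds (β := β) (d := d) (idx := idx) t ht
      have hphase : ∀ n ≤ idx (t + 1), ∑ i ∈ Finset.range n,
          √(((Finset.Icc e t).filter fun r => idx r = i).card : ℝ) ≤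
          ∑ i ∈ Finset.range (idx (t + 1)),
            √(((Finset.Icc e (t + 1)).filter fun r => idx r = i).card : ℝ) := by
        intro n hn
        refine (Finset.sum_le_sum fun i _ => ?_).trans (Finset.sum_le_sum_of_subset_of_nonneg
          (Finset.range_mono hn) fun _ _ _ => Real.sqrt_nonneg _)
        refine Real.sqrt_le_sqrt ?_
        exact_mod_cast Finset.card_le_card (Finset.filter_subset_filter _
          (Finset.Icc_subset_Icc le_rfl (by omega)))
      have hmono := hidx t (t + 1) (by omega) htT
      have hbad : badEnds β d idx e t ⊆ badEnds β d idx e (t + 1) :=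
        Finset.filter_subset_filter _ (Finset.Ico_subset_Ico le_rfl (by omega))
      have hbadsum := Finset.sum_le_sum_of_subset_of_nonneg
        (f := fun v => √(segLen β d idx e v : ℝ)) hbad fun _ _ _ => Real.sqrt_nonneg _
      have hlast : ∑ s ∈ Finset.Ico e (t + 1), d s =
          ∑ s ∈ Finset.Ico e (segStart β d idx e t), d s +
          ∑ s ∈ Finset.Icc (segStart β d idx e t) t, d s := by
        rw [← Finset.Ico_add_one_right_eq_Icc,
          Finset.sum_Ico_consecutive _ hb.1 (by omega)]
      have hsle := sum_segment_le (idx := idx) hβ hd t ht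
      by_cases hcase : β * √((t : ℝ) - segStart β d idx e t + 1) ≤
          ∑ s ∈ Finset.Icc (segStart β d idx e t) t, d s
      · rw [show segStart β d idx e (t + 1) = t + 1 by
          rw [segStart, if_pos (Or.inr (Or.inr hcase))], hlast]
        have hins : badEnds β d idx e (t + 1) = insert t (badEnds β d idx e t) := by
          ext v
          simp only [badEnds, Finset.mem_insert, Finset.mem_filter, Finset.mem_Ico]
          constructor
          · rintro ⟨h1, h2⟩
            by_cases hv : v = t
            · exact Or.inl hv
            · exact Or.inr ⟨⟨h1.1, by omega⟩, h2⟩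
          · rintro (rfl | ⟨h1, h2⟩)
            · exact ⟨⟨ht, by omega⟩, hcase⟩
            · exact ⟨⟨h1.1, by omega⟩, h2⟩
        rw [hins, Finset.sum_insert (by simp [badEnds])]
        have := hphase (idx t) hmono
        nlinarith
      · by_cases hph : idx (t + 1) ≠ idx t
        · rw [show segStart β d idx e (t + 1) = t + 1 by
            rw [segStart, if_pos (Or.inr (Or.inl hph))], hlast]
          have h1 := hphase (idx t + 1) (by omega)
          rw [Finset.sum_range_succ] at h1
          have h2 := Real.sqrt_le_sqrt (hseg t ht)
          have h3 := mul_le_mul_of_nonneg_left h2 (by linarith : 0 ≤ β + 1)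
          nlinarith
        · rw [show segStart β d idx e (t + 1) = segStart β d idx e t by
            rw [segStart, if_neg]
            push Not
            exact ⟨ht, not_not.1 hph, not_le.1 hcase⟩]
          have := hphase (idx t) hmono
          nlinarith
  have hb := segStart_bounds (β := β) (d := d) (idx := idx) t ht
  have hlast : ∑ s ∈ Finset.Icc e t, d s =
      ∑ s ∈ Finset.Ico e (segStart β d idx e t), d s +
      ∑ s ∈ Finset.Icc (segStart β d idx e t) t, d s := by
    rw [← Finset.Ico_add_one_right_eq_Icc, ← Finset.Ico_add_one_right_eq_Icc,
      Finset.sum_Ico_consecutive _ hb.1 (by omega)]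
  rw [hlast, Finset.sum_range_succ]
  have h1 := sum_segment_le (idx := idx) hβ hd t ht
  have h2 := mul_le_mul_of_nonneg_left (Real.sqrt_le_sqrt (hseg t ht)) (by linarith : 0 ≤ β + 1)
  linarith

end

/-! ### Regret of an episode -/

/-- The rate at which the gaps of an arm have to accumulate on a bad segment. After the first half of
the segment, a proportion `1 - √(1/2) > 1/4` of the sum of the gaps is left; the constant is such that
this exceeds the eviction threshold (`√C₀`), the deviation (`17`) and the gaps of the safe arm
(`1.5`). -/
noncomputable def badRate (C₀ : ℝ) (K T : ℕ) : ℝ := 4 * (√C₀ + 19) * Real.log T * √K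

/-- If, within the episode `e`, the bad segments of an arm before round `t` are long in total, then
a replay that covers the rest of the segment is scheduled in the first half of one of them. Here
`on r e m` says that the indicator of a replay of duration `m` at round `r` of episode `e` is on. -/
def ReplaysFound {K : ℕ} (C₀ : ℝ) (T : ℕ) (μ : ℕ → Fin K → ℝ) (on : ℕ → ℕ → ℕ → Prop) : Prop :=
  ∀ (e t : ℕ) (b : Fin K), 1 ≤ e → e < t → t ≤ T →
    20 * Real.log T * √((t : ℝ) - e) ≤
      ∑ v ∈ badEnds (badRate C₀ K T) (fun s => worstGap μ s b) (phaseIndex T μ) e t,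
        √(segLen (badRate C₀ K T) (fun s => worstGap μ s b) (phaseIndex T μ) e v : ℝ) →
    ∃ v ∈ badEnds (badRate C₀ K T) (fun s => worstGap μ s b) (phaseIndex T μ) e t, ∃ r,
      segStart (badRate C₀ K T) (fun s => worstGap μ s b) (phaseIndex T μ) e v < r ∧
      2 * (r - segStart (badRate C₀ K T) (fun s => worstGap μ s b) (phaseIndex T μ) e v) ≤
        segLen (badRate C₀ K T) (fun s => worstGap μ s b) (phaseIndex T μ) e v ∧
      on r e (2 ^ Nat.clog 2
        (segLen (badRate C₀ K T) (fun s => worstGap μ s b) (phaseIndex T μ) e v))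

section

variable {K : ℕ} {C₀ : ℝ} {T : ℕ} {ep rlen act : ℕ → ℕ} {arms : ℕ → Finset (Fin K)}
  {est : ℕ → Fin K → ℝ} {μ : ℕ → Fin K → ℝ}

theorem badRate_bounds {K : ℕ} (hT : 2 ≤ T) (C₀ : ℝ) :
    52 ≤ 4 * (√C₀ + 19) * Real.log T ∧ 52 * √K ≤ badRate C₀ K T := by
  have hL := sixty_nine_le_log hT
  have hC := Real.sqrt_nonneg C₀
  have h1 : 52 ≤ 4 * (√C₀ + 19) * Real.log T := by nlinarith
  exact ⟨h1, mul_le_mul_of_nonneg_right h1 (Real.sqrt_nonneg _)⟩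

/-- Gaps are at most `1`, so that a segment of length `n` is bad only if `√n ≥ badRate C₀ K T`. -/
theorem four_mul_le_segLen (hT : 2 ≤ T) (hμ : ∀ t a, μ t a ∈ Set.Icc (0 : ℝ) 1)
    {b : Fin K} {idx : ℕ → ℕ} {e t v : ℕ}
    (hv : v ∈ badEnds (badRate C₀ K T) (fun s => worstGap μ s b) idx e t) :
    4 * K ≤ segLen (badRate C₀ K T) (fun s => worstGap μ s b) idx e v := by
  obtain ⟨h1, h2⟩ := Finset.mem_filter.1 hv
  rw [Finset.mem_Ico] at h1
  have hb := segStart_bounds (β := badRate C₀ K T) (d := fun s => worstGap μ s b) (idx := idx) v h1.1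
  have hn := cast_segLen (β := badRate C₀ K T) (d := fun s => worstGap μ s b) (idx := idx) h1.1
  rw [← hn] at h2
  set n := segLen (badRate C₀ K T) (fun s => worstGap μ s b) idx e v with hndef
  have hsum : ∑ s ∈ Finset.Icc (segStart (badRate C₀ K T) (fun s => worstGap μ s b) idx e v) v,
      worstGap μ s b ≤ n := by
    calc _ ≤ ∑ s ∈ Finset.Icc (segStart (badRate C₀ K T) (fun s => worstGap μ s b) idx e v) v,
          (1 : ℝ) := Finset.sum_le_sum fun s _ => worstGap_le_one μ hμ s b
      _ = n := by rw [Finset.sum_const, Nat.card_Icc, nsmul_eq_mul, mul_one, hndef, segLen]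
  have hβ := (badRate_bounds (K := K) hT C₀).2
  have hn1 : 1 ≤ n := by rw [hndef, segLen]; omega
  have hn1' : (1 : ℝ) ≤ n := by exact_mod_cast hn1
  have hsn : 1 ≤ √(n : ℝ) := Real.one_le_sqrt.2 hn1'
  have h3 : badRate C₀ K T ≤ √(n : ℝ) := by
    have h4 := h2.trans hsum
    have h5 := Real.mul_self_sqrt (by linarith : (0 : ℝ) ≤ n)
    nlinarith
  have h6 : (2 * √(K : ℝ)) ≤ √(n : ℝ) := by have := Real.sqrt_nonneg (K : ℝ); linarith
  have h7 : 4 * (K : ℝ) ≤ n := by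
    have h8 := Real.mul_self_sqrt (by linarith : (0 : ℝ) ≤ n)
    have h9 := Real.mul_self_sqrt (Nat.cast_nonneg K : (0 : ℝ) ≤ K)
    nlinarith [Real.sqrt_nonneg (K : ℝ)]
  exact_mod_cast h7

/-- A replay started in the first half of a bad segment of `b`, and reaching beyond its end, gets `b`
evicted: the safe arm of the phase is a candidate during the replay, and far better than `b`. -/
theorem mem_evicted_of_replay (h : IsRun C₀ T ep rlen act arms est) (hT : 2 ≤ T)
    (hC : 400 ≤ C₀) (hμ : ∀ t a, μ t a ∈ Set.Icc (0 : ℝ) 1) (hc : Concentrated T μ arms est)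
    {e t v r : ℕ} {b : Fin K} (ht : t ∈ checkRounds T ep rlen e)
    (hv : v ∈ badEnds (badRate C₀ K T) (fun s => worstGap μ s b) (phaseIndex T μ) e t)
    (hr1 : segStart (badRate C₀ K T) (fun s => worstGap μ s b) (phaseIndex T μ) e v < r)
    (hr2 : 2 * (r - segStart (badRate C₀ K T) (fun s => worstGap μ s b) (phaseIndex T μ) e v) ≤
        segLen (badRate C₀ K T) (fun s => worstGap μ s b) (phaseIndex T μ) e v)
    (hr3 : segLen (badRate C₀ K T) (fun s => worstGap μ s b) (phaseIndex T μ) e v ≤ rlen r) :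
    b ∈ evicted C₀ T est e t := by
  by_contra hev
  have hK : 1 ≤ K := by have := b.pos; omega
  have hK' : (1 : ℝ) ≤ K := by exact_mod_cast hK
  have hL := sixty_nine_le_log hT
  have hlen := four_mul_le_segLen hT hμ hv
  obtain ⟨hβ1, -⟩ := badRate_bounds (K := K) hT C₀
  obtain ⟨hv1, hbad⟩ := Finset.mem_filter.1 hv
  rw [Finset.mem_Ico] at hv1
  simp only [checkRounds, Finset.mem_filter, Finset.mem_Icc] at ht
  obtain ⟨⟨ht1, htT⟩, hte, het, hrt⟩ := ht
  have he1 : 1 ≤ e := by have := (h.ep_bounds ht1 htT).1; omega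
  have hub := segStart_bounds (β := badRate C₀ K T) (d := fun s => worstGap μ s b)
    (idx := phaseIndex T μ) v hv1.1
  have hn := cast_segLen (β := badRate C₀ K T) (d := fun s => worstGap μ s b)
    (idx := phaseIndex T μ) hv1.1
  have hseg := segStart_eq (β := badRate C₀ K T) (d := fun s => worstGap μ s b)
    (idx := phaseIndex T μ) v hv1.1
  rw [← hn] at hbad
  set n := segLen (badRate C₀ K T) (fun s => worstGap μ s b) (phaseIndex T μ) e v with hndef
  have hnv : n = v + 1 - segStart (badRate C₀ K T) (fun s => worstGap μ s b) (phaseIndex T μ) e v := rfl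
  set u := segStart (badRate C₀ K T) (fun s => worstGap μ s b) (phaseIndex T μ) e v with hu
  have hrv : r < v := by omega
  -- the phase of the segment and its safe arm
  obtain ⟨hiN, hiv, hvi⟩ := phaseIndex_spec (μ := μ) (by omega : 1 ≤ T) (by omega : 1 ≤ v)
    (by omega : v ≤ T)
  obtain ⟨-, hiu, -⟩ := phaseIndex_spec (μ := μ) (by omega : 1 ≤ T) (by omega : 1 ≤ u)
    (by omega : u ≤ T)
  rw [(hseg u le_rfl hub.2).2.1] at hiu
  generalize phaseIndex T μ v = i at hiN hiv hvi hiu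
  obtain ⟨g, hg⟩ := exists_safeArm (μ := μ) hK (shiftTime_le_of_le_numShifts (μ := μ) (by omega) hiN)
  change ∀ s₁ s₂, shiftTime T μ i ≤ s₁ → s₁ < s₂ → s₂ < shiftTime T μ (i + 1) → _ at hg
  have hact : ∀ s, r ≤ s → s ≤ v → r ≤ act s := fun s h1 h2 =>
    h.le_act_of_replay (by omega) (by omega) (by omega) h1 (by omega)
  have hgarm : ∀ s ∈ Finset.Icc r v, g ∈ arms s := by
    intro s hs
    rw [Finset.mem_Icc] at hs
    refine h.mem_arms_of_notMem_evicted (by omega) (by omega) (hact s hs.1 hs.2) le_rfl fun hcon => ?_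
    obtain ⟨s₁, s₂, g1, g2, g3, g4⟩ := exists_significantRegret h hT hC hμ hc (by omega) g s
      (by omega) (fun q hq1 hq2 => hact q hq1 (by omega)) hcon
    exact hg s₁ s₂ (by omega) g2 (by omega) g4
  have hbarm : ∀ s ∈ Finset.Icc r v, b ∈ arms s := by
    intro s hs
    rw [Finset.mem_Icc] at hs
    refine h.mem_arms_of_notMem_evicted (by omega) (by omega) ?_ (by omega : s ≤ t) hev
    have := hact s hs.1 hs.2; omega
  -- gaps of `b` and of the safe arm on the rest of the segment
  have hL0 : 0 ≤ Real.log T := by linarith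
  have hnn : (0 : ℝ) ≤ n := Nat.cast_nonneg n
  set y := √((K : ℝ) * n) with hy
  have hβy : badRate C₀ K T * √(n : ℝ) = 4 * (√C₀ + 19) * Real.log T * y := by
    rw [hy, Real.sqrt_mul (by linarith), badRate]; ring
  have hfirst : ∑ s ∈ Finset.Icc u (r - 1), worstGap μ s b ≤
      4 * (√C₀ + 19) * Real.log T * (0.71 * y) := by
    have h1 := (hseg (r - 1) (by omega) (by omega)).2.2 (by omega)
    refine h1.le.trans ?_
    have h2 : ((r - 1 : ℕ) : ℝ) - u + 1 ≤ n / 2 := by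
      have : (2 : ℝ) * ((r : ℝ) - u) ≤ n := by
        have := (Nat.cast_le (α := ℝ)).2 hr2
        rw [Nat.cast_mul, Nat.cast_sub hr1.le] at this
        exact_mod_cast this
      rw [Nat.cast_sub (by omega)]; push_cast; linarith
    have h3 : √(((r - 1 : ℕ) : ℝ) - u + 1) ≤ 0.71 * √(n : ℝ) := by
      rw [show (0.71 : ℝ) * √(n : ℝ) = √(0.71 ^ 2 * n) by
        rw [Real.sqrt_mul (by positivity), Real.sqrt_sq (by norm_num)]]
      exact Real.sqrt_le_sqrt (by linarith)
    calc badRate C₀ K T * √(((r - 1 : ℕ) : ℝ) - u + 1)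
        ≤ badRate C₀ K T * (0.71 * √(n : ℝ)) := by
          refine mul_le_mul_of_nonneg_left h3 ?_
          unfold badRate; positivity
      _ = 0.71 * (badRate C₀ K T * √(n : ℝ)) := by ring
      _ = 4 * (√C₀ + 19) * Real.log T * (0.71 * y) := by rw [hβy]; ring
  have hsplit : ∑ s ∈ Finset.Icc u v, worstGap μ s b =
      ∑ s ∈ Finset.Icc u (r - 1), worstGap μ s b + ∑ s ∈ Finset.Icc r v, worstGap μ s b := by
    have h1 : Finset.Icc u v = Finset.Ico u (v + 1) := by ext; simp
    have h2 : Finset.Icc u (r - 1) = Finset.Ico u r := by ext; simp; omega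
    have h3 : Finset.Icc r v = Finset.Ico r (v + 1) := by ext; simp
    rw [h1, h2, h3, Finset.sum_Ico_consecutive _ (by omega) (by omega)]
  have hrvn : (v : ℝ) - r ≤ n := by
    have : (u : ℝ) ≤ r := by exact_mod_cast hr1.le
    linarith
  have hsafe : ∑ s ∈ Finset.Icc r v, worstGap μ s g ≤ y := by
    have h1 := hg r v (by omega) hrv hvi
    unfold SignificantRegret at h1
    refine (not_le.1 h1).le.trans (Real.sqrt_le_sqrt ?_)
    gcongr
  -- the estimates reveal the difference
  set X := max ((K : ℝ) * ((v : ℝ) - r)) ((K : ℝ) ^ 2) with hX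
  have hXy : √X ≤ y := by
    refine Real.sqrt_le_sqrt (max_le (by gcongr) ?_)
    have : (K : ℝ) ≤ n := by exact_mod_cast (by omega : K ≤ n)
    nlinarith
  have hest : ∑ s ∈ Finset.Icc r v, (est s g - est s b) ≤ Real.log T * √(C₀ * X) := by
    by_contra hcon
    exact hev (mem_evicted.2 ⟨r, v, by omega, hrv, by omega, g, not_le.1 hcon⟩)
  have hest2 : Real.log T * √(C₀ * X) ≤ √C₀ * Real.log T * y := by
    rw [Real.sqrt_mul (by linarith)]
    have := mul_le_mul_of_nonneg_left hXy (mul_nonneg (Real.sqrt_nonneg C₀) hL0)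
    linarith
  have hconc := hc.le_of_lt hT (by omega : 1 ≤ r) hrv (by omega) g b
  have hmean : ∑ s ∈ Finset.Icc r v, (estMean μ arms s b - estMean μ arms s g) =
      ∑ s ∈ Finset.Icc r v, worstGap μ s g - ∑ s ∈ Finset.Icc r v, worstGap μ s b := by
    rw [← Finset.sum_sub_distrib]
    refine Finset.sum_congr rfl fun s hs => ?_
    unfold estMean
    rw [if_pos (hbarm s hs), if_pos (hgarm s hs), worstGap_sub]
  have hneg : ∑ s ∈ Finset.Icc r v, (est s b - est s g) =
      -∑ s ∈ Finset.Icc r v, (est s g - est s b) := by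
    rw [← Finset.sum_neg_distrib]
    exact Finset.sum_congr rfl fun s hs => by ring
  rw [hmean, hneg] at hconc
  have hy1 : 1 ≤ y := by
    refine Real.one_le_sqrt.2 ?_
    have : (1 : ℝ) ≤ n := by exact_mod_cast (by omega : 1 ≤ n)
    nlinarith
  have hLX : 17 * Real.log T * √X ≤ 17 * Real.log T * y := by gcongr
  rw [hβy, hsplit] at hbad
  have hyL : y ≤ 1.5 * (Real.log T * y) := by nlinarith
  have hLy : 0 < Real.log T * y := by positivity
  nlinarith [mul_nonneg (Real.sqrt_nonneg C₀) hLy.le]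

/-- The number of rounds of episode `e` in phase `i`. -/
noncomputable def overlap {K : ℕ} (T : ℕ) (μ : ℕ → Fin K → ℝ) (ep : ℕ → ℕ) (e i : ℕ) : ℕ :=
  ((Finset.Icc 1 T).filter fun r => ep r = e ∧ phaseIndex T μ r = i).card

/-- `∑ᵢ √(K · |episode e ∩ phase i|)`. -/
noncomputable def episodeSum {K : ℕ} (T : ℕ) (μ : ℕ → Fin K → ℝ) (ep : ℕ → ℕ) (e : ℕ) : ℝ :=
  ∑ i ∈ Finset.range (numShifts T μ + 1), √((K : ℝ) * overlap T μ ep e i)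

theorem sqrt_card_episode_le (hT : 2 ≤ T) (e : ℕ) :
    √((K : ℝ) * ((Finset.Icc 1 T).filter fun r => ep r = e).card) ≤ episodeSum T μ ep e := by
  have h : (((Finset.Icc 1 T).filter fun r => ep r = e).card : ℝ) =
      ∑ i ∈ Finset.range (numShifts T μ + 1), (overlap T μ ep e i : ℝ) := by
    rw [Finset.card_eq_sum_card_fiberwise (t := Finset.range (numShifts T μ + 1))
      (f := phaseIndex T μ)]
    · push_cast
      refine Finset.sum_congr rfl fun i _ => ?_
      rw [overlap, Finset.filter_filter]
    · intro r hr
      have hr' := Finset.mem_Icc.1 (Finset.mem_filter.1 hr).1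
      have := (phaseIndex_spec (μ := μ) (by omega : 1 ≤ T) hr'.1 hr'.2).1
      simp only [Finset.coe_range, Set.mem_Iio]
      omega
  rw [h, Finset.mul_sum]
  exact sqrt_sum_le_sum_sqrt _ _ fun i _ => by positivity

/-- An arm that stays in the master set up to round `t` has small cumulative gap up to `t`. -/
theorem sum_worstGap_le (h : IsRun C₀ T ep rlen act arms est) (hT : 2 ≤ T)
    (hC : 400 ≤ C₀) (hμ : ∀ t a, μ t a ∈ Set.Icc (0 : ℝ) 1) (hc : Concentrated T μ arms est)
    {on : ℕ → ℕ → ℕ → Prop} (hfound : ReplaysFound C₀ T μ on)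
    (hon : ∀ r m, 2 ≤ r → r ≤ T → m ∈ durations T → on r (ep (r - 1)) m → m ≤ rlen r)
    {e t : ℕ} {b : Fin K} (ht : t ∈ checkRounds T ep rlen e) (hev : b ∉ evicted C₀ T est e t) :
    ∑ s ∈ Finset.Icc e t, worstGap μ s b ≤
      22 * (4 * √C₀ + 78) * Real.log T ^ 2 * episodeSum T μ ep e := by
  have hK : 1 ≤ K := by have := b.pos; omega
  have hL := sixty_nine_le_log hT
  have hK' : (1 : ℝ) ≤ K := by exact_mod_cast hK
  have hsK : 1 ≤ √(K : ℝ) := Real.one_le_sqrt.2 hK'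
  have hS := Real.sqrt_nonneg C₀
  have ht' := ht
  simp only [checkRounds, Finset.mem_filter, Finset.mem_Icc] at ht
  obtain ⟨⟨ht1, htT⟩, hte, het, hrt⟩ := ht
  have he1 : 1 ≤ e := by have := (h.ep_bounds ht1 htT).1; omega
  have hmain := sum_le_badEnds_add_phases (β := badRate C₀ K T) (d := fun s => worstGap μ s b)
    (idx := phaseIndex T μ) (e := e) (by unfold badRate; positivity)
    (fun s => worstGap_le_one μ hμ s b) T
    (fun s t hst htT => phaseIndex_mono (by omega) hst htT) t het.le htT
  -- a replay found in a bad segment would evict `b`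
  have hfew : ∑ v ∈ badEnds (badRate C₀ K T) (fun s => worstGap μ s b) (phaseIndex T μ) e t,
        √(segLen (badRate C₀ K T) (fun s => worstGap μ s b) (phaseIndex T μ) e v : ℝ) ≤
      20 * Real.log T * √((t : ℝ) - e) := by
    by_contra hcon
    obtain ⟨v, hv, r, hr1, hr2, hr3⟩ := hfound e t b he1 het htT (not_le.1 hcon).le
    have hlen := four_mul_le_segLen hT hμ hv
    have hve := Finset.mem_Ico.1 (Finset.mem_filter.1 hv).1
    have hub := segStart_bounds (β := badRate C₀ K T) (d := fun s => worstGap μ s b)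
      (idx := phaseIndex T μ) v hve.1
    have hnv : segLen (badRate C₀ K T) (fun s => worstGap μ s b) (phaseIndex T μ) e v = v + 1 -
      segStart (badRate C₀ K T) (fun s => worstGap μ s b) (phaseIndex T μ) e v := rfl
    refine hev (mem_evicted_of_replay h hT hC hμ hc ht' hv hr1 hr2 ?_)
    have hep : ep (r - 1) = e := by rw [← hte]; exact h.ep_eq ht1 htT (by omega) (by omega)
    have hon' := hon r (2 ^ Nat.clog 2
      (segLen (badRate C₀ K T) (fun s => worstGap μ s b) (phaseIndex T μ) e v)) (by omega) (by omega)
    rw [hep] at hon'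
    refine (Nat.le_pow_clog Nat.one_lt_two _).trans (hon' ?_ hr3)
    refine Finset.mem_image.2 ⟨_, Finset.mem_Icc.2 ⟨?_, Nat.clog_mono_right 2 (by omega)⟩, rfl⟩
    exact Nat.clog_pos (by norm_num) (by omega)
  have hsub : ∀ i, (Finset.Icc e t).filter (fun r => phaseIndex T μ r = i) ⊆
      (Finset.Icc 1 T).filter fun r => ep r = e ∧ phaseIndex T μ r = i := by
    intro i r hr
    obtain ⟨h1, h2⟩ := Finset.mem_filter.1 hr
    rw [Finset.mem_Icc] at h1
    exact Finset.mem_filter.2 ⟨Finset.mem_Icc.2 ⟨by omega, by omega⟩,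
      by rw [← hte]; exact h.ep_eq ht1 htT (by omega) h1.2, h2⟩
  have hphase : √(K : ℝ) * ∑ i ∈ Finset.range (phaseIndex T μ t + 1),
      √(((Finset.Icc e t).filter fun r => phaseIndex T μ r = i).card : ℝ) ≤
      episodeSum T μ ep e := by
    unfold episodeSum
    rw [Finset.mul_sum]
    refine (Finset.sum_le_sum fun i _ => ?_).trans (Finset.sum_le_sum_of_subset_of_nonneg
      (Finset.range_mono (by
        have := (phaseIndex_spec (μ := μ) (by omega : 1 ≤ T) ht1 htT).1
        omega)) fun _ _ _ => Real.sqrt_nonneg _)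
    rw [← Real.sqrt_mul (by linarith)]
    refine Real.sqrt_le_sqrt ?_
    have := Finset.card_le_card (hsub i)
    gcongr
    exact this
  have htime : √(K : ℝ) * √((t : ℝ) - e) ≤ episodeSum T μ ep e := by
    refine le_trans ?_ (sqrt_card_episode_le hT e)
    rw [← Real.sqrt_mul (by linarith)]
    refine Real.sqrt_le_sqrt ?_
    have h1 : Finset.Ioc e t ⊆ (Finset.Icc 1 T).filter fun r => ep r = e := by
      intro r hr
      rw [Finset.mem_Ioc] at hr
      exact Finset.mem_filter.2 ⟨Finset.mem_Icc.2 ⟨by omega, by omega⟩,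
        by rw [← hte]; exact h.ep_eq ht1 htT (by omega) hr.2⟩
    have h2 := Finset.card_le_card h1
    rw [Nat.card_Ioc] at h2
    have h3 : (t : ℝ) - e ≤ (((Finset.Icc 1 T).filter fun r => ep r = e).card : ℝ) := by
      have h4 := (Nat.cast_le (α := ℝ)).2 h2
      rw [Nat.cast_sub het.le] at h4
      exact h4
    gcongr
  set W := episodeSum T μ ep e with hW
  have hW0 : 0 ≤ W := Finset.sum_nonneg fun _ _ => Real.sqrt_nonneg _
  have hβ : badRate C₀ K T + 1 ≤ (4 * √C₀ + 78) * Real.log T * √K := by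
    unfold badRate
    nlinarith [mul_le_mul hL hsK zero_le_one (by linarith : 0 ≤ Real.log T)]
  set S₁ := ∑ v ∈ badEnds (badRate C₀ K T) (fun s => worstGap μ s b) (phaseIndex T μ) e t,
        √(segLen (badRate C₀ K T) (fun s => worstGap μ s b) (phaseIndex T μ) e v : ℝ)
  set S₂ := ∑ i ∈ Finset.range (phaseIndex T μ t + 1),
      √(((Finset.Icc e t).filter fun r => phaseIndex T μ r = i).card : ℝ) with hS₂
  have hS₁0 : 0 ≤ S₁ := Finset.sum_nonneg fun _ _ => Real.sqrt_nonneg _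
  have hS₂0 : 0 ≤ S₂ := Finset.sum_nonneg fun _ _ => Real.sqrt_nonneg _
  calc ∑ s ∈ Finset.Icc e t, worstGap μ s b ≤ (badRate C₀ K T + 1) * (S₁ + S₂) := hmain
    _ ≤ ((4 * √C₀ + 78) * Real.log T * √K) * (20 * Real.log T * √((t : ℝ) - e) + S₂) := by gcongr
    _ = ((4 * √C₀ + 78) * Real.log T) *
        (20 * Real.log T * (√K * √((t : ℝ) - e)) + √K * S₂) := by ring
    _ ≤ ((4 * √C₀ + 78) * Real.log T) * (20 * Real.log T * W + W) := by gcongr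
    _ ≤ ((4 * √C₀ + 78) * Real.log T) * (20 * Real.log T * W + 2 * Real.log T * W) := by
        gcongr
        nlinarith
    _ = 22 * (4 * √C₀ + 78) * Real.log T ^ 2 * W := by ring

end

/-! ### Summation over episodes -/

section

variable {K : ℕ} {C₀ : ℝ} {T : ℕ} {ep rlen act : ℕ → ℕ} {arms : ℕ → Finset (Fin K)}
  {est : ℕ → Fin K → ℝ} {μ : ℕ → Fin K → ℝ}

/-- Regret of an episode. The comparison arm is one that is still in the master set at the last check
round; it is a candidate at all the check rounds. -/
theorem sum_avgGap_episode_le (h : IsRun C₀ T ep rlen act arms est) (hK : 1 ≤ K) (hKT : K ≤ T)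
    (hT : 2 ≤ T) (hC : 400 ≤ C₀) (hμ : ∀ t a, μ t a ∈ Set.Icc (0 : ℝ) 1)
    (hc : Concentrated T μ arms est)
    {on : ℕ → ℕ → ℕ → Prop} (hfound : ReplaysFound C₀ T μ on)
    (hon : ∀ r m, 2 ≤ r → r ≤ T → m ∈ durations T → on r (ep (r - 1)) m → m ≤ rlen r) (e : ℕ) :
    ∑ t ∈ Finset.Icc 1 T with ep t = e, avgGap μ arms t ≤
      (100 * √C₀ + 2000) * Real.log T ^ 2 * (episodeSum T μ ep e +
        ∑ g ∈ Finset.Icc 1 T with ep g = e ∧ 0 < rlen g, √(K * ((rlen g : ℝ) + 1))) := by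
  have hL := sixty_nine_le_log hT
  have hS := Real.sqrt_nonneg C₀
  have hK' : (1 : ℝ) ≤ K := by exact_mod_cast hK
  set W := episodeSum T μ ep e with hW
  set V := ∑ g ∈ Finset.Icc 1 T with ep g = e ∧ 0 < rlen g, √(K * ((rlen g : ℝ) + 1)) with hV
  have hW0 : 0 ≤ W := Finset.sum_nonneg fun _ _ => Real.sqrt_nonneg _
  have hV0 : 0 ≤ V := Finset.sum_nonneg fun _ _ => Real.sqrt_nonneg _
  set Ep := (Finset.Icc 1 T).filter fun t => ep t = e with hEp
  by_cases hne : Ep.Nonempty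
  swap
  · rw [Finset.not_nonempty_iff_eq_empty.1 hne, Finset.sum_empty]
    positivity
  obtain ⟨t₀, ht₀⟩ := hne
  have ht₀' := Finset.mem_filter.1 ht₀
  rw [Finset.mem_Icc] at ht₀'
  have hge : ∀ t ∈ Ep, 1 ≤ t ∧ t ≤ T ∧ ep t = e ∧ e ≤ t := by
    intro t ht
    obtain ⟨h1, h2⟩ := Finset.mem_filter.1 ht
    rw [Finset.mem_Icc] at h1
    exact ⟨h1.1, h1.2, h2, h2 ▸ (h.ep_bounds h1.1 h1.2).2⟩
  have hcard : √((K : ℝ) * Ep.card) ≤ W := sqrt_card_episode_le hT e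
  have hW1 : 1 ≤ W := by
    refine le_trans (Real.one_le_sqrt.2 ?_) hcard
    have : (1 : ℝ) ≤ Ep.card := by exact_mod_cast Finset.card_pos.2 ⟨t₀, ht₀⟩
    nlinarith
  -- rounds at which a call starts cost at most `1` each
  have hsplit : ∑ t ∈ Ep, avgGap μ arms t ≤
      W + V + ∑ t ∈ checkRounds T ep rlen e, avgGap μ arms t := by
    have hpt : ∀ t ∈ Ep, avgGap μ arms t ≤ (if t = e then 1 else 0) +
        (if 0 < rlen t then √(K * ((rlen t : ℝ) + 1)) else 0) +
        (if e < t ∧ rlen t = 0 then avgGap μ arms t else 0) := by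
      intro t ht
      obtain ⟨h1, h2, h3, h4⟩ := hge t ht
      have hle := avgGap_le_one (arms := arms) hμ t
      by_cases hr : 0 < rlen t
      · rw [if_pos hr, if_neg (fun hcon : e < t ∧ rlen t = 0 => by omega)]
        have : 1 ≤ √(K * ((rlen t : ℝ) + 1)) := by
          refine Real.one_le_sqrt.2 ?_
          have : (0 : ℝ) ≤ rlen t := Nat.cast_nonneg _
          nlinarith
        split_ifs <;> linarith
      · rw [if_neg hr]
        by_cases he : t = e
        · rw [if_pos he, if_neg (by omega)]; linarith
        · rw [if_neg he, if_pos (by omega)]; linarith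
    refine (Finset.sum_le_sum hpt).trans ?_
    rw [Finset.sum_add_distrib, Finset.sum_add_distrib]
    refine add_le_add (add_le_add ?_ ?_) ?_
    · refine le_trans ?_ hW1
      rw [Finset.sum_ite_eq']
      split_ifs <;> norm_num
    · rw [← Finset.sum_filter, hEp, Finset.filter_filter]
    · rw [← Finset.sum_filter, hEp, Finset.filter_filter, checkRounds]
  have hcheck : ∑ t ∈ checkRounds T ep rlen e, avgGap μ arms t ≤
      22 * (4 * √C₀ + 78) * Real.log T ^ 2 * W +
      (1 + Real.log K) * ((√C₀ + 14) * Real.log T * (W + 2 * V)) := by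
    have hKlog : 0 ≤ Real.log K := Real.log_natCast_nonneg K
    by_cases hcne : (checkRounds T ep rlen e).Nonempty
    swap
    · rw [Finset.not_nonempty_iff_eq_empty.1 hcne, Finset.sum_empty]
      positivity
    set tc := (checkRounds T ep rlen e).max' hcne with htc
    have htcm : tc ∈ checkRounds T ep rlen e := Finset.max'_mem _ _
    have hmem : ∀ t ∈ checkRounds T ep rlen e, 1 ≤ t ∧ t ≤ T ∧ ep t = e ∧ e < t ∧ rlen t = 0 := by
      intro t ht
      simp only [checkRounds, Finset.mem_filter, Finset.mem_Icc] at ht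
      tauto
    obtain ⟨c1, c2, c3, c4, c5⟩ := hmem tc htcm
    obtain ⟨b, hb⟩ : ∃ b, b ∉ evicted C₀ T est e tc := by
      by_contra hcon
      push Not at hcon
      have := h.check tc c1 c2 (by omega) c5
      rw [c3] at this
      exact this (Finset.eq_univ_iff_forall.2 hcon)
    have hbarm : ∀ t ∈ checkRounds T ep rlen e, b ∈ arms t := by
      intro t ht
      obtain ⟨d1, d2, d3, d4, d5⟩ := hmem t ht
      exact h.mem_arms_of_notMem_evicted d1 d2 (d3 ▸ h.act_ge t d1 d2)
        (Finset.le_max' _ t ht) hb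
    have hD : ∀ t ∈ checkRounds T ep rlen e, (t : ℝ) - e ≤ (Ep.card : ℝ) := by
      intro t ht
      obtain ⟨d1, d2, d3, d4, d5⟩ := hmem t ht
      have hsub : Finset.Ioc e t ⊆ Ep := by
        intro r hr
        rw [Finset.mem_Ioc] at hr
        exact Finset.mem_filter.2 ⟨Finset.mem_Icc.2 ⟨by omega, by omega⟩,
          by rw [← d3]; exact h.ep_eq d1 d2 (by omega) hr.2⟩
      have h2 := Finset.card_le_card hsub
      rw [Nat.card_Ioc] at h2
      have h4 := (Nat.cast_le (α := ℝ)).2 h2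
      rwa [Nat.cast_sub d4.le] at h4
    refine (sum_checkRounds_le h hT (by linarith) hμ hc hbarm (Nat.cast_nonneg _) hD).trans ?_
    refine add_le_add ?_ ?_
    · refine le_trans ?_ (sum_worstGap_le h hT hC hμ hc hfound hon htcm hb)
      refine Finset.sum_le_sum_of_subset_of_nonneg (fun t ht => ?_)
        fun t _ _ => worstGap_nonneg μ t b
      exact Finset.mem_Icc.2 ⟨(hmem t ht).2.2.2.1.le, Finset.le_max' _ t ht⟩
    · gcongr
  have hlogK : Real.log K ≤ Real.log T :=
    Real.log_le_log (by linarith) (by exact_mod_cast hKT)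
  have h1 : (1 + Real.log K) * ((√C₀ + 14) * Real.log T * (W + 2 * V)) ≤
      (2.5 * Real.log T) * ((√C₀ + 14) * Real.log T * (W + 2 * V)) := by
    gcongr
    linarith
  have hL2 : 1 ≤ 2.2 * Real.log T ^ 2 := by nlinarith
  have hSW : 0 ≤ √C₀ * (Real.log T ^ 2 * W) := by positivity
  have hSV : 0 ≤ √C₀ * (Real.log T ^ 2 * V) := by positivity
  have hLW : 0 ≤ Real.log T ^ 2 * W := by positivity
  have hLV : 0 ≤ Real.log T ^ 2 * V := by positivity
  have hWV := mul_le_mul_of_nonneg_right hL2 (add_nonneg hW0 hV0)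
  calc ∑ t ∈ Ep, avgGap μ arms t ≤ (W + V) + (22 * (4 * √C₀ + 78) * Real.log T ^ 2 * W +
        (2.5 * Real.log T) * ((√C₀ + 14) * Real.log T * (W + 2 * V))) := by linarith
    _ ≤ 2.2 * Real.log T ^ 2 * (W + V) + (22 * (4 * √C₀ + 78) * Real.log T ^ 2 * W +
        (2.5 * Real.log T) * ((√C₀ + 14) * Real.log T * (W + 2 * V))) := by linarith
    _ ≤ (100 * √C₀ + 2000) * Real.log T ^ 2 * (W + V) := by nlinarith

/-- By the end of an episode, every arm has incurred significant regret within it. -/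
theorem exists_noSafeArm (h : IsRun C₀ T ep rlen act arms est) (hT : 2 ≤ T)
    (hC : 400 ≤ C₀) (hμ : ∀ t a, μ t a ∈ Set.Icc (0 : ℝ) 1) (hc : Concentrated T μ arms est)
    {e t t' : ℕ} (h1 : 1 ≤ t) (he : ep t = e) (htt' : t ≤ t') (hT' : t' ≤ T) (he' : ep t' ≠ e) :
    ∃ f, f < t' ∧ NoSafeArm μ e f := by
  induction t', htt' using Nat.le_induction with
  | base => exact absurd he he'
  | succ n hn ih =>
    by_cases hen : ep n = e
    · refine ⟨n, Nat.lt_succ_self n, fun a => ?_⟩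
      rcases h.ep_succ n (by omega) (by omega) with h2 | ⟨-, -, h2⟩
      · exact absurd (h2.trans hen) he'
      · rw [hen] at h2
        have hb := h.ep_bounds h1 (by omega)
        have hlo : ∀ s, e ≤ s → s < n + 1 → e ≤ act s := fun s hs1 hs2 => by
          have h3 : ep s = ep n := h.ep_eq (by omega) (by omega) (by omega) (by omega)
          rw [← hen, ← h3]
          exact h.act_ge s (by omega) (by omega)
        obtain ⟨s₁, s₂, g1, g2, g3, g4⟩ := exists_significantRegret h hT hC hμ hc
          (lo := e) (by omega) a (n + 1) (by omega) hlo (by rw [h2]; exact Finset.mem_univ a)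
        exact ⟨s₁, s₂, g1, g2, by omega, g4⟩
    · obtain ⟨f, hf1, hf2⟩ := ih (by omega) hen
      exact ⟨f, by omega, hf2⟩

/-- Each phase meets at most two episodes: otherwise one of them lies entirely within the phase, and
there is no safe arm when it ends. -/
theorem sum_episodeSum_le (h : IsRun C₀ T ep rlen act arms est) (hK : 1 ≤ K) (hT : 2 ≤ T)
    (hC : 400 ≤ C₀) (hμ : ∀ t a, μ t a ∈ Set.Icc (0 : ℝ) 1) (hc : Concentrated T μ arms est) :
    ∑ e ∈ Finset.Icc 1 T, episodeSum T μ ep e ≤ 2 * phaseSum T μ := by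
  unfold episodeSum phaseSum
  rw [Finset.sum_comm, Finset.mul_sum]
  refine Finset.sum_le_sum fun i hi => ?_
  have hiN : i ≤ numShifts T μ := by simpa [Nat.lt_succ_iff] using hi
  have hτ := shiftTime_le_of_le_numShifts (μ := μ) (by omega : 1 ≤ T) hiN
  have hτ' : shiftTime T μ i < shiftTime T μ (i + 1) := (nextShift_bounds hτ).1
  set E := (Finset.Icc 1 T).filter fun e => 0 < overlap T μ ep e i with hE
  have hmem : ∀ e ∈ E, ∃ r, 1 ≤ r ∧ r ≤ T ∧ ep r = e ∧ shiftTime T μ i ≤ r ∧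
      r < shiftTime T μ (i + 1) := by
    intro e he
    obtain ⟨r, hr⟩ := Finset.card_pos.1 (Finset.mem_filter.1 he).2
    obtain ⟨hr1, hr2, hr3⟩ := Finset.mem_filter.1 hr
    rw [Finset.mem_Icc] at hr1
    have := phaseIndex_spec (μ := μ) (by omega : 1 ≤ T) hr1.1 hr1.2
    rw [hr3] at this
    exact ⟨r, hr1.1, hr1.2, hr2, this.2.1, this.2.2⟩
  have hthree : ∀ e₁ ∈ E, ∀ e₂ ∈ E, ∀ e₃ ∈ E, e₁ < e₂ → e₂ < e₃ → False := by
    intro e₁ h1 e₂ h2 e₃ h3 h12 h23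
    obtain ⟨r₁, a1, a2, a3, a4, a5⟩ := hmem e₁ h1
    obtain ⟨r₂, b1, b2, b3, b4, b5⟩ := hmem e₂ h2
    obtain ⟨r₃, c1, c2, c3, c4, c5⟩ := hmem e₃ h3
    have he₂ := h.ep_bounds b1 b2
    have he₃ := h.ep_bounds c1 c2
    have hee₂ : ep e₂ = e₂ := b3 ▸ h.ep_ep b1 b2
    have hee₃ : ep e₃ = e₃ := c3 ▸ h.ep_ep c1 c2
    have hr₁ : r₁ < e₂ := by
      by_contra hcon
      have := h.ep_mono (by omega) (not_lt.1 hcon) a2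
      omega
    obtain ⟨f, hf1, hf2⟩ := exists_noSafeArm h hT hC hμ hc (t := e₂) (t' := e₃) (e := e₂)
      (by omega) hee₂ h23.le (by omega) (by omega)
    have hns : NoSafeArm μ (shiftTime T μ i) f := fun a => by
      obtain ⟨s₁, s₂, g1, g2⟩ := hf2 a
      exact ⟨s₁, s₂, by omega, g2⟩
    obtain ⟨s₁, s₂, g1, g2, g3, -⟩ := hf2 ⟨0, hK⟩
    have h4 : shiftTime T μ (i + 1) ≤ f := nextShift_le (by omega) (by omega) hns
    omega
  have hEcard : E.card ≤ 2 := by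
    by_cases hne : E.Nonempty
    · have hsub : E ⊆ {E.min' hne, E.max' hne} := by
        intro e he
        by_contra hcon
        rw [Finset.mem_insert, Finset.mem_singleton, not_or] at hcon
        exact hthree _ (E.min'_mem hne) e he _ (E.max'_mem hne)
          (lt_of_le_of_ne (E.min'_le e he) (Ne.symm hcon.1))
          (lt_of_le_of_ne (E.le_max' e he) hcon.2)
      exact (Finset.card_le_card hsub).trans Finset.card_le_two
    · rw [Finset.not_nonempty_iff_eq_empty.1 hne]; simp
  have hov : ∀ e, (overlap T μ ep e i : ℝ) ≤
      (shiftTime T μ (i + 1) : ℝ) - (shiftTime T μ i : ℝ) := by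
    intro e
    have hsub : ((Finset.Icc 1 T).filter fun r => ep r = e ∧ phaseIndex T μ r = i) ⊆
        Finset.Ico (shiftTime T μ i) (shiftTime T μ (i + 1)) := by
      intro r hr
      obtain ⟨hr1, hr2, hr3⟩ := Finset.mem_filter.1 hr
      rw [Finset.mem_Icc] at hr1
      have := phaseIndex_spec (μ := μ) (by omega : 1 ≤ T) hr1.1 hr1.2
      rw [hr3] at this
      exact Finset.mem_Ico.2 this.2
    have h2 := Finset.card_le_card hsub
    rw [Nat.card_Ico] at h2
    have h4 := (Nat.cast_le (α := ℝ)).2 h2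
    rwa [Nat.cast_sub hτ'.le] at h4
  calc ∑ e ∈ Finset.Icc 1 T, √((K : ℝ) * overlap T μ ep e i)
      = ∑ e ∈ E, √((K : ℝ) * overlap T μ ep e i) := by
        rw [hE, Finset.sum_filter]
        refine Finset.sum_congr rfl fun e _ => ?_
        split_ifs with h0
        · rfl
        · rw [Nat.eq_zero_of_not_pos h0]; simp
    _ ≤ ∑ e ∈ E, √((K : ℝ) * ((shiftTime T μ (i + 1) : ℝ) - (shiftTime T μ i : ℝ))) := by
        refine Finset.sum_le_sum fun e _ => ?_
        have := hov e
        gcongr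
    _ = E.card * √((K : ℝ) * ((shiftTime T μ (i + 1) : ℝ) - (shiftTime T μ i : ℝ))) := by
        rw [Finset.sum_const, nsmul_eq_mul]
    _ ≤ 2 * √((K : ℝ) * ((shiftTime T μ (i + 1) : ℝ) - (shiftTime T μ i : ℝ))) := by
        have : (E.card : ℝ) ≤ 2 := by exact_mod_cast hEcard
        gcongr

theorem sum_eq_sum_episodes (h : IsRun C₀ T ep rlen act arms est) (f : ℕ → ℝ) :
    ∑ t ∈ Finset.Icc 1 T, f t =
      ∑ e ∈ Finset.Icc 1 T, ∑ t ∈ Finset.Icc 1 T with ep t = e, f t := by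
  refine (Finset.sum_fiberwise_of_maps_to (fun t ht => ?_) _).symm
  rw [Finset.mem_Icc] at ht ⊢
  have := h.ep_bounds ht.1 ht.2
  omega

/-- Regret of a trajectory along which the estimates concentrate and the replays are found. -/
theorem sum_avgGap_le (h : IsRun C₀ T ep rlen act arms est) (hK : 1 ≤ K) (hKT : K ≤ T)
    (hT : 2 ≤ T) (hC : 400 ≤ C₀) (hμ : ∀ t a, μ t a ∈ Set.Icc (0 : ℝ) 1)
    (hc : Concentrated T μ arms est)
    {on : ℕ → ℕ → ℕ → Prop} (hfound : ReplaysFound C₀ T μ on)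
    (hon : ∀ r m, 2 ≤ r → r ≤ T → m ∈ durations T → on r (ep (r - 1)) m → m ≤ rlen r) :
    ∑ t ∈ Finset.Icc 1 T, avgGap μ arms t ≤
      (100 * √C₀ + 2000) * Real.log T ^ 2 * (2 * phaseSum T μ +
        ∑ g ∈ Finset.Icc 1 T with 0 < rlen g, √(K * ((rlen g : ℝ) + 1))) := by
  have hL := sixty_nine_le_log hT
  rw [sum_eq_sum_episodes h]
  refine (Finset.sum_le_sum fun e _ =>
    sum_avgGap_episode_le h hK hKT hT hC hμ hc hfound hon e).trans ?_
  rw [← Finset.mul_sum, Finset.sum_add_distrib]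
  have h1 : ∑ e ∈ Finset.Icc 1 T, ∑ g ∈ Finset.Icc 1 T with ep g = e ∧ 0 < rlen g,
      √(K * ((rlen g : ℝ) + 1)) =
      ∑ g ∈ Finset.Icc 1 T with 0 < rlen g, √(K * ((rlen g : ℝ) + 1)) := by
    rw [Finset.sum_filter]
    refine (Eq.trans (sum_eq_sum_episodes h _) ?_).symm
    refine Finset.sum_congr rfl fun e _ => ?_
    rw [← Finset.sum_filter, Finset.filter_filter]
  rw [h1]
  have := sum_episodeSum_le h hK hT hC hμ hc
  gcongr

theorem sum_inv_sqrt_le (e : ℕ) (F : Finset ℕ) (hF : ∀ q ∈ F, e ≤ q) :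
    ∑ q ∈ F, 1 / √((q : ℝ) + 1 - e) ≤ 2 * √(F.card : ℝ) := by
  induction F using Finset.induction_on_max with
  | empty => simp
  | insert a s has ih =>
    have hna : a ∉ s := fun h => lt_irrefl _ (has a h)
    rw [Finset.sum_insert hna, Finset.card_insert_of_notMem hna]
    have ih := ih fun q hq => hF q (Finset.mem_insert_of_mem hq)
    have hea := hF a (Finset.mem_insert_self _ _)
    have hcard : s.card ≤ a - e := by
      have : s ⊆ Finset.Ico e a := fun q hq =>
        Finset.mem_Ico.2 ⟨hF q (Finset.mem_insert_of_mem hq), has q hq⟩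
      simpa using Finset.card_le_card this
    have hcard' : (s.card : ℝ) + 1 ≤ (a : ℝ) + 1 - e := by
      have := (Nat.cast_le (α := ℝ)).2 hcard
      rw [Nat.cast_sub hea] at this
      linarith
    set n : ℝ := (s.card : ℝ) with hn
    have hn0 : 0 ≤ n := Nat.cast_nonneg _
    have h1 : 1 / √((a : ℝ) + 1 - e) ≤ 1 / √(n + 1) :=
      one_div_le_one_div_of_le (by positivity) (Real.sqrt_le_sqrt hcard')
    have h2 : 1 / √(n + 1) ≤ 2 * (√(n + 1) - √n) := by
      have hp : 0 < √(n + 1) := by positivity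
      rw [div_le_iff₀ hp]
      have h3 := Real.mul_self_sqrt (by linarith : 0 ≤ n + 1)
      have h4 := Real.mul_self_sqrt hn0
      nlinarith [sq_nonneg (√(n + 1) - √n)]
    push_cast
    linarith

theorem sum_inv_sqrt_episode_le (h : IsRun C₀ T ep rlen act arms est) (hK : 1 ≤ K) (hT : 2 ≤ T)
    (hC : 400 ≤ C₀) (hμ : ∀ t a, μ t a ∈ Set.Icc (0 : ℝ) 1) (hc : Concentrated T μ arms est) :
    √(K : ℝ) * ∑ q ∈ Finset.Icc 1 T, 1 / √((q : ℝ) + 1 - ep q) ≤ 4 * phaseSum T μ := by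
  have h1 : ∑ q ∈ Finset.Icc 1 T, 1 / √((q : ℝ) + 1 - ep q) =
      ∑ e ∈ Finset.Icc 1 T, ∑ q ∈ Finset.Icc 1 T with ep q = e, 1 / √((q : ℝ) + 1 - e) := by
    rw [sum_eq_sum_episodes h]
    refine Finset.sum_congr rfl fun e _ => Finset.sum_congr rfl fun q hq => ?_
    rw [(Finset.mem_filter.1 hq).2]
  rw [h1, Finset.mul_sum]
  have h2 : ∀ e ∈ Finset.Icc 1 T, √(K : ℝ) * ∑ q ∈ Finset.Icc 1 T with ep q = e,
      1 / √((q : ℝ) + 1 - e) ≤ 2 * episodeSum T μ ep e := by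
    intro e _
    have h3 := sum_inv_sqrt_le e ((Finset.Icc 1 T).filter fun q => ep q = e) fun q hq => by
      obtain ⟨hq1, hq2⟩ := Finset.mem_filter.1 hq
      rw [Finset.mem_Icc] at hq1
      exact hq2 ▸ (h.ep_bounds hq1.1 hq1.2).2
    have h4 := sqrt_card_episode_le (μ := μ) (ep := ep) hT e
    rw [Real.sqrt_mul (Nat.cast_nonneg K)] at h4
    have := mul_le_mul_of_nonneg_left h3 (Real.sqrt_nonneg (K : ℝ))
    linarith
  refine (Finset.sum_le_sum h2).trans ?_
  rw [← Finset.mul_sum]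
  have := sum_episodeSum_le h hK hT hC hμ hc
  linarith

end

/-! ### From the call stack to trajectories -/

section

variable {K : ℕ}

/-- First round of the episode that contains round `t`. -/
noncomputable def episodeAt (C₀ : ℝ) (T : ℕ) (ω : ℕ → RoundSeed K) (t : ℕ) : ℕ :=
  (stateAfter C₀ T ω (t - 1)).episode

/-- First round of the call that is active at round `t`. -/
noncomputable def activeAt (C₀ : ℝ) (T : ℕ) (ω : ℕ → RoundSeed K) (t : ℕ) : ℕ :=
  (stateAfter C₀ T ω (t - 1)).active.start

/-- The candidate set `𝒜_t`. -/
noncomputable def armsAt (C₀ : ℝ) (T : ℕ) (ω : ℕ → RoundSeed K) (t : ℕ) : Finset (Fin K) :=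
  (stateAfter C₀ T ω (t - 1)).active.arms

/-- Duration of the replay that starts at round `t`, or `0` if none does. -/
noncomputable def replayLen (C₀ : ℝ) (T : ℕ) (ω : ℕ → RoundSeed K) (t : ℕ) : ℕ :=
  if t ≤ 1 then 0
  else ((durations T).filter fun m => (ω t).2.2 (episodeAt C₀ T ω (t - 1), m) = true).sup id

/-- The importance-weighted rewards `|𝒜_s| Y_s(a) 𝟙{π_s = a}`. -/
noncomputable def estAt (C₀ : ℝ) (T : ℕ) (ω : ℕ → RoundSeed K) (s : ℕ) (a : Fin K) : ℝ :=
  if metaArm C₀ T s ω = a then ((armsAt C₀ T ω s).card : ℝ) * (ω s).1 (metaArm C₀ T s ω) else 0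

theorem durations_pos {T m : ℕ} (hm : m ∈ durations T) : 0 < m := by
  obtain ⟨n, -, rfl⟩ := Finset.mem_image.1 hm
  positivity

/-- The call to which the algorithm returns: the innermost one that has not expired. -/
theorem resume_spec (C₀ : ℝ) (T t : ℕ) (S : State K) (L : List (Frame K))
    (hL : ∃ f ∈ L, t ≤ f.start + f.dur) :
    ∃ L₁ f L₂, L = L₁ ++ f :: L₂ ∧ (∀ g ∈ L₁, g.start + g.dur < t) ∧ t ≤ f.start + f.dur ∧
      ((S.master \ evicted C₀ T S.est S.episode t = ∅ ∧ resume C₀ T t S L = newEpisode T t S.est) ∨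
       (S.master \ evicted C₀ T S.est S.episode t ≠ ∅ ∧ resume C₀ T t S L =
        { S with
          master := S.master \ evicted C₀ T S.est S.episode t
          active := ⟨f.start, f.dur, f.arms \ evicted C₀ T S.est f.start t⟩
          suspended := L₂ })) := by
  induction L with
  | nil => simp at hL
  | cons f L ih =>
    by_cases hf : f.start + f.dur < t
    · have hL' : ∃ g ∈ L, t ≤ g.start + g.dur := by
        obtain ⟨g, hg, hgt⟩ := hL
        rcases List.mem_cons.1 hg with rfl | hg
        · omega
        · exact ⟨g, hg, hgt⟩
      obtain ⟨L₁, g, L₂, h1, h2, h3, h4⟩ := ih hL'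
      refine ⟨f :: L₁, g, L₂, by rw [h1]; rfl, ?_, h3, ?_⟩
      · intro g' hg'
        rcases List.mem_cons.1 hg' with rfl | hg'
        exacts [hf, h2 g' hg']
      · rw [resume, if_pos hf]; exact h4
    · refine ⟨[], f, L, rfl, by simp, not_lt.1 hf, ?_⟩
      rw [resume, if_neg hf]
      by_cases hm : S.master \ evicted C₀ T S.est S.episode t = ∅
      · exact Or.inl ⟨hm, by simp [hm]⟩
      · exact Or.inr ⟨hm, by simp [hm]⟩

/-- What the call stack looks like just before round `t` is played: it contains all the calls of the
episode that have not expired, and the active call has just evicted arms. -/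
structure StackInvariant (C₀ : ℝ) (T : ℕ) (ω : ℕ → RoundSeed K) (t : ℕ) (S : State K) : Prop where
  one_le_episode : 1 ≤ S.episode
  episode_le : S.episode ≤ t
  est_eq : ∀ s, 1 ≤ s → s < t → S.est s = estAt C₀ T ω s
  sorted : (S.active :: S.suspended).Pairwise fun f g => g.start < f.start
  frame : ∀ f ∈ S.active :: S.suspended, f.start ≤ t ∧
    ((f.start = S.episode ∧ f.dur = T + 1 - S.episode) ∨
     (S.episode < f.start ∧ 0 < replayLen C₀ T ω f.start ∧ f.dur = replayLen C₀ T ω f.start))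
  root : ∃ f ∈ S.active :: S.suspended, f.start = S.episode
  complete : ∀ s, S.episode < s → s ≤ t → 0 < replayLen C₀ T ω s → t ≤ s + replayLen C₀ T ω s →
    ∃ f ∈ S.active :: S.suspended, f.start = s
  arms_compl : ∀ f ∈ S.active :: S.suspended,
    ∀ a ∉ f.arms, a ∈ evicted C₀ T (estAt C₀ T ω) f.start t
  active_arms : S.active.arms = Finset.univ \ evicted C₀ T (estAt C₀ T ω) S.active.start t
  active_live : t ≤ S.active.start + S.active.dur
  master_compl : ∀ a ∉ S.master, a ∈ evicted C₀ T (estAt C₀ T ω) S.episode t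

variable {C₀ : ℝ} {T : ℕ} {ω : ℕ → RoundSeed K}

theorem stackInvariant_newEpisode {t : ℕ} (h1 : 1 ≤ t) {est : ℕ → Fin K → ℝ}
    (hest : ∀ s, 1 ≤ s → s < t → est s = estAt C₀ T ω s) :
    StackInvariant C₀ T ω t (newEpisode T t est) where
  one_le_episode := h1
  episode_le := le_rfl
  est_eq := hest
  sorted := by simp [newEpisode]
  frame := by simp [newEpisode]
  root := by simp [newEpisode]
  complete := by
    intro s hs hst
    simp only [newEpisode] at hs
    omega
  arms_compl := by simp [newEpisode]
  active_arms := by simp [newEpisode, evicted_self]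
  active_live := by simp only [newEpisode]; omega
  master_compl := by simp [newEpisode]

theorem stackInvariant_step {n : ℕ} (hT : n + 2 ≤ T)
    (h : StackInvariant C₀ T ω (n + 1) (stateAfter C₀ T ω n)) :
    StackInvariant C₀ T ω (n + 2) (stateAfter C₀ T ω (n + 1)) ∧
    ((episodeAt C₀ T ω (n + 2) = episodeAt C₀ T ω (n + 1) ∧ (replayLen C₀ T ω (n + 2) = 0 →
        evicted C₀ T (estAt C₀ T ω) (episodeAt C₀ T ω (n + 1)) (n + 2) ≠ Finset.univ)) ∨
     (episodeAt C₀ T ω (n + 2) = n + 2 ∧ replayLen C₀ T ω (n + 2) = 0 ∧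
        evicted C₀ T (estAt C₀ T ω) (episodeAt C₀ T ω (n + 1)) (n + 2) = Finset.univ)) := by
  classical
  set S := stateAfter C₀ T ω n with hS
  set S' : State K :=
    { S with
      est := Function.update S.est (n + 1) fun a =>
        if metaArm C₀ T (n + 1) ω = a then
          (S.active.arms.card : ℝ) * (ω (n + 1)).1 (metaArm C₀ T (n + 1) ω) else 0 } with hS'
  have hest : ∀ s, 1 ≤ s → s < n + 2 → S'.est s = estAt C₀ T ω s := by
    intro s hs1 hs2
    simp only [hS']
    by_cases hsn : s = n + 1
    · subst hsn
      rw [Function.update_self]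
      rfl
    · rw [Function.update_of_ne hsn]
      exact h.est_eq s hs1 (by omega)
  have hev : ∀ lo, 1 ≤ lo → evicted C₀ T S'.est lo (n + 2) =
      evicted C₀ T (estAt C₀ T ω) lo (n + 2) := fun lo hlo =>
    evicted_congr fun s hs1 hs2 => hest s (by omega) hs2
  have hmono : ∀ lo, evicted C₀ T (estAt C₀ T ω) lo (n + 1) ⊆
      evicted C₀ T (estAt C₀ T ω) lo (n + 2) := fun lo => evicted_mono le_rfl (by omega)
  set due : Finset ℕ := (durations T).filter fun m => (ω (n + 2)).2.2 (S.episode, m) = true with hdue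
  have hlen : replayLen C₀ T ω (n + 2) = due.sup id := by
    rw [replayLen, if_neg (by omega)]; rfl
  have hstate : stateAfter C₀ T ω (n + 1) = if hd : due.Nonempty then
      { S' with
        active := ⟨n + 2, due.max' hd, Finset.univ⟩
        suspended := S.active :: S.suspended }
    else resume C₀ T (n + 2) S' (S.active :: S.suspended) := rfl
  have hep1 : episodeAt C₀ T ω (n + 1) = S.episode := rfl
  have hep2 : episodeAt C₀ T ω (n + 2) = (stateAfter C₀ T ω (n + 1)).episode := rfl
  have hE1 := h.one_le_episode
  have hE2 := h.episode_le
  by_cases hd : due.Nonempty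
  · rw [dif_pos hd] at hstate
    have hmax : due.max' hd = replayLen C₀ T ω (n + 2) := by
      rw [hlen, Finset.max'_eq_sup', Finset.sup'_eq_sup]
    have hpos : 0 < replayLen C₀ T ω (n + 2) := by
      rw [← hmax]
      exact durations_pos (Finset.mem_filter.1 (due.max'_mem hd)).1
    rw [hep2, hep1, hstate]
    refine ⟨⟨hE1, by simp only [hS']; omega, hest, ?_, ?_, ?_, ?_, ?_, ?_, ?_, ?_⟩,
      Or.inl ⟨rfl, fun h0 => by omega⟩⟩
    · refine List.pairwise_cons.2 ⟨fun f hf => ?_, h.sorted⟩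
      have := (h.frame f hf).1
      simp only; omega
    · intro f hf
      rcases List.mem_cons.1 hf with rfl | hf
      · exact ⟨le_rfl, Or.inr ⟨by simp only [hS']; omega, hpos, hmax⟩⟩
      · obtain ⟨h1, h2⟩ := h.frame f hf
        exact ⟨by omega, h2⟩
    · obtain ⟨f, hf, hf'⟩ := h.root
      exact ⟨f, List.mem_cons_of_mem _ hf, hf'⟩
    · intro s hs1 hs2 hs3 hs4
      by_cases hsn : s = n + 2
      · exact ⟨_, List.mem_cons_self, hsn.symm⟩
      · obtain ⟨f, hf, hf'⟩ := h.complete s hs1 (by omega) hs3 (by omega)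
        exact ⟨f, List.mem_cons_of_mem _ hf, hf'⟩
    · intro f hf a ha
      rcases List.mem_cons.1 hf with rfl | hf
      · simp at ha
      · exact hmono _ (h.arms_compl f hf a ha)
    · simp [evicted_self]
    · simp
    · intro a ha
      exact hmono _ (h.master_compl a ha)
  · rw [dif_neg hd] at hstate
    have h0 : replayLen C₀ T ω (n + 2) = 0 := by
      rw [hlen, Finset.not_nonempty_iff_eq_empty.1 hd]; rfl
    have hroot : ∃ f ∈ S.active :: S.suspended, n + 2 ≤ f.start + f.dur := by
      obtain ⟨f, hf, hf'⟩ := h.root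
      refine ⟨f, hf, ?_⟩
      rcases (h.frame f hf).2 with h1 | h1 <;> omega
    obtain ⟨L₁, f, L₂, hL, hexp, hlive, hres⟩ :=
      resume_spec C₀ T (n + 2) S' (S.active :: S.suspended) hroot
    have hSS : S'.episode = S.episode := rfl
    have hSm : S'.master = S.master := rfl
    rw [hSS, hSm, hev _ hE1] at hres
    have hmaster : S.master \ evicted C₀ T (estAt C₀ T ω) S.episode (n + 2) = ∅ ↔
        evicted C₀ T (estAt C₀ T ω) S.episode (n + 2) = Finset.univ := by
      rw [Finset.sdiff_eq_empty_iff_subset, Finset.eq_univ_iff_forall]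
      refine ⟨fun hsub a => ?_, fun hall a _ => hall a⟩
      by_cases ha : a ∈ S.master
      · exact hsub ha
      · exact hmono _ (h.master_compl a ha)
    rcases hres with ⟨hm, hres⟩ | ⟨hm, hres⟩
    · rw [hep2, hep1, hstate, hres]
      refine ⟨stackInvariant_newEpisode (by omega) hest, Or.inr ⟨rfl, h0, hmaster.1 hm⟩⟩
    · have hfL : f ∈ S.active :: S.suspended := by rw [hL]; simp
      have hfstart : S.episode ≤ f.start := by
        rcases (h.frame f hfL).2 with h1 | h1 <;> omega
      have hsub : ∀ g ∈ L₂, g ∈ S.active :: S.suspended := fun g hg => by rw [hL]; simp [hg]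
      have hsort : (f :: L₂).Pairwise fun f g => g.start < f.start := by
        have := h.sorted
        rw [hL] at this
        exact (List.pairwise_append.1 this).2.1
      have harms : f.arms \ evicted C₀ T S'.est f.start (n + 2) =
          Finset.univ \ evicted C₀ T (estAt C₀ T ω) f.start (n + 2) := by
        rw [hev _ (by omega)]
        ext a
        simp only [Finset.mem_sdiff, Finset.mem_univ, true_and, and_iff_right_iff_imp]
        intro ha
        by_contra hcon
        exact ha (hmono _ (h.arms_compl f hfL a hcon))
      rw [harms] at hres
      rw [hep2, hep1, hstate, hres]
      -- a call that has not expired is not among the ones that have returned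
      have hkeep : ∀ g ∈ S.active :: S.suspended, n + 2 ≤ g.start + g.dur → g = f ∨ g ∈ L₂ := by
        intro g hg hgl
        rw [hL] at hg
        rcases List.mem_append.1 hg with hg | hg
        · have := hexp g hg; omega
        · exact List.mem_cons.1 hg
      refine ⟨⟨hE1, by simp only; omega, hest, ?_, ?_, ?_, ?_, ?_, rfl, hlive, ?_⟩,
        Or.inl ⟨rfl, fun _ hcon => hm (hmaster.2 hcon)⟩⟩
      · rw [List.pairwise_cons] at hsort ⊢
        exact hsort
      · intro g hg
        rcases List.mem_cons.1 hg with rfl | hg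
        · obtain ⟨h1, h2⟩ := h.frame f hfL
          exact ⟨by simp only; omega, h2⟩
        · obtain ⟨h1, h2⟩ := h.frame g (hsub g hg)
          exact ⟨by omega, h2⟩
      · obtain ⟨g, hg, hg'⟩ := h.root
        have hgl : n + 2 ≤ g.start + g.dur := by
          rcases (h.frame g hg).2 with h1 | h1 <;> omega
        rcases hkeep g hg hgl with rfl | hg2
        · exact ⟨_, List.mem_cons_self, hg'⟩
        · exact ⟨g, List.mem_cons_of_mem _ hg2, hg'⟩
      · intro s hs1 hs2 hs3 hs4
        have hsn : s ≠ n + 2 := fun hcon => by rw [hcon] at hs3; omega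
        obtain ⟨g, hg, hg'⟩ := h.complete s hs1 (by omega) hs3 (by omega)
        have hgl : n + 2 ≤ g.start + g.dur := by
          rcases (h.frame g hg).2 with h1 | h1
          · change S.episode < s at hs1; omega
          · rw [h1.2.2, hg']; exact hs4
        rcases hkeep g hg hgl with rfl | hg2
        · exact ⟨_, List.mem_cons_self, hg'⟩
        · exact ⟨g, List.mem_cons_of_mem _ hg2, hg'⟩
      · intro g hg a ha
        rcases List.mem_cons.1 hg with rfl | hg
        · simpa using ha
        · exact hmono _ (h.arms_compl g (hsub g hg) a ha)
      · intro a ha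
        by_cases haS : a ∈ S.master
        · simpa [haS] using ha
        · exact hmono _ (h.master_compl a haS)

theorem stackInvariant (n : ℕ) (hT : n + 1 ≤ T) :
    StackInvariant C₀ T ω (n + 1) (stateAfter C₀ T ω n) := by
  induction n with
  | zero => exact stackInvariant_newEpisode le_rfl fun s h1 h2 => by omega
  | succ n ih => exact (stackInvariant_step hT (ih (by omega))).1

/-- The stack-free description of the algorithm. -/
theorem isRun : IsRun C₀ T (episodeAt C₀ T ω) (replayLen C₀ T ω)
    (activeAt C₀ T ω) (armsAt C₀ T ω) (estAt C₀ T ω) := by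
  have hinv : ∀ t, 1 ≤ t → t ≤ T → StackInvariant C₀ T ω t (stateAfter C₀ T ω (t - 1)) := by
    intro t h1 h2
    obtain ⟨n, rfl⟩ : ∃ n, t = n + 1 := ⟨t - 1, by omega⟩
    exact stackInvariant n h2
  have hstep : ∀ t, 1 ≤ t → t < T → _ := fun t h1 h2 =>
    (stackInvariant_step (C₀ := C₀) (T := T) (ω := ω) (n := t - 1) (by omega)
      (stackInvariant (t - 1) (by omega))).2
  have hlive : ∀ t, 1 ≤ t → t ≤ T → activeAt C₀ T ω t = episodeAt C₀ T ω t ∨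
      (episodeAt C₀ T ω t < activeAt C₀ T ω t ∧ 0 < replayLen C₀ T ω (activeAt C₀ T ω t) ∧
        t ≤ activeAt C₀ T ω t + replayLen C₀ T ω (activeAt C₀ T ω t)) := by
    intro t h1 h2
    have h := hinv t h1 h2
    rcases (h.frame _ List.mem_cons_self).2 with h3 | h3
    · exact Or.inl h3.1
    · have := h.active_live
      rw [h3.2.2] at this
      exact Or.inr ⟨h3.1, h3.2.1, this⟩
  refine ⟨rfl, by simp [replayLen], fun t h1 h2 => ?_, fun t h1 h2 h3 h4 => ?_, fun t h1 h2 => ?_,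
    fun t h1 h2 => ?_, hlive, fun t h1 h2 s hs1 hs2 hs3 => ?_, fun t h1 h2 => ?_⟩
  · have := hstep t h1 h2
    rw [show t - 1 + 2 = t + 1 by omega, show t - 1 + 1 = t by omega] at this
    rcases this with h3 | h3
    · exact Or.inl h3.1
    · exact Or.inr h3
  · have ht1 : t ≠ 1 := by
      rintro rfl
      exact absurd h3 (by simp [episodeAt, stateAfter, newEpisode])
    have := hstep (t - 1) (by omega) (by omega)
    rw [show t - 1 - 1 + 2 = t by omega, show t - 1 - 1 + 1 = t - 1 by omega] at this
    rcases this with h5 | h5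
    · rw [h5.1]; exact h5.2 h4
    · omega
  · rcases hlive t h1 h2 with h3 | h3 <;> omega
  · exact ((hinv t h1 h2).frame _ List.mem_cons_self).1
  · have h := hinv t h1 h2
    by_contra hcon
    have hep : episodeAt C₀ T ω t < s := by
      rcases hlive t h1 h2 with h3 | h3 <;> omega
    obtain ⟨f, hf, hfs⟩ := h.complete s hep hs2 hs3 (not_lt.1 hcon)
    rcases List.mem_cons.1 hf with rfl | hf
    · exact absurd hfs hs1.ne
    · have h5 : f.start < activeAt C₀ T ω t := (List.pairwise_cons.1 h.sorted).1 f hf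
      omega
  · exact (hinv t h1 h2).active_arms

/-- A scheduled replay indicator makes the replay that starts at this round at least as long. -/
theorem le_replayLen {r m : ℕ} (hr : 2 ≤ r) (hm : m ∈ durations T)
    (hon : (ω r).2.2 (episodeAt C₀ T ω (r - 1), m) = true) : m ≤ replayLen C₀ T ω r := by
  rw [replayLen, if_neg (by omega)]
  exact Finset.le_sup (f := id) (Finset.mem_filter.2 ⟨hm, hon⟩)

end

/-! ### Resampling one round of a product measure -/

/-- If `φ` resamples a coordinate law using independent randomness, then resampling one coordinate of
a product measure does not change the product measure. -/
theorem measurePreserving_resample {X Z : Type*} [MeasurableSpace X] [MeasurableSpace Z]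
    (ν : ℕ → Measure X) [∀ i, IsProbabilityMeasure (ν i)] (ζ : Measure Z) [IsProbabilityMeasure ζ]
    (t : ℕ) (φ : X × Z → X) (hφ : MeasurePreserving φ ((ν t).prod ζ) (ν t)) :
    MeasurePreserving (fun p : (ℕ → X) × Z => Function.update p.1 t (φ (p.1 t, p.2)))
      ((Measure.infinitePi ν).prod ζ) (Measure.infinitePi ν) := by
  have hmeas : Measurable fun p : (ℕ → X) × Z => Function.update p.1 t (φ (p.1 t, p.2)) := by
    refine measurable_pi_lambda _ fun i => ?_
    by_cases hi : i = t
    · subst hi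
      simp only [Function.update_self]
      exact hφ.measurable.comp (((measurable_pi_apply i).comp measurable_fst).prodMk measurable_snd)
    · simp only [Function.update_of_ne hi]
      exact (measurable_pi_apply i).comp measurable_fst
  refine ⟨hmeas, ?_⟩
  refine Measure.eq_infinitePi ν fun s A hA => ?_
  have hbox : MeasurableSet (Set.pi (s : Set ℕ) A) :=
    MeasurableSet.pi s.countable_toSet fun i _ => hA i
  rw [Measure.map_apply hmeas hbox, Measure.prod_apply_symm (hmeas hbox)]
  have hslice : ∀ z, (fun ω : ℕ → X => (ω, z)) ⁻¹'
      ((fun p : (ℕ → X) × Z => Function.update p.1 t (φ (p.1 t, p.2))) ⁻¹' Set.pi (s : Set ℕ) A) =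
      Set.pi (s : Set ℕ) (Function.update A t ((fun x => φ (x, z)) ⁻¹' A t)) := by
    intro z
    ext ω
    simp only [Set.mem_preimage, Set.mem_pi]
    refine forall_congr' fun i => forall_congr' fun _ => ?_
    by_cases hi : i = t
    · subst hi; simp
    · simp [Function.update_of_ne hi]
  have hsec : ∀ z, MeasurableSet ((fun x => φ (x, z)) ⁻¹' A t) := fun z =>
    (hφ.measurable.comp (measurable_id.prodMk measurable_const)) (hA t)
  have hval : ∀ z, Measure.infinitePi ν ((fun ω : ℕ → X => (ω, z)) ⁻¹'
      ((fun p : (ℕ → X) × Z => Function.update p.1 t (φ (p.1 t, p.2))) ⁻¹' Set.pi (s : Set ℕ) A)) =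
      ∏ i ∈ s, ν i (Function.update A t ((fun x => φ (x, z)) ⁻¹' A t) i) := by
    intro z
    rw [hslice z]
    refine Measure.infinitePi_pi ν fun i _ => ?_
    by_cases hi : i = t
    · subst hi; simpa using hsec z
    · simpa [Function.update_of_ne hi] using hA i
  simp only [hval]
  by_cases hts : t ∈ s
  · have hprod : ∀ z, ∏ i ∈ s, ν i (Function.update A t ((fun x => φ (x, z)) ⁻¹' A t) i) =
        (∏ i ∈ s.erase t, ν i (A i)) * ν t ((fun x => φ (x, z)) ⁻¹' A t) := by
      intro z
      rw [← Finset.mul_prod_erase s _ hts, Function.update_self, mul_comm]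
      congr 1
      refine Finset.prod_congr rfl fun i hi => ?_
      rw [Function.update_of_ne (Finset.ne_of_mem_erase hi)]
    simp only [hprod]
    rw [lintegral_const_mul', ← Finset.mul_prod_erase s _ hts, mul_comm]
    · congr 1
      have h1 := hφ.measure_preimage (hA t).nullMeasurableSet
      rw [Measure.prod_apply_symm (hφ.measurable (hA t))] at h1
      exact h1
    · exact ENNReal.prod_ne_top fun i _ => measure_ne_top _ _
  · have hprod : ∀ z, ∏ i ∈ s, ν i (Function.update A t ((fun x => φ (x, z)) ⁻¹' A t) i) =
        ∏ i ∈ s, ν i (A i) := by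
      intro z
      refine Finset.prod_congr rfl fun i hi => ?_
      rw [Function.update_of_ne (ne_of_mem_of_not_mem hi hts)]
    simp [hprod]

section

variable {K : ℕ} (P : ℕ → Measure (Fin K → ℝ)) [∀ t, IsProbabilityMeasure (P t)]

/-- Replace the reward vector and the draws of round `t`, but keep its replay indicators. -/
def withPlay {K : ℕ} (ω : ℕ → RoundSeed K) (t : ℕ)
    (z : (Fin K → ℝ) × (Finset (Fin K) → Fin K)) : ℕ → RoundSeed K :=
  Function.update ω t (z.1, z.2, (ω t).2.2)

/-- Replace the replay indicators of round `t`. -/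
def withReplays {K : ℕ} (ω : ℕ → RoundSeed K) (t : ℕ) (B : ℕ × ℕ → Bool) : ℕ → RoundSeed K :=
  Function.update ω t ((ω t).1, (ω t).2.1, B)

theorem measurePreserving_withPlay (hK : 1 ≤ K) (t : ℕ) :
    MeasurePreserving (fun p : (ℕ → RoundSeed K) × ((Fin K → ℝ) × (Finset (Fin K) → Fin K)) =>
      withPlay p.1 t p.2) ((seedLaw P).prod ((P t).prod (drawLaw K))) (seedLaw P) := by
  have := isProbabilityMeasure_drawLaw hK
  have h2 : MeasurePreserving
      (Prod.map (fun x : RoundSeed K => x.2.2)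
        (id : (Fin K → ℝ) × (Finset (Fin K) → Fin K) → _))
      (((P t).prod ((drawLaw K).prod (replayLaw t))).prod ((P t).prod (drawLaw K)))
      ((replayLaw t).prod ((P t).prod (drawLaw K))) :=
    (measurePreserving_snd.comp measurePreserving_snd).prod (MeasurePreserving.id _)
  have h3 := (measurePreserving_prodAssoc (P t) (drawLaw K) (replayLaw t)).comp
    (Measure.measurePreserving_swap.comp h2)
  exact measurePreserving_resample (fun s => (P s).prod ((drawLaw K).prod (replayLaw s))) _ t _ h3

theorem measurePreserving_withReplays (hK : 1 ≤ K) (t : ℕ) :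
    MeasurePreserving (fun p : (ℕ → RoundSeed K) × (ℕ × ℕ → Bool) => withReplays p.1 t p.2)
      ((seedLaw P).prod (replayLaw t)) (seedLaw P) := by
  have := isProbabilityMeasure_drawLaw hK
  have h1 : MeasurePreserving
      (Prod.map (Prod.fst : (Finset (Fin K) → Fin K) × (ℕ × ℕ → Bool) → _)
        (id : (ℕ × ℕ → Bool) → _))
      (((drawLaw K).prod (replayLaw t)).prod (replayLaw t)) ((drawLaw K).prod (replayLaw t)) :=
    measurePreserving_fst.prod (MeasurePreserving.id _)
  have h2 := ((MeasurePreserving.id (P t)).prod h1).comp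
    (measurePreserving_prodAssoc (P t) ((drawLaw K).prod (replayLaw t)) (replayLaw t))
  exact measurePreserving_resample (fun s => (P s).prod ((drawLaw K).prod (replayLaw s))) _ t _ h2

/-! ### Adaptedness -/

theorem stateAfter_congr {C₀ : ℝ} {T : ℕ} {ω ω' : ℕ → RoundSeed K} (n : ℕ)
    (h : ∀ s ≤ n, ω s = ω' s) (h' : (ω (n + 1)).2.2 = (ω' (n + 1)).2.2) :
    stateAfter C₀ T ω n = stateAfter C₀ T ω' n := by
  induction n with
  | zero => rfl
  | succ n ih =>
    have h1 := ih (fun s hs => h s (by omega)) (by rw [h (n + 1) le_rfl])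
    simp only [stateAfter]
    rw [h1, h (n + 1) le_rfl, h']

variable {C₀ : ℝ} {T : ℕ} (ω : ℕ → RoundSeed K) (t : ℕ)

theorem stateAfter_withPlay (z : (Fin K → ℝ) × (Finset (Fin K) → Fin K)) {n : ℕ} (hn : n < t) :
    stateAfter C₀ T (withPlay ω t z) n = stateAfter C₀ T ω n := by
  refine stateAfter_congr n (fun s hs => Function.update_of_ne (by omega) _ _) ?_
  by_cases h : n + 1 = t
  · subst h; simp [withPlay]
  · rw [withPlay, Function.update_of_ne h]

theorem armsAt_withPlay (z : (Fin K → ℝ) × (Finset (Fin K) → Fin K)) {s : ℕ} (hs : s ≤ t)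
    (ht : 1 ≤ t) : armsAt C₀ T (withPlay ω t z) s = armsAt C₀ T ω s := by
  rw [armsAt, stateAfter_withPlay ω t z (by omega)]; rfl

theorem metaArm_withPlay_self (z : (Fin K → ℝ) × (Finset (Fin K) → Fin K)) (ht : 1 ≤ t) :
    metaArm C₀ T t (withPlay ω t z) = z.2 (armsAt C₀ T ω t) := by
  rw [metaArm, stateAfter_withPlay ω t z (by omega)]
  simp [withPlay, armsAt]

theorem metaArm_withPlay (z : (Fin K → ℝ) × (Finset (Fin K) → Fin K)) {s : ℕ} (hs : s < t) :
    metaArm C₀ T s (withPlay ω t z) = metaArm C₀ T s ω := by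
  rw [metaArm, stateAfter_withPlay ω t z (by omega), withPlay, Function.update_of_ne (by omega)]
  rfl

theorem estAt_withPlay (z : (Fin K → ℝ) × (Finset (Fin K) → Fin K)) {s : ℕ} (hs : s < t)
    (a : Fin K) : estAt C₀ T (withPlay ω t z) s a = estAt C₀ T ω s a := by
  have h1 : withPlay ω t z s = ω s := Function.update_of_ne (by omega) _ _
  rw [estAt, metaArm_withPlay ω t z hs, armsAt_withPlay ω t z (by omega) (by omega), h1]
  rfl

theorem estAt_withPlay_self (z : (Fin K → ℝ) × (Finset (Fin K) → Fin K)) (ht : 1 ≤ t)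
    (a : Fin K) : estAt C₀ T (withPlay ω t z) t a = if z.2 (armsAt C₀ T ω t) = a then
      ((armsAt C₀ T ω t).card : ℝ) * z.1 (z.2 (armsAt C₀ T ω t)) else 0 := by
  rw [estAt, metaArm_withPlay_self ω t z ht, armsAt_withPlay ω t z le_rfl ht]
  simp [withPlay]

theorem episodeAt_withReplays (B : ℕ × ℕ → Bool) {s : ℕ} (hs : s < t) (ht : 2 ≤ t) :
    episodeAt C₀ T (withReplays ω t B) s = episodeAt C₀ T ω s := by
  rw [episodeAt, stateAfter_congr (ω' := ω) (s - 1)]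
  · rfl
  · exact fun r hr => Function.update_of_ne (by omega) _ _
  · rw [withReplays, Function.update_of_ne (by omega)]

end

/-! ### Measurability of the trajectory -/

theorem measurable_apply_countable {Ω β γ : Type*} [MeasurableSpace Ω] [MeasurableSpace β]
    [Countable β] [MeasurableSingletonClass β] [MeasurableSpace γ] {g : Ω → β} {F : β → Ω → γ}
    (hg : Measurable g) (hF : ∀ b, Measurable (F b)) : Measurable fun ω => F (g ω) ω :=
  (measurable_from_prod_countable_right (f := fun p : β × Ω => F p.1 p.2) hF).comp
    (hg.prodMk measurable_id)

section

variable {K : ℕ} {C₀ : ℝ} {T : ℕ}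

theorem measurable_metaArm_of {t : ℕ}
    (h : Measurable fun ω : ℕ → RoundSeed K => armsAt C₀ T ω t) :
    Measurable (metaArm (K := K) C₀ T t) := by
  refine measurable_apply_countable (F := fun A (ω : ℕ → RoundSeed K) => (ω t).2.1 A) h fun A => ?_
  exact (measurable_pi_apply A).comp (measurable_fst.comp (measurable_snd.comp (measurable_pi_apply t)))

theorem measurable_estAt_of {t : ℕ}
    (h : Measurable fun ω : ℕ → RoundSeed K => armsAt C₀ T ω t) (a : Fin K) :
    Measurable fun ω : ℕ → RoundSeed K => estAt C₀ T ω t a := by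
  have h2 : Measurable (metaArm (K := K) C₀ T t) := measurable_metaArm_of h
  refine measurable_apply_countable (F := fun (p : Finset (Fin K) × Fin K) (ω : ℕ → RoundSeed K) =>
    if p.2 = a then (p.1.card : ℝ) * (ω t).1 p.2 else 0) (h.prodMk h2) fun p => ?_
  by_cases hp : p.2 = a
  · simp only [hp, if_true]
    exact measurable_const.mul
      ((measurable_pi_apply a).comp (measurable_fst.comp (measurable_pi_apply t)))
  · simp only [hp, if_false]
    exact measurable_const

theorem measurable_evicted {lo t : ℕ}
    (h : ∀ s < t, ∀ a, Measurable fun ω : ℕ → RoundSeed K => estAt C₀ T ω s a) :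
    Measurable fun ω : ℕ → RoundSeed K => evicted C₀ T (estAt C₀ T ω) lo t := by
  rw [measurable_finset_iff]
  intro a
  simp only [mem_evicted]
  refine Measurable.exists fun s₁ => Measurable.exists fun s₂ => ?_
  refine Measurable.and measurable_const (Measurable.and measurable_const ?_)
  by_cases hs : s₂ < t
  · refine Measurable.and measurable_const (Measurable.exists fun a' => ?_)
    refine measurableSet_setOfPred.1 (measurableSet_lt measurable_const ?_)
    refine Finset.measurable_sum _ fun s hs' => ?_
    rw [Finset.mem_Icc] at hs'
    exact (h s (by omega) a').sub (h s (by omega) a)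
  · simp only [hs, false_and]
    exact measurable_const

theorem activeAt_eq_iff {t s : ℕ} (h1 : 1 ≤ t) (hT : t ≤ T) (ω : ℕ → RoundSeed K) :
    activeAt C₀ T ω t = s ↔ (s ≤ t ∧ (s = episodeAt C₀ T ω t ∨ (episodeAt C₀ T ω t < s ∧
      0 < replayLen C₀ T ω s ∧ t ≤ s + replayLen C₀ T ω s))) ∧
      ∀ r, s < r → r ≤ t → 0 < replayLen C₀ T ω r → r + replayLen C₀ T ω r < t := by
  have h := isRun (C₀ := C₀) (T := T) (ω := ω)
  have hge := h.act_ge t h1 hT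
  have hle := h.act_le t h1 hT
  constructor
  · rintro rfl
    exact ⟨⟨hle, h.act_live t h1 hT⟩, h.act_last t h1 hT⟩
  · rintro ⟨⟨h2, h3⟩, h4⟩
    rcases lt_trichotomy (activeAt C₀ T ω t) s with h5 | h5 | h5
    · rcases h3 with h3 | ⟨-, h6, h7⟩
      · omega
      · have := h.act_last t h1 hT s h5 h2 h6; omega
    · exact h5
    · rcases h.act_live t h1 hT with h6 | ⟨-, h7, h8⟩
      · rcases h3 with h3 | h3 <;> omega
      · have := h4 _ h5 hle h7; omega

theorem episodeAt_succ {t : ℕ} (h1 : 1 ≤ t) (hT : t < T) (ω : ℕ → RoundSeed K) :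
    episodeAt C₀ T ω (t + 1) = if replayLen C₀ T ω (t + 1) = 0 ∧
      evicted C₀ T (estAt C₀ T ω) (episodeAt C₀ T ω t) (t + 1) = Finset.univ
      then t + 1 else episodeAt C₀ T ω t := by
  have h := isRun (C₀ := C₀) (T := T) (ω := ω)
  have hb := h.ep_bounds h1 hT.le
  split_ifs with hc
  · rcases h.ep_succ t h1 hT with h2 | h2
    · have := h.check (t + 1) (by omega) hT (by omega) hc.1
      rw [h2] at this
      exact absurd hc.2 this
    · exact h2.1
  · rcases h.ep_succ t h1 hT with h2 | h2
    · exact h2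
    · exact absurd h2.2 hc

theorem measurable_trajectory (t : ℕ) (hT : t ≤ T) :
    (Measurable fun ω : ℕ → RoundSeed K => episodeAt C₀ T ω t) ∧
    (Measurable fun ω : ℕ → RoundSeed K => replayLen C₀ T ω t) ∧
    (Measurable fun ω : ℕ → RoundSeed K => armsAt C₀ T ω t) := by
  induction t using Nat.strong_induction_on with
  | _ t ih =>
  rcases Nat.lt_or_ge 1 t with h2 | h2
  swap
  · have h0 : ∀ ω : ℕ → RoundSeed K, stateAfter C₀ T ω (t - 1) = newEpisode T 1 fun _ _ => 0 := by
      intro ω; rw [show t - 1 = 0 by omega]; rfl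
    simp only [episodeAt, replayLen, armsAt, h0, h2, if_true]
    exact ⟨measurable_const, measurable_const, measurable_const⟩
  obtain ⟨n, rfl⟩ : ∃ n, t = n + 1 := ⟨t - 1, by omega⟩
  have hest : ∀ s < n + 1, ∀ a, Measurable fun ω : ℕ → RoundSeed K => estAt C₀ T ω s a :=
    fun s hs a => measurable_estAt_of (ih s hs (by omega)).2.2 a
  have hepn := (ih n (by omega) (by omega)).1
  have hrl : Measurable fun ω : ℕ → RoundSeed K => replayLen C₀ T ω (n + 1) := by
    have hB : Measurable fun ω : ℕ → RoundSeed K =>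
        fun m : durations T => (ω (n + 1)).2.2 (episodeAt C₀ T ω n, m.1) := by
      refine measurable_pi_lambda _ fun m => ?_
      refine measurable_apply_countable
        (F := fun e (ω : ℕ → RoundSeed K) => (ω (n + 1)).2.2 (e, m.1)) hepn fun e => ?_
      exact (measurable_pi_apply (e, m.1)).comp
        (measurable_snd.comp (measurable_snd.comp (measurable_pi_apply (n + 1))))
    have hF : ∀ ω : ℕ → RoundSeed K, replayLen C₀ T ω (n + 1) =
        (fun b : durations T → Bool => (Finset.univ.filter fun m => b m = true).sup Subtype.val)
          (fun m : durations T => (ω (n + 1)).2.2 (episodeAt C₀ T ω n, m.1)) := by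
      intro ω
      rw [replayLen, if_neg (by omega)]
      apply le_antisymm
      · refine Finset.sup_le fun m hm => ?_
        obtain ⟨hm1, hm2⟩ := Finset.mem_filter.1 hm
        exact Finset.le_sup (f := Subtype.val)
          (Finset.mem_filter.2 ⟨Finset.mem_univ (⟨m, hm1⟩ : durations T), hm2⟩)
      · refine Finset.sup_le fun m hm => ?_
        exact Finset.le_sup (f := id)
          (Finset.mem_filter.2 ⟨m.2, (Finset.mem_filter.1 hm).2⟩)
    simp only [hF]
    exact (measurable_of_countable fun b : durations T → Bool =>
      (Finset.univ.filter fun m => b m = true).sup Subtype.val).comp hB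
  have hep : Measurable fun ω : ℕ → RoundSeed K => episodeAt C₀ T ω (n + 1) := by
    simp only [episodeAt_succ (C₀ := C₀) (by omega : 1 ≤ n) (by omega : n < T)]
    have hev : Measurable fun ω : ℕ → RoundSeed K =>
        evicted C₀ T (estAt C₀ T ω) (episodeAt C₀ T ω n) (n + 1) :=
      measurable_apply_countable
        (F := fun e (ω : ℕ → RoundSeed K) => evicted C₀ T (estAt C₀ T ω) e (n + 1)) hepn
        fun e => measurable_evicted hest
    exact Measurable.ite ((hrl (measurableSet_singleton 0)).inter
      (hev (measurableSet_singleton Finset.univ))) measurable_const hepn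
  refine ⟨hep, hrl, ?_⟩
  have hact : Measurable fun ω : ℕ → RoundSeed K => activeAt C₀ T ω (n + 1) := by
    refine measurable_to_countable' fun s => ?_
    have hset : (fun ω : ℕ → RoundSeed K => activeAt C₀ T ω (n + 1)) ⁻¹' {s} =
        {ω | (s ≤ n + 1 ∧ (s = episodeAt C₀ T ω (n + 1) ∨ (episodeAt C₀ T ω (n + 1) < s ∧
          0 < replayLen C₀ T ω s ∧ n + 1 ≤ s + replayLen C₀ T ω s))) ∧
          ∀ r, s < r → r ≤ n + 1 → 0 < replayLen C₀ T ω r → r + replayLen C₀ T ω r < n + 1} := by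
      ext ω
      exact activeAt_eq_iff (by omega) hT ω
    rw [hset]
    have hrlen : ∀ r ≤ n + 1, Measurable fun ω : ℕ → RoundSeed K => replayLen C₀ T ω r := by
      intro r hr
      rcases hr.lt_or_eq with h | rfl
      · exact (ih r h (by omega)).2.1
      · exact hrl
    have hdisc : ∀ (f : (ℕ → RoundSeed K) → ℕ) (p : ℕ → Prop), Measurable f →
        Measurable fun ω => p (f ω) := fun f p hf => (measurable_of_countable p).comp hf
    refine measurableSet_setOfPred.2 (Measurable.and ?_ ?_)
    · by_cases hs : s ≤ n + 1
      · refine Measurable.and measurable_const (Measurable.or (hdisc _ (fun e => s = e) hep) ?_)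
        refine Measurable.and (hdisc _ (fun e => e < s) hep) (Measurable.and ?_ ?_)
        · exact hdisc _ (fun l => 0 < l) (hrlen s hs)
        · exact hdisc _ (fun l => n + 1 ≤ s + l) (hrlen s hs)
      · simp only [hs, false_and]
        exact measurable_const
    · refine Measurable.forall fun r => Measurable.imp measurable_const ?_
      by_cases hr : r ≤ n + 1
      · refine Measurable.imp measurable_const ?_
        exact hdisc _ (fun l => 0 < l → r + l < n + 1) (hrlen r hr)
      · simp only [hr, false_imp_iff]
        exact measurable_const
  have harms : ∀ ω : ℕ → RoundSeed K, armsAt C₀ T ω (n + 1) =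
      Finset.univ \ evicted C₀ T (estAt C₀ T ω) (activeAt C₀ T ω (n + 1)) (n + 1) := fun ω =>
    (isRun (C₀ := C₀) (T := T) (ω := ω)).arms_eq (n + 1) (by omega) hT
  simp only [harms]
  exact measurable_apply_countable (F := fun e (ω : ℕ → RoundSeed K) =>
    Finset.univ \ evicted C₀ T (estAt C₀ T ω) e (n + 1)) hact fun e =>
      (measurable_of_countable fun A : Finset (Fin K) => Finset.univ \ A).comp
        (measurable_evicted hest)

theorem measurable_episodeAt {t : ℕ} (hT : t ≤ T) :
    Measurable fun ω : ℕ → RoundSeed K => episodeAt C₀ T ω t := (measurable_trajectory t hT).1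

theorem measurable_armsAt {t : ℕ} (hT : t ≤ T) :
    Measurable fun ω : ℕ → RoundSeed K => armsAt C₀ T ω t := (measurable_trajectory t hT).2.2

theorem measurable_metaArm {t : ℕ} (hT : t ≤ T) : Measurable (metaArm (K := K) C₀ T t) :=
  measurable_metaArm_of (measurable_armsAt hT)

theorem measurable_estAt {t : ℕ} (hT : t ≤ T) (a : Fin K) :
    Measurable fun ω : ℕ → RoundSeed K => estAt C₀ T ω t a :=
  measurable_estAt_of (measurable_armsAt hT) a

end

/-! ### Exponential moments of the estimates -/

section

variable {K : ℕ}

theorem drawLaw_real_eq (hK : 1 ≤ K) {A : Finset (Fin K)} (hA : A.Nonempty) (b : Fin K) :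
    (drawLaw K).real {d | d A = b} = if b ∈ A then 1 / (A.card : ℝ) else 0 := by
  have : Nonempty (Fin K) := ⟨⟨0, hK⟩⟩
  have hp : ∀ A : Finset (Fin K), IsProbabilityMeasure
      (uniformOn (if A.Nonempty then (A : Set (Fin K)) else (Set.univ : Set (Fin K)))) := by
    intro A
    refine isProbabilityMeasure_uniformOn (Set.toFinite _) ?_
    split_ifs with h
    · exact h
    · exact Set.univ_nonempty
  have h1 := (measurePreserving_eval (fun A : Finset (Fin K) =>
    uniformOn (if A.Nonempty then (A : Set (Fin K)) else (Set.univ : Set (Fin K)))) A).measure_preimage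
    (measurableSet_singleton b).nullMeasurableSet
  have h2 : (drawLaw K) {d | d A = b} = uniformOn (A : Set (Fin K)) {b} := by
    rw [if_pos hA] at h1
    exact h1
  rw [measureReal_def, h2, ← Finset.coe_singleton, uniformOn_apply_finset]
  by_cases hb : b ∈ A
  · rw [Finset.inter_singleton_of_mem hb, if_pos hb]
    simp
  · rw [Finset.inter_singleton_of_notMem hb, if_neg hb]
    simp

/-- Expectation of a function of the reward vector and of the arm drawn from `A`. -/
theorem integral_play (hK : 1 ≤ K) (Q : Measure (Fin K → ℝ)) [IsProbabilityMeasure Q]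
    {A : Finset (Fin K)} (hA : A.Nonempty) (h : Fin K → (Fin K → ℝ) → ℝ)
    (hint : ∀ b, Integrable (h b) Q) :
    Integrable (fun z : (Fin K → ℝ) × (Finset (Fin K) → Fin K) => h (z.2 A) z.1)
      (Q.prod (drawLaw K)) ∧
    ∫ z, h (z.2 A) z.1 ∂(Q.prod (drawLaw K)) = (∑ b ∈ A, ∫ y, h b y ∂Q) / (A.card : ℝ) := by
  have := isProbabilityMeasure_drawLaw hK
  have hset : ∀ b, MeasurableSet {d : Finset (Fin K) → Fin K | d A = b} := fun b =>
    (show Measurable fun d : Finset (Fin K) → Fin K => d A from measurable_pi_apply A)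
      (measurableSet_singleton b)
  have hdecomp : (fun z : (Fin K → ℝ) × (Finset (Fin K) → Fin K) => h (z.2 A) z.1) =
      fun z => ∑ b, h b z.1 * Set.indicator {d : Finset (Fin K) → Fin K | d A = b} 1 z.2 := by
    funext z
    rw [Finset.sum_eq_single (z.2 A)]
    · simp
    · intro b _ hb
      simp [Set.indicator, Ne.symm hb]
    · simp
  have hindint : ∀ b, Integrable
      (Set.indicator {d : Finset (Fin K) → Fin K | d A = b} (1 : (Finset (Fin K) → Fin K) → ℝ)) (drawLaw K) := fun b =>
    (integrable_const (1 : ℝ)).indicator (hset b)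
  have hterm : ∀ b, Integrable (fun z : (Fin K → ℝ) × (Finset (Fin K) → Fin K) =>
      h b z.1 * Set.indicator {d : Finset (Fin K) → Fin K | d A = b} 1 z.2)
      (Q.prod (drawLaw K)) := fun b => (hint b).mul_prod (hindint b)
  rw [hdecomp]
  refine ⟨integrable_finsetSum _ fun b _ => hterm b, ?_⟩
  rw [integral_finsetSum _ fun b _ => hterm b, Finset.sum_div,
    ← Finset.sum_subset (Finset.subset_univ A)]
  · refine Finset.sum_congr rfl fun b hb => ?_
    rw [integral_prod_mul (h b), integral_indicator_one (hset b), drawLaw_real_eq hK hA, if_pos hb]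
    ring
  · intro b _ hb
    rw [integral_prod_mul (h b), integral_indicator_one (hset b), drawLaw_real_eq hK hA, if_neg hb,
      mul_zero]

theorem integrable_eval (Q : Measure (Fin K → ℝ)) [IsProbabilityMeasure Q]
    (hY : ∀ᵐ y ∂Q, ∀ a, y a ∈ Set.Icc (0 : ℝ) 1) (b : Fin K) : Integrable (fun y => y b) Q := by
  refine Integrable.of_bound (measurable_pi_apply b).aestronglyMeasurable 1 ?_
  filter_upwards [hY] with y hy
  rw [Real.norm_eq_abs, abs_of_nonneg (hy b).1]
  exact (hy b).2

theorem integral_eval_mem (Q : Measure (Fin K → ℝ)) [IsProbabilityMeasure Q]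
    (hY : ∀ᵐ y ∂Q, ∀ a, y a ∈ Set.Icc (0 : ℝ) 1) (b : Fin K) :
    ∫ y, y b ∂Q ∈ Set.Icc (0 : ℝ) 1 := by
  constructor
  · refine integral_nonneg_of_ae ?_
    filter_upwards [hY] with y hy using (hy b).1
  · calc ∫ y, y b ∂Q ≤ ∫ _, (1 : ℝ) ∂Q := by
          refine integral_mono_ae (integrable_eval Q hY b) (integrable_const _) ?_
          filter_upwards [hY] with y hy using (hy b).2
      _ = 1 := by simp

/-- The exponential moment of the centred estimate of a gap in one round. The estimate has second
moment at most `2K`, and `exp x ≤ 1 + x + x²` for `|x| ≤ 1`. -/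
theorem lintegral_exp_play_le (hK : 1 ≤ K) (Q : Measure (Fin K → ℝ)) [IsProbabilityMeasure Q]
    (hY : ∀ᵐ y ∂Q, ∀ a, y a ∈ Set.Icc (0 : ℝ) 1) {A : Finset (Fin K)} (hA : A.Nonempty)
    (a a' : Fin K) {l : ℝ} (hl0 : 0 ≤ l) (hl : 2 * K * l ≤ 1) :
    ∫⁻ z, ENNReal.ofReal (Real.exp (l * (((if z.2 A = a' then (A.card : ℝ) * z.1 (z.2 A) else 0) -
        (if z.2 A = a then (A.card : ℝ) * z.1 (z.2 A) else 0)) -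
        ((if a' ∈ A then ∫ y, y a' ∂Q else 0) - (if a ∈ A then ∫ y, y a ∂Q else 0)))))
      ∂(Q.prod (drawLaw K)) ≤ ENNReal.ofReal (Real.exp (2 * K * l ^ 2)) := by
  have := isProbabilityMeasure_drawLaw hK
  have hK' : (1 : ℝ) ≤ K := by exact_mod_cast hK
  have hm := integral_eval_mem Q hY
  set m : Fin K → ℝ := fun b => ∫ y, y b ∂Q with hmdef
  set n : ℝ := (A.card : ℝ) with hn
  have hn1 : 1 ≤ n := Nat.one_le_cast.2 (Finset.card_pos.2 hA)
  have hnK : n ≤ K := by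
    have := Finset.card_le_univ A
    rw [Fintype.card_fin] at this
    exact Nat.cast_le.2 this
  set c : ℝ := (if a' ∈ A then m a' else 0) - (if a ∈ A then m a else 0) with hc
  set k : Fin K → ℝ := fun b => (if b = a' then n else 0) - (if b = a then n else 0) with hk
  have hkabs : ∀ b, |k b| ≤ n := by
    intro b
    simp only [hk]
    rw [abs_le]
    constructor <;> split_ifs <;> linarith
  have hksq : ∀ b, k b ^ 2 ≤ (if b = a' then n ^ 2 else 0) + (if b = a then n ^ 2 else 0) := by
    intro b
    simp only [hk]
    split_ifs <;> nlinarith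
  have hcabs : |c| ≤ 1 := by
    rw [hc, abs_le]
    have h1 := hm a
    have h2 := hm a'
    constructor <;> split_ifs <;> linarith [h1.1, h1.2, h2.1, h2.2]
  have hform : ∀ z : (Fin K → ℝ) × (Finset (Fin K) → Fin K),
      ((if z.2 A = a' then n * z.1 (z.2 A) else 0) - (if z.2 A = a then n * z.1 (z.2 A) else 0)) - c =
      k (z.2 A) * z.1 (z.2 A) - c := by
    intro z
    simp only [hk]
    split_ifs <;> ring
  have hint1 : ∀ b, Integrable (fun y : Fin K → ℝ => y b) Q := integrable_eval Q hY
  have hint2 : ∀ b, Integrable (fun y : Fin K → ℝ => y b ^ 2) Q := by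
    intro b
    refine Integrable.of_bound ((measurable_pi_apply b).pow_const 2).aestronglyMeasurable 1 ?_
    filter_upwards [hY] with y hy
    rw [Real.norm_eq_abs, abs_of_nonneg (by positivity)]
    nlinarith [(hy b).1, (hy b).2]
  set q : Fin K → (Fin K → ℝ) → ℝ := fun b y =>
    (1 - l * c + l ^ 2 * c ^ 2) + (l - 2 * l ^ 2 * c) * k b * y b + l ^ 2 * k b ^ 2 * y b ^ 2 with hq
  have hqint1 : ∀ b, Integrable (fun y : Fin K → ℝ => (l - 2 * l ^ 2 * c) * k b * y b) Q :=
    fun b => (hint1 b).const_mul _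
  have hqint2 : ∀ b, Integrable (fun y : Fin K → ℝ => l ^ 2 * k b ^ 2 * y b ^ 2) Q :=
    fun b => (hint2 b).const_mul _
  have hqint : ∀ b, Integrable (q b) Q := fun b =>
    ((integrable_const _).add (hqint1 b)).add (hqint2 b)
  have hqint' : ∀ b, Integrable (fun y : Fin K → ℝ =>
      (1 - l * c + l ^ 2 * c ^ 2) + (l - 2 * l ^ 2 * c) * k b * y b) Q := fun b =>
    (integrable_const _).add (hqint1 b)
  have hqval : ∀ b, ∫ y, q b y ∂Q ≤
      (1 - l * c + l ^ 2 * c ^ 2) + (l - 2 * l ^ 2 * c) * (k b * m b) + l ^ 2 * k b ^ 2 := by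
    intro b
    have h1 : ∫ y, q b y ∂Q = (1 - l * c + l ^ 2 * c ^ 2) + (l - 2 * l ^ 2 * c) * k b * m b +
        l ^ 2 * k b ^ 2 * ∫ y, y b ^ 2 ∂Q := by
      simp only [hq]
      rw [integral_add (hqint' b) (hqint2 b),
        integral_add (integrable_const _) (hqint1 b), integral_const_mul, integral_const_mul]
      simp [hmdef]
    have h2 : ∫ y, y b ^ 2 ∂Q ≤ 1 := by
      calc ∫ y, y b ^ 2 ∂Q ≤ ∫ _, (1 : ℝ) ∂Q := by
            refine integral_mono_ae (hint2 b) (integrable_const _) ?_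
            filter_upwards [hY] with y hy
            nlinarith [(hy b).1, (hy b).2]
        _ = 1 := by simp
    have h3 : l ^ 2 * k b ^ 2 * ∫ y, y b ^ 2 ∂Q ≤ l ^ 2 * k b ^ 2 * 1 :=
      mul_le_mul_of_nonneg_left h2 (by positivity)
    rw [h1]; linarith
  obtain ⟨hplayint, hplay⟩ := integral_play hK Q hA q hqint
  have hmean : ∑ b ∈ A, k b * m b = n * c := by
    have h1 : ∀ b, k b * m b = (if b = a' then n * m b else 0) - (if b = a then n * m b else 0) := by
      intro b; simp only [hk]; split_ifs <;> ring
    simp only [h1]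
    rw [Finset.sum_sub_distrib, Finset.sum_ite_eq', Finset.sum_ite_eq', hc]
    split_ifs <;> ring
  have hsq : ∑ b ∈ A, k b ^ 2 ≤ 2 * n ^ 2 := by
    refine (Finset.sum_le_sum fun b _ => hksq b).trans ?_
    rw [Finset.sum_add_distrib, Finset.sum_ite_eq', Finset.sum_ite_eq']
    split_ifs <;> nlinarith
  have hval : ∫ z, q (z.2 A) z.1 ∂(Q.prod (drawLaw K)) ≤ Real.exp (2 * K * l ^ 2) := by
    rw [hplay]
    have h1 : ∑ b ∈ A, ∫ y, q b y ∂Q ≤ n * (1 + 2 * n * l ^ 2) := by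
      refine (Finset.sum_le_sum fun b _ => hqval b).trans ?_
      rw [Finset.sum_add_distrib, Finset.sum_add_distrib, Finset.sum_const, ← Finset.mul_sum,
        ← Finset.mul_sum, hmean, nsmul_eq_mul, ← hn]
      have h2 := mul_le_mul_of_nonneg_left hsq (sq_nonneg l)
      have h3 : 0 ≤ n * (l ^ 2 * c ^ 2) := by positivity
      nlinarith
    have h2 : (∑ b ∈ A, ∫ y, q b y ∂Q) / n ≤ 1 + 2 * n * l ^ 2 := by
      rw [div_le_iff₀ (by linarith)]
      linarith
    have h3 := Real.add_one_le_exp (2 * K * l ^ 2)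
    have h4 : 2 * n * l ^ 2 ≤ 2 * K * l ^ 2 := by gcongr
    linarith
  have hexp : ∀ᵐ z ∂(Q.prod (drawLaw K)),
      Real.exp (l * (k (z.2 A) * z.1 (z.2 A) - c)) ≤ q (z.2 A) z.1 := by
    have hY' : ∀ᵐ z ∂(Q.prod (drawLaw K)), ∀ a, z.1 a ∈ Set.Icc (0 : ℝ) 1 :=
      Measure.quasiMeasurePreserving_fst.ae hY
    filter_upwards [hY'] with z hz
    set b := z.2 A
    have hz0 := (hz b).1
    have hz1 := (hz b).2
    have h1 : |k b * z.1 b| ≤ n := by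
      rw [abs_mul, abs_of_nonneg hz0]
      nlinarith [hkabs b, abs_nonneg (k b)]
    have h2 : |k b * z.1 b - c| ≤ 2 * K := (abs_sub _ _).trans (by linarith)
    have h3 : |l * (k b * z.1 b - c)| ≤ 1 := by
      rw [abs_mul, abs_of_nonneg hl0]
      nlinarith
    have h4 := (abs_le.1 (Real.abs_exp_sub_one_sub_id_le h3)).2
    have h5 : q b z.1 = 1 + l * (k b * z.1 b - c) + (l * (k b * z.1 b - c)) ^ 2 := by
      simp only [hq]; ring
    rw [h5]; linarith
  simp only [hform]
  calc ∫⁻ z, ENNReal.ofReal (Real.exp (l * (k (z.2 A) * z.1 (z.2 A) - c))) ∂(Q.prod (drawLaw K))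
      ≤ ∫⁻ z, ENNReal.ofReal (q (z.2 A) z.1) ∂(Q.prod (drawLaw K)) := by
        refine lintegral_mono_ae ?_
        filter_upwards [hexp] with z hz using ENNReal.ofReal_le_ofReal hz
    _ = ENNReal.ofReal (∫ z, q (z.2 A) z.1 ∂(Q.prod (drawLaw K))) := by
        refine (ofReal_integral_eq_lintegral_ofReal hplayint ?_).symm
        filter_upwards [hexp] with z hz using (Real.exp_pos _).le.trans hz
    _ ≤ ENNReal.ofReal (Real.exp (2 * K * l ^ 2)) := ENNReal.ofReal_le_ofReal hval

end

/-! ### Concentration of the estimates -/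

section

variable {K : ℕ} {C₀ : ℝ} {T : ℕ}

theorem measurable_estMean (μ : ℕ → Fin K → ℝ) {s : ℕ} (hs : s ≤ T) (a : Fin K) :
    Measurable fun ω : ℕ → RoundSeed K => estMean μ (armsAt C₀ T ω) s a :=
  (measurable_of_countable fun A : Finset (Fin K) => if a ∈ A then μ s a else 0).comp
    (measurable_armsAt hs)

variable (P : ℕ → Measure (Fin K → ℝ))

/-- The error of the estimate of `μ_s(a') - μ_s(a)` relative to its conditional mean. -/
noncomputable def estError {K : ℕ} (C₀ : ℝ) (T : ℕ) (P : ℕ → Measure (Fin K → ℝ)) (a a' : Fin K)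
    (s : ℕ) (ω : ℕ → RoundSeed K) : ℝ :=
  (estAt C₀ T ω s a' - estAt C₀ T ω s a) -
    (estMean (meanReward P) (armsAt C₀ T ω) s a' - estMean (meanReward P) (armsAt C₀ T ω) s a)

theorem measurable_estError (a a' : Fin K) {s : ℕ} (hs : s ≤ T) :
    Measurable (estError C₀ T P a a' s) :=
  ((measurable_estAt hs a').sub (measurable_estAt hs a)).sub
    ((measurable_estMean _ hs a').sub (measurable_estMean _ hs a))

variable [∀ t, IsProbabilityMeasure (P t)]

/-- The exponential moments of the rounds multiply up: given the past, the play of the last round is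
resampled. -/
theorem lintegral_exp_sum_estError_le (hK : 1 ≤ K)
    (hY : ∀ t, ∀ᵐ y ∂(P t), ∀ a, y a ∈ Set.Icc (0 : ℝ) 1) (a a' : Fin K) {l : ℝ} (hl0 : 0 ≤ l)
    (hl : 2 * K * l ≤ 1) {s₁ : ℕ} (h1 : 1 ≤ s₁) (n : ℕ) (hn : s₁ + n ≤ T + 1) :
    ∫⁻ ω, ENNReal.ofReal (Real.exp (l * ∑ s ∈ Finset.Ico s₁ (s₁ + n), estError C₀ T P a a' s ω))
      ∂(seedLaw P) ≤ ENNReal.ofReal (Real.exp (2 * K * l ^ 2 * n)) := by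
  have := isProbabilityMeasure_drawLaw hK
  have := isProbabilityMeasure_seedLaw hK P
  induction n with
  | zero => simp
  | succ n ih =>
    have ih := ih (by omega)
    set t := s₁ + n with ht
    have hsucc : s₁ + (n + 1) = t + 1 := by omega
    have hmeas : ∀ j ≤ T + 1, Measurable fun ω : ℕ → RoundSeed K =>
        ENNReal.ofReal (Real.exp (l * ∑ s ∈ Finset.Ico s₁ j, estError C₀ T P a a' s ω)) := by
      intro j hj
      refine ENNReal.measurable_ofReal.comp (Real.measurable_exp.comp
        ((Finset.measurable_sum _ fun s hs => ?_).const_mul l))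
      rw [Finset.mem_Ico] at hs
      exact measurable_estError P a a' (by omega)
    have hpast : ∀ ω z, ∑ s ∈ Finset.Ico s₁ t, estError C₀ T P a a' s (withPlay ω t z) =
        ∑ s ∈ Finset.Ico s₁ t, estError C₀ T P a a' s ω := by
      intro ω z
      refine Finset.sum_congr rfl fun s hs => ?_
      rw [Finset.mem_Ico] at hs
      simp only [estError, estMean]
      rw [estAt_withPlay ω t z hs.2, estAt_withPlay ω t z hs.2,
        armsAt_withPlay ω t z hs.2.le (by omega)]
    have hmeas' : Measurable fun p : (ℕ → RoundSeed K) × ((Fin K → ℝ) × (Finset (Fin K) → Fin K)) =>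
        ENNReal.ofReal (Real.exp (l * ∑ s ∈ Finset.Ico s₁ (t + 1),
          estError C₀ T P a a' s (withPlay p.1 t p.2))) :=
      (hmeas (t + 1) (by omega)).comp (measurePreserving_withPlay P hK t).measurable
    rw [hsucc, ← (measurePreserving_withPlay P hK t).lintegral_comp (hmeas (t + 1) (by omega)),
      lintegral_prod _ hmeas'.aemeasurable]
    have hinner : ∀ ω, ∫⁻ z, ENNReal.ofReal (Real.exp (l * ∑ s ∈ Finset.Ico s₁ (t + 1),
          estError C₀ T P a a' s (withPlay ω t z))) ∂((P t).prod (drawLaw K)) ≤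
        ENNReal.ofReal (Real.exp (l * ∑ s ∈ Finset.Ico s₁ t, estError C₀ T P a a' s ω)) *
          ENNReal.ofReal (Real.exp (2 * K * l ^ 2)) := by
      intro ω
      have hA : (armsAt C₀ T ω t).Nonempty :=
        (isRun (C₀ := C₀) (T := T) (ω := ω)).arms_nonempty hK (by omega) (by omega)
      have hsplit : ∀ z, ENNReal.ofReal (Real.exp (l * ∑ s ∈ Finset.Ico s₁ (t + 1),
          estError C₀ T P a a' s (withPlay ω t z))) =
          ENNReal.ofReal (Real.exp (l * ∑ s ∈ Finset.Ico s₁ t, estError C₀ T P a a' s ω)) *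
          ENNReal.ofReal (Real.exp (l * estError C₀ T P a a' t (withPlay ω t z))) := by
        intro z
        rw [Finset.sum_Ico_succ_top (by omega), hpast, mul_add, Real.exp_add,
          ENNReal.ofReal_mul (Real.exp_pos _).le]
      simp only [hsplit]
      rw [lintegral_const_mul' _ _ ENNReal.ofReal_ne_top]
      gcongr
      refine le_trans (le_of_eq ?_) (lintegral_exp_play_le hK (P t) (hY t) hA a a' hl0 hl)
      refine lintegral_congr fun z => ?_
      simp only [estError, estMean]
      rw [estAt_withPlay_self ω t z (by omega), estAt_withPlay_self ω t z (by omega),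
        armsAt_withPlay ω t z le_rfl (by omega)]
      rfl
    refine (lintegral_mono hinner).trans ?_
    rw [lintegral_mul_const' _ _ ENNReal.ofReal_ne_top]
    refine (mul_le_mul_left ih _).trans ?_
    rw [← ENNReal.ofReal_mul (Real.exp_pos _).le, ← Real.exp_add]
    refine ENNReal.ofReal_le_ofReal (Real.exp_le_exp.2 (le_of_eq ?_))
    push_cast; ring

theorem exp_neg_mul_log {T : ℕ} (hT : 2 ≤ T) (k : ℕ) :
    Real.exp (-(k * Real.log T)) = 1 / (T : ℝ) ^ k := by
  have hT0 : (0 : ℝ) < T := by exact_mod_cast (by omega : 0 < T)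
  rw [Real.exp_neg, ← Real.log_pow, Real.exp_log (by positivity), one_div]

/-- Deviation bound for one interval and one pair of arms, by the exponential Markov inequality with
parameter `1 / (2 √V)`, where `V` is the maximum under the root. -/
theorem measure_lt_sum_estError_le (hK : 1 ≤ K) (hT : 2 ≤ T)
    (hY : ∀ t, ∀ᵐ y ∂(P t), ∀ a, y a ∈ Set.Icc (0 : ℝ) 1) (a a' : Fin K) {s₁ s₂ : ℕ} (h1 : 1 ≤ s₁)
    (h12 : s₁ ≤ s₂) (h2 : s₂ ≤ T) :
    seedLaw P {ω | 12 * Real.log T * √(max ((K : ℝ) * ((s₂ : ℝ) - s₁ + 1)) ((K : ℝ) ^ 2)) <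
      ∑ s ∈ Finset.Icc s₁ s₂, estError C₀ T P a a' s ω} ≤ ENNReal.ofReal (2 / (T : ℝ) ^ 6) := by
  have hK' : (1 : ℝ) ≤ K := by exact_mod_cast hK
  have := isProbabilityMeasure_seedLaw hK P
  set V := max ((K : ℝ) * ((s₂ : ℝ) - s₁ + 1)) ((K : ℝ) ^ 2) with hV
  have hVK : (K : ℝ) ≤ √V := by
    rw [show (K : ℝ) = √((K : ℝ) ^ 2) by rw [Real.sqrt_sq (by linarith)]]
    exact Real.sqrt_le_sqrt (le_max_right _ _)
  have hV0 : 0 < √V := by linarith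
  have hVV : √V * √V = V := Real.mul_self_sqrt (le_max_of_le_right (by positivity))
  set l : ℝ := 1 / (2 * √V) with hl
  have hl0 : 0 < l := by positivity
  have hlK : 2 * K * l ≤ 1 := by
    rw [hl, mul_one_div, div_le_one (by positivity)]; linarith
  obtain ⟨n, hn⟩ : ∃ n, s₁ + n = s₂ + 1 := ⟨s₂ + 1 - s₁, by omega⟩
  have hIcc : Finset.Icc s₁ s₂ = Finset.Ico s₁ (s₁ + n) := by rw [hn]; ext; simp
  have hncast : (n : ℝ) = (s₂ : ℝ) - s₁ + 1 := by
    have : (s₁ : ℝ) + n = s₂ + 1 := by exact_mod_cast hn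
    linarith
  have hmom := lintegral_exp_sum_estError_le (C₀ := C₀) (T := T) P hK hY a a' hl0.le hlK h1 n
    (by omega)
  have hmeas : Measurable fun ω : ℕ → RoundSeed K => ENNReal.ofReal (Real.exp (l *
      ∑ s ∈ Finset.Ico s₁ (s₁ + n), estError C₀ T P a a' s ω)) := by
    refine ENNReal.measurable_ofReal.comp (Real.measurable_exp.comp
      ((Finset.measurable_sum _ fun s hs => ?_).const_mul l))
    rw [Finset.mem_Ico] at hs
    exact measurable_estError P a a' (by omega)
  have hmarkov := mul_meas_ge_le_lintegral hmeas (μ := seedLaw P)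
    (ENNReal.ofReal (Real.exp (6 * Real.log T)))
  have hsub : {ω | 12 * Real.log T * √V < ∑ s ∈ Finset.Icc s₁ s₂, estError C₀ T P a a' s ω} ⊆
      {ω | ENNReal.ofReal (Real.exp (6 * Real.log T)) ≤ ENNReal.ofReal (Real.exp (l *
      ∑ s ∈ Finset.Ico s₁ (s₁ + n), estError C₀ T P a a' s ω))} := by
    intro ω hω
    rw [Set.mem_ofPred_eq, hIcc] at hω
    refine ENNReal.ofReal_le_ofReal (Real.exp_le_exp.2 ?_)
    have h3 := mul_le_mul_of_nonneg_left hω.le hl0.le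
    refine le_trans (le_of_eq ?_) h3
    rw [hl]; field_simp; ring
  have hexp : Real.exp (2 * K * l ^ 2 * n) ≤ 2 := by
    have h3 : 2 * K * l ^ 2 * n ≤ 1 / 2 := by
      have h4 : (K : ℝ) * n ≤ V := by rw [hncast]; exact le_max_left _ _
      have h5 : l ^ 2 * V = 1 / 4 := by
        rw [hl, div_pow, mul_pow, one_pow, sq (√V), hVV]
        have : V ≠ 0 := by rw [← hVV]; positivity
        field_simp; norm_num
      have h6 := mul_le_mul_of_nonneg_left h4 (sq_nonneg l)
      nlinarith
    have h4 : Real.exp (1 / 2) ≤ 2 := by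
      have h5 : Real.exp (1 / 2) * Real.exp (1 / 2) = Real.exp 1 := by
        rw [← Real.exp_add]; norm_num
      have h6 := Real.exp_one_lt_d9
      nlinarith [Real.exp_pos (1 / 2)]
    exact (Real.exp_le_exp.2 h3).trans h4
  have hT6 : Real.exp (6 * Real.log T) = (T : ℝ) ^ 6 := by
    rw [show (6 : ℝ) * Real.log T = ((6 : ℕ) : ℝ) * Real.log T by norm_num, ← Real.log_pow,
      Real.exp_log]
    have : (0 : ℝ) < T := by exact_mod_cast (by omega : 0 < T)
    positivity
  have hTpos : (0 : ℝ) < (T : ℝ) ^ 6 := by rw [← hT6]; exact Real.exp_pos _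
  refine (measure_mono hsub).trans ?_
  rw [ENNReal.ofReal_div_of_pos hTpos, ENNReal.le_div_iff_mul_le
    (Or.inl (ENNReal.ofReal_pos.2 hTpos).ne') (Or.inl ENNReal.ofReal_ne_top), mul_comm, ← hT6]
  exact hmarkov.trans (hmom.trans (ENNReal.ofReal_le_ofReal hexp))

theorem measure_not_concentrated_le (hK : 1 ≤ K) (hKT : K ≤ T) (hT : 2 ≤ T)
    (hY : ∀ t, ∀ᵐ y ∂(P t), ∀ a, y a ∈ Set.Icc (0 : ℝ) 1) :
    seedLaw P {ω | ¬ Concentrated T (meanReward P) (armsAt C₀ T ω) (estAt C₀ T ω)} ≤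
      ENNReal.ofReal (2 / (T : ℝ)) := by
  have hT0 : (0 : ℝ) < T := by exact_mod_cast (by omega : 0 < T)
  set I := (((Finset.Icc 1 T) ×ˢ (Finset.Icc 1 T)).filter fun p => p.1 ≤ p.2) ×ˢ
    ((Finset.univ : Finset (Fin K)) ×ˢ (Finset.univ : Finset (Fin K))) with hI
  have hsub : {ω | ¬ Concentrated T (meanReward P) (armsAt C₀ T ω) (estAt C₀ T ω)} ⊆
      ⋃ p ∈ I, {ω | 12 * Real.log T * √(max ((K : ℝ) * ((p.1.2 : ℝ) - p.1.1 + 1)) ((K : ℝ) ^ 2)) <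
      ∑ s ∈ Finset.Icc p.1.1 p.1.2, estError C₀ T P p.2.1 p.2.2 s ω} := by
    intro ω hω
    simp only [Set.mem_ofPred_eq, Concentrated] at hω
    push Not at hω
    obtain ⟨s₁, s₂, h1, h12, h2, a, a', h3⟩ := hω
    refine Set.mem_biUnion (x := ((s₁, s₂), (a, a'))) ?_ h3
    simp only [hI, Finset.coe_product, Set.mem_prod, Finset.mem_coe, Finset.mem_filter,
      Finset.mem_product, Finset.mem_Icc, Finset.mem_univ, and_true]
    exact ⟨⟨⟨h1, h12.trans h2⟩, h1.trans h12, h2⟩, h12⟩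
  refine (measure_mono hsub).trans ((measure_biUnion_finset_le I _).trans ?_)
  have hterm : ∀ p ∈ I, seedLaw P {ω | 12 * Real.log T *
      √(max ((K : ℝ) * ((p.1.2 : ℝ) - p.1.1 + 1)) ((K : ℝ) ^ 2)) <
      ∑ s ∈ Finset.Icc p.1.1 p.1.2, estError C₀ T P p.2.1 p.2.2 s ω} ≤
      ENNReal.ofReal (2 / (T : ℝ) ^ 6) := by
    intro p hp
    simp only [hI, Finset.mem_filter, Finset.mem_product, Finset.mem_Icc, Finset.mem_univ,
      and_true] at hp
    exact measure_lt_sum_estError_le P hK hT hY _ _ hp.1.1.1 hp.2 hp.1.2.2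
  refine (Finset.sum_le_sum hterm).trans ?_
  rw [Finset.sum_const, nsmul_eq_mul, ← ENNReal.ofReal_natCast,
    ← ENNReal.ofReal_mul (Nat.cast_nonneg _)]
  refine ENNReal.ofReal_le_ofReal ?_
  have hcard : I.card ≤ T ^ 4 := by
    rw [hI, Finset.card_product, Finset.card_product, Finset.card_univ, Fintype.card_fin]
    have h1 := Finset.card_filter_le ((Finset.Icc 1 T) ×ˢ (Finset.Icc 1 T))
      (fun p : ℕ × ℕ => p.1 ≤ p.2)
    rw [Finset.card_product, Nat.card_Icc, Nat.add_sub_cancel] at h1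
    calc _ ≤ (T * T) * (T * T) := Nat.mul_le_mul h1 (Nat.mul_le_mul hKT hKT)
      _ = T ^ 4 := by ring
  have hcard' : (I.card : ℝ) ≤ (T : ℝ) ^ 4 := by exact_mod_cast hcard
  calc (I.card : ℝ) * (2 / (T : ℝ) ^ 6) ≤ (T : ℝ) ^ 4 * (2 / (T : ℝ) ^ 6) := by gcongr
    _ = 2 / (T : ℝ) ^ 2 := by field_simp
    _ ≤ 2 / (T : ℝ) := by
        refine div_le_div_of_nonneg_left (by norm_num) hT0 ?_
        have : (1 : ℝ) ≤ T := by exact_mod_cast (by omega : 1 ≤ T)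
        nlinarith

end

/-! ### Replays are found in bad segments -/

section

variable {K : ℕ}

theorem replayLaw_map_eval (s : ℕ) (p : ℕ × ℕ) (A : Set Bool) :
    replayLaw s {B | B p ∈ A} = bernoulliMeasure true false
      (⟨1 / √((p.2 * (s - p.1) : ℕ) : ℝ), one_div_sqrt_mem _⟩ : unitInterval) A :=
  (measurePreserving_eval_infinitePi (fun p : ℕ × ℕ => bernoulliMeasure true false
      (⟨1 / √((p.2 * (s - p.1) : ℕ) : ℝ), one_div_sqrt_mem _⟩ : unitInterval)) p).measure_preimage
    (MeasurableSet.of_discrete (s := A)).nullMeasurableSet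

theorem replayLaw_real_true (s e m : ℕ) :
    (replayLaw s).real {B | B (e, m) = true} = 1 / √((m * (s - e) : ℕ) : ℝ) := by
  have h := replayLaw_map_eval s (e, m) {true}
  simp only [Set.mem_singleton_iff] at h
  rw [measureReal_def, h, ← measureReal_def,
    bernoulliMeasure_real_apply_of_mem_of_notMem _ MeasurableSet.of_discrete (by simp) (by simp)]

theorem measurableSet_replay_eq (e m : ℕ) (b : Bool) :
    MeasurableSet {B : ℕ × ℕ → Bool | B (e, m) = b} :=
  measurableSet_eq_fun (measurable_pi_apply (e, m)) measurable_const

theorem replayLaw_false_le (s e m : ℕ) :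
    replayLaw s {B | B (e, m) = false} ≤
      ENNReal.ofReal (Real.exp (-(1 / √((m * (s - e) : ℕ) : ℝ)))) := by
  have h1 : {B : ℕ × ℕ → Bool | B (e, m) = false} = {B | B (e, m) = true}ᶜ := by
    ext B; simp
  rw [h1, ← ofReal_measureReal, probReal_compl_eq_one_sub (measurableSet_replay_eq e m true),
    replayLaw_real_true]
  refine ENNReal.ofReal_le_ofReal ?_
  have := Real.add_one_le_exp (-(1 / √((m * (s - e) : ℕ) : ℝ)))
  linarith

variable (P : ℕ → Measure (Fin K → ℝ)) [∀ t, IsProbabilityMeasure (P t)]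

/-- The probability that, in disjoint sets of rounds, no replay of the prescribed durations is
scheduled. -/
theorem measure_forall_replay_false_le (hK : 1 ≤ K) (e : ℕ) (V : Finset ℕ) (I : ℕ → Finset ℕ)
    (m : ℕ → ℕ) (hdisj : (V : Set ℕ).PairwiseDisjoint I) :
    seedLaw P {ω | ∀ v ∈ V, ∀ r ∈ I v, (ω r).2.2 (e, m v) = false} ≤
      ENNReal.ofReal (Real.exp (-∑ v ∈ V, ∑ r ∈ I v, 1 / √((m v * (r - e) : ℕ) : ℝ))) := by
  have := isProbabilityMeasure_drawLaw hK
  set A : ℕ → Set (RoundSeed K) := fun r => {x | ∀ v ∈ V, r ∈ I v → x.2.2 (e, m v) = false} with hA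
  have hAmeas : ∀ r, MeasurableSet (A r) := by
    intro r
    have : A r = ⋂ v ∈ V, {x : RoundSeed K | r ∈ I v → x.2.2 (e, m v) = false} := by
      ext x; simp [hA]
    rw [this]
    refine Finset.measurableSet_biInter V fun v _ => ?_
    by_cases hr : r ∈ I v
    · simp only [hr, true_imp_iff]
      exact (measurable_snd.comp measurable_snd) (measurableSet_replay_eq e (m v) false)
    · simp [hr]
  have hset : {ω : ℕ → RoundSeed K | ∀ v ∈ V, ∀ r ∈ I v, (ω r).2.2 (e, m v) = false} =
      Set.pi ((V.biUnion I : Finset ℕ) : Set ℕ) A := by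
    ext ω
    simp only [Set.mem_ofPred_eq, Set.mem_pi, Finset.mem_coe, Finset.mem_biUnion, hA]
    exact ⟨fun h r _ v hv hr => h v hv r hr, fun h v hv r hr => h r ⟨v, hv, hr⟩ v hv hr⟩
  rw [hset, seedLaw, Measure.infinitePi_pi _ fun r _ => hAmeas r, Finset.prod_biUnion hdisj,
    ← Finset.sum_neg_distrib, Real.exp_sum,
    ENNReal.ofReal_prod_of_nonneg fun _ _ => (Real.exp_pos _).le]
  refine Finset.prod_le_prod' fun v hv => ?_
  rw [← Finset.sum_neg_distrib, Real.exp_sum,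
    ENNReal.ofReal_prod_of_nonneg fun _ _ => (Real.exp_pos _).le]
  refine Finset.prod_le_prod' fun r hr => ?_
  have hpre : MeasurePreserving (fun x : RoundSeed K => x.2.2)
      ((P r).prod ((drawLaw K).prod (replayLaw r))) (replayLaw r) :=
    measurePreserving_snd.comp measurePreserving_snd
  refine le_trans ?_ (replayLaw_false_le r e (m v))
  rw [← hpre.measure_preimage (measurableSet_replay_eq e (m v) false).nullMeasurableSet]
  exact measure_mono fun x hx => hx v hv hr

variable {C₀ : ℝ} {T : ℕ} {μ : ℕ → Fin K → ℝ}

/-- The expected number of replays of length about `n` that are scheduled in the first half of a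
segment of length `n`. -/
theorem sqrt_div_le_sum_replay {u n e t : ℕ} (hn : 2 ≤ n) (heu : e ≤ u) (hut : u + n ≤ t) :
    √(n : ℝ) / (5 * √((t : ℝ) - e)) ≤
      ∑ r ∈ Finset.Ioc u (u + n / 2), 1 / √((2 ^ Nat.clog 2 n * (r - e) : ℕ) : ℝ) := by
  have hn0 : (0 : ℝ) < n := by exact_mod_cast (by omega : 0 < n)
  have hD : (0 : ℝ) < (t : ℝ) - e := by
    have : (e : ℝ) < t := by exact_mod_cast (by omega : e < t)
    linarith
  have hm : 2 ^ Nat.clog 2 n ≤ 2 * n := by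
    have h1 := Nat.pow_pred_clog_lt_self (b := 2) (by norm_num) (by omega : 1 < n)
    have h2 : 0 < Nat.clog 2 n := Nat.clog_pos (by norm_num) hn
    obtain ⟨k, hk⟩ : ∃ k, Nat.clog 2 n = k + 1 := ⟨Nat.clog 2 n - 1, by omega⟩
    rw [hk, Nat.pred_succ] at h1
    rw [hk, pow_succ]; omega
  have hterm : ∀ r ∈ Finset.Ioc u (u + n / 2), 1 / (1.5 * (√(n : ℝ) * √((t : ℝ) - e))) ≤
      1 / √((2 ^ Nat.clog 2 n * (r - e) : ℕ) : ℝ) := by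
    intro r hr
    rw [Finset.mem_Ioc] at hr
    have h1 : 0 < 2 ^ Nat.clog 2 n * (r - e) := Nat.mul_pos (by positivity) (by omega)
    refine one_div_le_one_div_of_le (Real.sqrt_pos.2 (by exact_mod_cast h1)) ?_
    rw [← Real.sqrt_mul hn0.le]
    refine Real.sqrt_le_iff.2 ⟨by positivity, ?_⟩
    rw [mul_pow, Real.sq_sqrt (by positivity)]
    have h2 : 2 ^ Nat.clog 2 n * (r - e) ≤ 2 * n * (t - e) := Nat.mul_le_mul hm (by omega)
    have h3 : ((2 ^ Nat.clog 2 n * (r - e) : ℕ) : ℝ) ≤ 2 * n * ((t : ℝ) - e) := by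
      rw [← Nat.cast_sub (by omega : e ≤ t)]
      exact_mod_cast h2
    have h4 := mul_pos hn0 hD
    nlinarith
  refine le_trans ?_ (Finset.card_nsmul_le_sum _ _ _ hterm)
  rw [Nat.card_Ioc, nsmul_eq_mul, Nat.add_sub_cancel_left]
  have h5 : (n : ℝ) ≤ 3 * (n / 2 : ℕ) := by exact_mod_cast (by omega : n ≤ 3 * (n / 2))
  have hs := Real.mul_self_sqrt hn0.le
  have hs0 := Real.sqrt_pos.2 hn0
  have hd0 := Real.sqrt_pos.2 hD
  rw [mul_one_div, div_le_div_iff₀ (by positivity) (by positivity)]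
  have h6 : √(n : ℝ) * (1.5 * (√(n : ℝ) * √((t : ℝ) - e))) = 1.5 * n * √((t : ℝ) - e) := by
    linear_combination 1.5 * √((t : ℝ) - e) * hs
  rw [h6]
  nlinarith

/-- The failure probability for one episode start, one round and one arm. -/
theorem measure_no_replay_le (hK : 1 ≤ K) (hT : 2 ≤ T) (hμ : ∀ t a, μ t a ∈ Set.Icc (0 : ℝ) 1)
    {e t : ℕ} (he : e < t) (b : Fin K)
    (hsum : 20 * Real.log T * √((t : ℝ) - e) ≤
      ∑ v ∈ badEnds (badRate C₀ K T) (fun s => worstGap μ s b) (phaseIndex T μ) e t,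
        √(segLen (badRate C₀ K T) (fun s => worstGap μ s b) (phaseIndex T μ) e v : ℝ)) :
    seedLaw P {ω | ∀ v ∈ badEnds (badRate C₀ K T) (fun s => worstGap μ s b) (phaseIndex T μ) e t,
      ∀ r, segStart (badRate C₀ K T) (fun s => worstGap μ s b) (phaseIndex T μ) e v < r →
      2 * (r - segStart (badRate C₀ K T) (fun s => worstGap μ s b) (phaseIndex T μ) e v) ≤
        segLen (badRate C₀ K T) (fun s => worstGap μ s b) (phaseIndex T μ) e v →
      ¬ (ω r).2.2 (e, 2 ^ Nat.clog 2
        (segLen (badRate C₀ K T) (fun s => worstGap μ s b) (phaseIndex T μ) e v)) = true} ≤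
      ENNReal.ofReal (1 / (T : ℝ) ^ 4) := by
  set β := badRate C₀ K T
  set d : ℕ → ℝ := fun s => worstGap μ s b with hd
  set V := badEnds β d (phaseIndex T μ) e t with hV
  set u := segStart β d (phaseIndex T μ) e with hu
  set n := segLen β d (phaseIndex T μ) e with hn
  have hVmem : ∀ v ∈ V, e ≤ v ∧ v < t ∧ e ≤ u v ∧ u v ≤ v ∧ n v = v + 1 - u v ∧ 2 ≤ n v := by
    intro v hv
    have h1 := Finset.mem_Ico.1 (Finset.mem_filter.1 hv).1
    have h2 := segStart_bounds (β := β) (d := d) (idx := phaseIndex T μ) v h1.1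
    have h3 : 4 * K ≤ n v := four_mul_le_segLen hT hμ hv
    exact ⟨h1.1, h1.2, h2.1, h2.2, rfl, by omega⟩
  have hdisj : (V : Set ℕ).PairwiseDisjoint fun v => Finset.Ioc (u v) (u v + n v / 2) := by
    -- the segment of an earlier bad end cannot contain a later segment start
    have hlt : ∀ v ∈ V, ∀ w ∈ V, v < w → v < u w := by
      intro v hv w hw hvw
      by_contra hcon
      have h1 := segStart_eq (β := β) (d := d) (idx := phaseIndex T μ) w (hVmem w hw).1 v
        (not_lt.1 hcon) hvw.le
      have h2 := (Finset.mem_filter.1 hv).2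
      rw [h1.1] at h2
      exact absurd h2 (not_le.2 (h1.2.2 hvw))
    have hdj : ∀ v ∈ V, ∀ w ∈ V, v < w →
        Disjoint (Finset.Ioc (u v) (u v + n v / 2)) (Finset.Ioc (u w) (u w + n w / 2)) := by
      intro v hv w hw hvw
      have h1 := hlt v hv w hw hvw
      obtain ⟨-, -, -, h2, h3, h4⟩ := hVmem v hv
      rw [Finset.disjoint_left]
      intro r hr hr'
      rw [Finset.mem_Ioc] at hr hr'
      omega
    intro v hv w hw hvw
    rcases lt_or_gt_of_ne hvw with h | h
    · exact hdj v hv w hw h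
    · exact (hdj w hw v hv h).symm
  have hmain := measure_forall_replay_false_le P hK e V (fun v => Finset.Ioc (u v) (u v + n v / 2))
    (fun v => 2 ^ Nat.clog 2 (n v)) hdisj
  refine le_trans (measure_mono ?_) (hmain.trans (ENNReal.ofReal_le_ofReal ?_))
  · intro ω hω v hv r hr
    rw [Finset.mem_Ioc] at hr
    simpa using hω v hv r hr.1 (by omega)
  · have hD : (0 : ℝ) < (t : ℝ) - e := by
      have : (e : ℝ) < t := by exact_mod_cast he
      linarith
    have h1 : 4 * Real.log T ≤ ∑ v ∈ V, ∑ r ∈ Finset.Ioc (u v) (u v + n v / 2),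
        1 / √((2 ^ Nat.clog 2 (n v) * (r - e) : ℕ) : ℝ) := by
      calc 4 * Real.log T ≤ (∑ v ∈ V, √(n v : ℝ)) / (5 * √((t : ℝ) - e)) := by
            rw [le_div_iff₀ (by have := Real.sqrt_pos.2 hD; positivity)]
            linarith
        _ = ∑ v ∈ V, √(n v : ℝ) / (5 * √((t : ℝ) - e)) := Finset.sum_div _ _ _
        _ ≤ _ := Finset.sum_le_sum fun v hv => by
            obtain ⟨h2, h3, h4, h5, h6, h7⟩ := hVmem v hv
            exact sqrt_div_le_sum_replay h7 h4 (by omega)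
    rw [← exp_neg_mul_log hT 4]
    exact Real.exp_le_exp.2 (neg_le_neg (by exact_mod_cast h1))

theorem measure_not_replaysFound_le (hK : 1 ≤ K) (hKT : K ≤ T) (hT : 2 ≤ T)
    (hμ : ∀ t a, μ t a ∈ Set.Icc (0 : ℝ) 1) :
    seedLaw P {ω | ¬ ReplaysFound C₀ T μ fun r e m => (ω r).2.2 (e, m) = true} ≤
      ENNReal.ofReal (1 / (T : ℝ)) := by
  classical
  have hT0 : (0 : ℝ) < T := by exact_mod_cast (by omega : 0 < T)
  set J := ((Finset.Icc 1 T) ×ˢ (Finset.Icc 1 T)) ×ˢ (Finset.univ : Finset (Fin K)) with hJ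
  set I := J.filter fun p => p.1.1 < p.1.2 ∧ 20 * Real.log T * √((p.1.2 : ℝ) - p.1.1) ≤
      ∑ v ∈ badEnds (badRate C₀ K T) (fun s => worstGap μ s p.2) (phaseIndex T μ) p.1.1 p.1.2,
        √(segLen (badRate C₀ K T) (fun s => worstGap μ s p.2) (phaseIndex T μ) p.1.1 v : ℝ) with hI
  have hsub : {ω : ℕ → RoundSeed K |
      ¬ ReplaysFound C₀ T μ fun r e m => (ω r).2.2 (e, m) = true} ⊆
      ⋃ p ∈ I, {ω | ∀ v ∈ badEnds (badRate C₀ K T) (fun s => worstGap μ s p.2) (phaseIndex T μ)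
          p.1.1 p.1.2,
        ∀ r, segStart (badRate C₀ K T) (fun s => worstGap μ s p.2) (phaseIndex T μ) p.1.1 v < r →
        2 * (r - segStart (badRate C₀ K T) (fun s => worstGap μ s p.2) (phaseIndex T μ) p.1.1 v) ≤
          segLen (badRate C₀ K T) (fun s => worstGap μ s p.2) (phaseIndex T μ) p.1.1 v →
        ¬ (ω r).2.2 (p.1.1, 2 ^ Nat.clog 2
          (segLen (badRate C₀ K T) (fun s => worstGap μ s p.2) (phaseIndex T μ) p.1.1 v)) =
            true} := by
    intro ω hω
    simp only [Set.mem_ofPred_eq, ReplaysFound] at hω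
    push Not at hω
    obtain ⟨e, t, b, h1, h2, h3, h4, h5⟩ := hω
    refine Set.mem_biUnion (x := ((e, t), b)) ?_ h5
    simp only [hI, hJ, Finset.mem_coe, Finset.mem_filter, Finset.mem_product, Finset.mem_Icc,
      Finset.mem_univ, and_true]
    exact ⟨⟨⟨h1, h2.le.trans h3⟩, h1.trans h2.le, h3⟩, h2, h4⟩
  refine (measure_mono hsub).trans ((measure_biUnion_finset_le I _).trans ?_)
  refine (Finset.sum_le_sum fun p hp => ?_).trans (b := ∑ p ∈ I, ENNReal.ofReal (1 / (T : ℝ) ^ 4)) ?_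
  · obtain ⟨-, h1, h2⟩ := Finset.mem_filter.1 hp
    exact measure_no_replay_le P hK hT hμ h1 p.2 h2
  rw [Finset.sum_const, nsmul_eq_mul, ← ENNReal.ofReal_natCast,
    ← ENNReal.ofReal_mul (Nat.cast_nonneg _)]
  refine ENNReal.ofReal_le_ofReal ?_
  have hcard : I.card ≤ T ^ 3 := by
    refine (Finset.card_filter_le _ _).trans ?_
    rw [hJ, Finset.card_product, Finset.card_product, Finset.card_univ, Fintype.card_fin,
      Nat.card_Icc, Nat.add_sub_cancel]
    calc T * T * K ≤ T * T * T := Nat.mul_le_mul_left _ hKT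
      _ = T ^ 3 := by ring
  have hcard' : (I.card : ℝ) ≤ (T : ℝ) ^ 3 := by exact_mod_cast hcard
  calc (I.card : ℝ) * (1 / (T : ℝ) ^ 4) ≤ (T : ℝ) ^ 3 * (1 / (T : ℝ) ^ 4) := by gcongr
    _ = 1 / (T : ℝ) := by field_simp

end

/-! ### Expected regret and expected cost of the replays -/

section

variable {K : ℕ} {C₀ : ℝ} {T : ℕ} {μ : ℕ → Fin K → ℝ}

theorem measurable_worstGap_metaArm {t : ℕ} (hT : t ≤ T) :
    Measurable fun ω : ℕ → RoundSeed K => worstGap μ t (metaArm C₀ T t ω) :=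
  (measurable_of_countable fun a : Fin K => worstGap μ t a).comp (measurable_metaArm hT)

theorem measurable_avgGap {t : ℕ} (hT : t ≤ T) :
    Measurable fun ω : ℕ → RoundSeed K => avgGap μ (armsAt C₀ T ω) t :=
  (measurable_of_countable fun A : Finset (Fin K) =>
    (∑ a ∈ A, worstGap μ t a) / (A.card : ℝ)).comp (measurable_armsAt hT)

variable (P : ℕ → Measure (Fin K → ℝ)) [∀ t, IsProbabilityMeasure (P t)]

theorem integrable_worstGap_metaArm (hK : 1 ≤ K) (hμ : ∀ t a, μ t a ∈ Set.Icc (0 : ℝ) 1) {t : ℕ}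
    (hT : t ≤ T) :
    Integrable (fun ω : ℕ → RoundSeed K => worstGap μ t (metaArm C₀ T t ω)) (seedLaw P) := by
  have := isProbabilityMeasure_seedLaw hK P
  refine Integrable.of_bound (measurable_worstGap_metaArm hT).aestronglyMeasurable 1
    (ae_of_all _ fun ω => ?_)
  rw [Real.norm_eq_abs, abs_of_nonneg (worstGap_nonneg μ t _)]
  exact worstGap_le_one μ hμ t _

theorem integrable_avgGap (hK : 1 ≤ K) (hμ : ∀ t a, μ t a ∈ Set.Icc (0 : ℝ) 1) {t : ℕ}
    (hT : t ≤ T) :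
    Integrable (fun ω : ℕ → RoundSeed K => avgGap μ (armsAt C₀ T ω) t) (seedLaw P) := by
  have := isProbabilityMeasure_seedLaw hK P
  refine Integrable.of_bound (measurable_avgGap hT).aestronglyMeasurable 1
    (ae_of_all _ fun ω => ?_)
  rw [Real.norm_eq_abs, abs_of_nonneg (avgGap_nonneg t)]
  exact avgGap_le_one hμ t

/-- Conditionally on the past, the arm is drawn uniformly from the candidate set. -/
theorem integral_worstGap_metaArm (hK : 1 ≤ K) (hμ : ∀ t a, μ t a ∈ Set.Icc (0 : ℝ) 1) {t : ℕ}
    (h1 : 1 ≤ t) (hT : t ≤ T) :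
    ∫ ω, worstGap μ t (metaArm C₀ T t ω) ∂(seedLaw P) =
      ∫ ω, avgGap μ (armsAt C₀ T ω) t ∂(seedLaw P) := by
  have := isProbabilityMeasure_drawLaw hK
  have := isProbabilityMeasure_seedLaw hK P
  have hpres := measurePreserving_withPlay P hK t
  have hint := integrable_worstGap_metaArm (C₀ := C₀) P hK hμ hT
  have hint' : Integrable (fun p : (ℕ → RoundSeed K) × ((Fin K → ℝ) × (Finset (Fin K) → Fin K)) =>
      worstGap μ t (metaArm C₀ T t (withPlay p.1 t p.2)))
      ((seedLaw P).prod ((P t).prod (drawLaw K))) := hpres.integrable_comp_of_integrable hint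
  calc ∫ ω, worstGap μ t (metaArm C₀ T t ω) ∂(seedLaw P)
      = ∫ p, worstGap μ t (metaArm C₀ T t (withPlay p.1 t p.2))
          ∂((seedLaw P).prod ((P t).prod (drawLaw K))) := by
        have h2 := integral_map (μ := (seedLaw P).prod ((P t).prod (drawLaw K)))
          hpres.measurable.aemeasurable (f := fun ω => worstGap μ t (metaArm C₀ T t ω))
          (measurable_worstGap_metaArm hT).aestronglyMeasurable
        rw [hpres.map_eq] at h2
        exact h2
    _ = ∫ ω, ∫ z, worstGap μ t (metaArm C₀ T t (withPlay ω t z)) ∂((P t).prod (drawLaw K))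
          ∂(seedLaw P) := integral_prod _ hint'
    _ = ∫ ω, avgGap μ (armsAt C₀ T ω) t ∂(seedLaw P) := by
        refine integral_congr_ae (ae_of_all _ fun ω => ?_)
        have hA : (armsAt C₀ T ω t).Nonempty :=
          (isRun (C₀ := C₀) (T := T) (ω := ω)).arms_nonempty hK h1 hT
        have h3 := (integral_play hK (P t) hA (fun b _ => worstGap μ t b)
          fun b => integrable_const _).2
        simp only [metaArm_withPlay_self ω t _ h1]
        rw [h3]
        simp [avgGap]

theorem dynamicRegret_eq_integral (hK : 1 ≤ K) (hμ : ∀ t a, μ t a ∈ Set.Icc (0 : ℝ) 1) :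
    dynamicRegret (seedLaw P) T μ (metaArm C₀ T) =
      ∫ ω, ∑ t ∈ Finset.Icc 1 T, avgGap μ (armsAt C₀ T ω) t ∂(seedLaw P) := by
  have := isProbabilityMeasure_seedLaw hK P
  have hint : ∀ t ∈ Finset.Icc 1 T,
      Integrable (fun ω : ℕ → RoundSeed K => worstGap μ t (metaArm C₀ T t ω)) (seedLaw P) :=
    fun t ht => integrable_worstGap_metaArm P hK hμ (Finset.mem_Icc.1 ht).2
  have hsum : ∫ ω, ∑ t ∈ Finset.Icc 1 T, worstGap μ t (metaArm C₀ T t ω) ∂(seedLaw P) =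
      ∫ ω, ∑ t ∈ Finset.Icc 1 T, avgGap μ (armsAt C₀ T ω) t ∂(seedLaw P) := by
    rw [integral_finsetSum _ hint, integral_finsetSum _ fun t ht =>
      integrable_avgGap P hK hμ (Finset.mem_Icc.1 ht).2]
    refine Finset.sum_congr rfl fun t ht => ?_
    rw [Finset.mem_Icc] at ht
    exact integral_worstGap_metaArm P hK hμ ht.1 ht.2
  have hmean : ∀ ω : ℕ → RoundSeed K, ∑ t ∈ Finset.Icc 1 T, μ t (metaArm C₀ T t ω) =
      ∑ t ∈ Finset.Icc 1 T, (⨆ a, μ t a) -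
        ∑ t ∈ Finset.Icc 1 T, worstGap μ t (metaArm C₀ T t ω) := by
    intro ω
    rw [← Finset.sum_sub_distrib]
    exact Finset.sum_congr rfl fun t _ => by rw [worstGap_eq hK]; ring
  rw [dynamicRegret, ← hsum]
  simp only [hmean]
  rw [integral_sub (integrable_const _) (integrable_finsetSum _ hint), integral_const]
  simp

theorem card_durations_le (hT : 2 ≤ T) : ((durations T).card : ℝ) ≤ 3 * Real.log T := by
  have h1 : (durations T).card ≤ Nat.clog 2 T := by
    refine Finset.card_image_le.trans ?_
    rw [Nat.card_Icc, Nat.add_sub_cancel]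
  refine (Nat.cast_le.2 h1).trans ?_
  have h2 : 0 < Nat.clog 2 T := Nat.clog_pos (by norm_num) hT
  obtain ⟨k, hk⟩ : ∃ k, Nat.clog 2 T = k + 1 := ⟨Nat.clog 2 T - 1, by omega⟩
  have h3 := Nat.pow_pred_clog_lt_self (b := 2) (by norm_num) (by omega : 1 < T)
  rw [hk, Nat.pred_succ] at h3
  have h4 : ((2 : ℝ) ^ k) ≤ T := by exact_mod_cast h3.le
  have h5 := Real.log_le_log (by positivity) h4
  rw [Real.log_pow] at h5
  have h6 := Real.log_two_gt_d9
  have h7 : Real.log 2 ≤ Real.log T := Real.log_le_log (by norm_num) (by exact_mod_cast hT)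
  rw [hk]
  push_cast
  nlinarith [Nat.cast_nonneg (α := ℝ) k]

/-- The sum of `√(K (m + 1))` over all scheduled replays of duration `m`, including those that are
superseded by a longer one scheduled at the same round. -/
noncomputable def replayCost {K : ℕ} (C₀ : ℝ) (T : ℕ) (ω : ℕ → RoundSeed K) : ℝ :=
  ∑ r ∈ Finset.Icc 2 T, ∑ m ∈ durations T,
    if (ω r).2.2 (episodeAt C₀ T ω (r - 1), m) = true then √(K * ((m : ℝ) + 1)) else 0

theorem sum_replayLen_le_replayCost (ω : ℕ → RoundSeed K) :
    ∑ g ∈ Finset.Icc 1 T with 0 < replayLen C₀ T ω g, √(K * ((replayLen C₀ T ω g : ℝ) + 1)) ≤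
      replayCost C₀ T ω := by
  have hnonneg : ∀ r, ∀ m ∈ durations T,
      0 ≤ if (ω r).2.2 (episodeAt C₀ T ω (r - 1), m) = true then √(K * ((m : ℝ) + 1)) else 0 := by
    intro r m _
    split_ifs
    exacts [Real.sqrt_nonneg _, le_rfl]
  have hsub : (Finset.Icc 1 T).filter (fun g => 0 < replayLen C₀ T ω g) ⊆ Finset.Icc 2 T := by
    intro g hg
    obtain ⟨h1, h2⟩ := Finset.mem_filter.1 hg
    rw [Finset.mem_Icc] at h1 ⊢
    refine ⟨?_, h1.2⟩
    by_contra hcon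
    rw [replayLen, if_pos (by omega)] at h2
    exact lt_irrefl _ h2
  refine le_trans (Finset.sum_le_sum fun g hg => ?_)
    (Finset.sum_le_sum_of_subset_of_nonneg hsub fun r _ _ => Finset.sum_nonneg (hnonneg r))
  have hg2 := Finset.mem_Icc.1 (hsub hg)
  have hpos := (Finset.mem_filter.1 hg).2
  have hlen : replayLen C₀ T ω g ∈
      (durations T).filter fun m => (ω g).2.2 (episodeAt C₀ T ω (g - 1), m) = true := by
    have h3 : replayLen C₀ T ω g = ((durations T).filter fun m =>
        (ω g).2.2 (episodeAt C₀ T ω (g - 1), m) = true).sup id := by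
      rw [replayLen, if_neg (by omega)]
    have hne : ((durations T).filter fun m =>
        (ω g).2.2 (episodeAt C₀ T ω (g - 1), m) = true).Nonempty := by
      by_contra hcon
      rw [h3, Finset.not_nonempty_iff_eq_empty.1 hcon] at hpos
      exact lt_irrefl _ hpos
    obtain ⟨m, hm, hm'⟩ := Finset.exists_mem_eq_sup _ hne id
    rw [h3, hm']
    exact hm
  obtain ⟨h4, h5⟩ := Finset.mem_filter.1 hlen
  refine le_trans (le_of_eq ?_) (Finset.single_le_sum (hnonneg g) h4)
  rw [if_pos h5]

theorem integrable_replayTerm (hK : 1 ≤ K) {r : ℕ} (hT : r ≤ T) (m : ℕ) (c : ℝ) :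
    Integrable (fun ω : ℕ → RoundSeed K =>
      if (ω r).2.2 (episodeAt C₀ T ω (r - 1), m) = true then c else 0) (seedLaw P) := by
  have := isProbabilityMeasure_seedLaw hK P
  have hB : Measurable fun ω : ℕ → RoundSeed K => (ω r).2.2 (episodeAt C₀ T ω (r - 1), m) :=
    measurable_apply_countable (F := fun e (ω : ℕ → RoundSeed K) => (ω r).2.2 (e, m))
      (measurable_episodeAt (by omega)) fun e => (measurable_pi_apply (e, m)).comp
        (measurable_snd.comp (measurable_snd.comp (measurable_pi_apply r)))
  refine Integrable.of_bound (((measurable_of_countable fun b : Bool =>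
    if b = true then c else 0).comp hB).aestronglyMeasurable) |c| (ae_of_all _ fun ω => ?_)
  rw [Real.norm_eq_abs]
  split_ifs
  · exact le_rfl
  · simp

/-- The replay indicators of a round are independent of the past. -/
theorem integral_replayTerm (hK : 1 ≤ K) {r : ℕ} (h2 : 2 ≤ r) (hT : r ≤ T) (m : ℕ) (c : ℝ) :
    ∫ ω : ℕ → RoundSeed K,
      (if (ω r).2.2 (episodeAt C₀ T ω (r - 1), m) = true then c else 0) ∂(seedLaw P) =
      ∫ ω : ℕ → RoundSeed K,
        c * (1 / √((m * (r - episodeAt C₀ T ω (r - 1)) : ℕ) : ℝ)) ∂(seedLaw P) := by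
  have := isProbabilityMeasure_seedLaw hK P
  have hpres := measurePreserving_withReplays P hK r
  have hint := integrable_replayTerm (C₀ := C₀) P hK hT m c
  have hint' : Integrable (fun p : (ℕ → RoundSeed K) × (ℕ × ℕ → Bool) =>
      if (withReplays p.1 r p.2 r).2.2 (episodeAt C₀ T (withReplays p.1 r p.2) (r - 1), m) = true
        then c else 0) ((seedLaw P).prod (replayLaw r)) := hpres.integrable_comp_of_integrable hint
  have hstep := integral_map hpres.measurable.aemeasurable
    (f := fun ω : ℕ → RoundSeed K =>
      if (ω r).2.2 (episodeAt C₀ T ω (r - 1), m) = true then c else 0)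
    (by rw [hpres.map_eq]; exact hint.aestronglyMeasurable)
  rw [hpres.map_eq] at hstep
  rw [hstep, integral_prod _ hint']
  refine integral_congr_ae (ae_of_all _ fun ω => ?_)
  have hval : ∀ B : ℕ × ℕ → Bool,
      (if (withReplays ω r B r).2.2 (episodeAt C₀ T (withReplays ω r B) (r - 1), m) = true
        then c else 0) =
      Set.indicator {B : ℕ × ℕ → Bool | B (episodeAt C₀ T ω (r - 1), m) = true} (fun _ => c) B := by
    intro B
    rw [episodeAt_withReplays ω r B (by omega) h2]
    simp [withReplays, Set.indicator]
  simp only [hval]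
  rw [integral_indicator_const _ (measurableSet_replay_eq _ m true), replayLaw_real_true,
    smul_eq_mul, mul_comm]

/-- Up to a constant, the expected cost of the scheduled replays of one duration, along the
trajectory. -/
noncomputable def replayRate {K : ℕ} (C₀ : ℝ) (T : ℕ) (ω : ℕ → RoundSeed K) : ℝ :=
  √(K : ℝ) * ∑ q ∈ Finset.Icc 1 T, 1 / √((q : ℝ) + 1 - episodeAt C₀ T ω q)

theorem replayRate_bounds (ω : ℕ → RoundSeed K) :
    0 ≤ replayRate C₀ T ω ∧ replayRate C₀ T ω ≤ √(K : ℝ) * T := by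
  refine ⟨mul_nonneg (Real.sqrt_nonneg _) (Finset.sum_nonneg fun _ _ => by positivity),
    mul_le_mul_of_nonneg_left ?_ (Real.sqrt_nonneg _)⟩
  calc ∑ q ∈ Finset.Icc 1 T, 1 / √((q : ℝ) + 1 - episodeAt C₀ T ω q)
      ≤ ∑ q ∈ Finset.Icc 1 T, (1 : ℝ) := by
        refine Finset.sum_le_sum fun q hq => ?_
        rw [Finset.mem_Icc] at hq
        have h1 := ((isRun (C₀ := C₀) (T := T) (ω := ω)).ep_bounds hq.1 hq.2).2
        have h2 : (episodeAt C₀ T ω q : ℝ) ≤ q := by exact_mod_cast h1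
        have h3 : 1 ≤ √((q : ℝ) + 1 - episodeAt C₀ T ω q) := Real.one_le_sqrt.2 (by linarith)
        exact (div_le_one (by linarith)).2 h3
    _ = T := by simp

theorem measurable_replayRate :
    Measurable fun ω : ℕ → RoundSeed K => replayRate C₀ T ω := by
  refine (Finset.measurable_sum _ fun q hq => ?_).const_mul _
  rw [Finset.mem_Icc] at hq
  exact (measurable_of_countable fun e : ℕ => 1 / √((q : ℝ) + 1 - e)).comp
    (measurable_episodeAt hq.2)

theorem integrable_replayRate (hK : 1 ≤ K) :
    Integrable (fun ω : ℕ → RoundSeed K => replayRate C₀ T ω) (seedLaw P) := by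
  have := isProbabilityMeasure_seedLaw hK P
  refine Integrable.of_bound measurable_replayRate.aestronglyMeasurable (√(K : ℝ) * T)
    (ae_of_all _ fun ω => ?_)
  obtain ⟨h1, h2⟩ := replayRate_bounds (C₀ := C₀) (T := T) ω
  rw [Real.norm_eq_abs, abs_of_nonneg h1]
  exact h2

theorem integrable_replayCost (hK : 1 ≤ K) :
    Integrable (fun ω : ℕ → RoundSeed K => replayCost C₀ T ω) (seedLaw P) :=
  integrable_finsetSum _ fun _ hr => integrable_finsetSum _ fun m _ =>
    integrable_replayTerm P hK (Finset.mem_Icc.1 hr).2 m _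

/-- The durations cancel in `√(K (m + 1)) / √(m (r - e)) ≤ 1.5 √(K / (r - e))`. -/
theorem integral_replayCost_le (hK : 1 ≤ K) (hT : 2 ≤ T) :
    ∫ ω, replayCost C₀ T ω ∂(seedLaw P) ≤
      4.5 * Real.log T * ∫ ω, replayRate C₀ T ω ∂(seedLaw P) := by
  have := isProbabilityMeasure_seedLaw hK P
  have hL := sixty_nine_le_log hT
  have hint : ∀ r ∈ Finset.Icc 2 T, ∀ m ∈ durations T, Integrable (fun ω : ℕ → RoundSeed K =>
      if (ω r).2.2 (episodeAt C₀ T ω (r - 1), m) = true then √(K * ((m : ℝ) + 1)) else 0)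
      (seedLaw P) := fun r hr m _ => integrable_replayTerm P hK (Finset.mem_Icc.1 hr).2 m _
  have hrate : ∀ q ∈ Finset.Icc 1 T, Integrable (fun ω : ℕ → RoundSeed K =>
      1 / √((q : ℝ) + 1 - episodeAt C₀ T ω q)) (seedLaw P) := by
    intro q hq
    rw [Finset.mem_Icc] at hq
    refine Integrable.of_bound ((measurable_of_countable fun e : ℕ => 1 / √((q : ℝ) + 1 - e)).comp
      (measurable_episodeAt hq.2)).aestronglyMeasurable 1 (ae_of_all _ fun ω => ?_)
    have h1 := ((isRun (C₀ := C₀) (T := T) (ω := ω)).ep_bounds hq.1 hq.2).2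
    have h2 : (episodeAt C₀ T ω q : ℝ) ≤ q := by exact_mod_cast h1
    have h3 : 1 ≤ √((q : ℝ) + 1 - episodeAt C₀ T ω q) := Real.one_le_sqrt.2 (by linarith)
    rw [Real.norm_eq_abs, abs_of_nonneg (by positivity)]
    exact (div_le_one (by linarith)).2 h3
  have hterm : ∀ r ∈ Finset.Icc 2 T, ∀ m ∈ durations T, ∫ ω : ℕ → RoundSeed K,
      (if (ω r).2.2 (episodeAt C₀ T ω (r - 1), m) = true then √(K * ((m : ℝ) + 1)) else 0)
        ∂(seedLaw P) ≤
      1.5 * √(K : ℝ) * ∫ ω : ℕ → RoundSeed K,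
        1 / √(((r - 1 : ℕ) : ℝ) + 1 - episodeAt C₀ T ω (r - 1)) ∂(seedLaw P) := by
    intro r hr m hm
    rw [Finset.mem_Icc] at hr
    rw [integral_replayTerm P hK hr.1 hr.2, ← integral_const_mul]
    have hle : ∀ ω : ℕ → RoundSeed K,
        √(K * ((m : ℝ) + 1)) * (1 / √((m * (r - episodeAt C₀ T ω (r - 1)) : ℕ) : ℝ)) ≤
        1.5 * √(K : ℝ) * (1 / √(((r - 1 : ℕ) : ℝ) + 1 - episodeAt C₀ T ω (r - 1))) := by
      intro ω
      have hep := ((isRun (C₀ := C₀) (T := T) (ω := ω)).ep_bounds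
        (by omega : 1 ≤ r - 1) (by omega)).2
      have hm1 : (1 : ℝ) ≤ m := by exact_mod_cast durations_pos hm
      have hcast : ((m * (r - episodeAt C₀ T ω (r - 1)) : ℕ) : ℝ) =
          m * (((r - 1 : ℕ) : ℝ) + 1 - episodeAt C₀ T ω (r - 1)) := by
        rw [Nat.cast_mul, Nat.cast_sub (by omega), Nat.cast_sub (by omega)]
        push_cast; ring
      have hep' : (episodeAt C₀ T ω (r - 1) : ℝ) ≤ ((r - 1 : ℕ) : ℝ) := by exact_mod_cast hep
      rw [hcast]
      set D : ℝ := ((r - 1 : ℕ) : ℝ) + 1 - episodeAt C₀ T ω (r - 1) with hD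
      have hD0 : 0 < √D := Real.sqrt_pos.2 (by linarith)
      have hm0 : 0 < √(m : ℝ) := Real.sqrt_pos.2 (by linarith)
      have h3 : √((m : ℝ) + 1) ≤ 1.5 * √(m : ℝ) := by
        refine Real.sqrt_le_iff.2 ⟨by positivity, ?_⟩
        rw [mul_pow, Real.sq_sqrt (by linarith)]
        linarith
      rw [Real.sqrt_mul (Nat.cast_nonneg K), Real.sqrt_mul (by linarith : (0 : ℝ) ≤ m),
        mul_one_div, mul_one_div, div_le_div_iff₀ (by positivity) hD0]
      have h4 := mul_le_mul_of_nonneg_left h3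
        (mul_nonneg (Real.sqrt_nonneg (K : ℝ)) hD0.le)
      linarith
    have hepm : Measurable fun ω : ℕ → RoundSeed K => episodeAt C₀ T ω (r - 1) :=
      measurable_episodeAt (by omega)
    refine integral_mono ?_ ((hrate (r - 1) (Finset.mem_Icc.2 ⟨by omega, by omega⟩)).const_mul _)
      hle
    refine Integrable.of_bound ((measurable_of_countable fun e : ℕ => √(K * ((m : ℝ) + 1)) *
      (1 / √((m * (r - e) : ℕ) : ℝ))).comp hepm).aestronglyMeasurable (√(K * ((m : ℝ) + 1)))
      (ae_of_all _ fun ω => ?_)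
    have h5 := one_div_sqrt_mem (m * (r - episodeAt C₀ T ω (r - 1)))
    rw [Real.norm_eq_abs, abs_of_nonneg (mul_nonneg (Real.sqrt_nonneg _) h5.1)]
    exact mul_le_of_le_one_right (Real.sqrt_nonneg _) h5.2
  have hI0 : ∀ q : ℕ, 0 ≤ ∫ ω : ℕ → RoundSeed K, 1 / √((q : ℝ) + 1 - episodeAt C₀ T ω q)
      ∂(seedLaw P) := fun q => integral_nonneg fun ω => by positivity
  have hshift : ∑ r ∈ Finset.Icc 2 T, ∫ ω : ℕ → RoundSeed K,
        1 / √(((r - 1 : ℕ) : ℝ) + 1 - episodeAt C₀ T ω (r - 1)) ∂(seedLaw P) ≤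
      ∑ q ∈ Finset.Icc 1 T, ∫ ω : ℕ → RoundSeed K,
        1 / √((q : ℝ) + 1 - episodeAt C₀ T ω q) ∂(seedLaw P) := by
    rw [← Finset.sum_image (s := Finset.Icc 2 T) (g := fun r => r - 1)
      (f := fun q : ℕ => ∫ ω : ℕ → RoundSeed K,
        1 / √((q : ℝ) + 1 - (episodeAt C₀ T ω q : ℝ)) ∂(seedLaw P))]
    · refine Finset.sum_le_sum_of_subset_of_nonneg ?_ fun q _ _ => hI0 q
      intro q hq
      obtain ⟨r, hr, rfl⟩ := Finset.mem_image.1 hq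
      rw [Finset.mem_Icc] at hr ⊢
      omega
    · intro r hr r' hr' h
      rw [Finset.coe_Icc, Set.mem_Icc] at hr hr'
      simp only at h
      omega
  have hsum0 := Finset.sum_nonneg fun q (_ : q ∈ Finset.Icc 1 T) => hI0 q
  calc ∫ ω, replayCost C₀ T ω ∂(seedLaw P)
      = ∑ r ∈ Finset.Icc 2 T, ∑ m ∈ durations T, ∫ ω : ℕ → RoundSeed K,
          (if (ω r).2.2 (episodeAt C₀ T ω (r - 1), m) = true then √(K * ((m : ℝ) + 1)) else 0)
            ∂(seedLaw P) := by
        unfold replayCost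
        rw [integral_finsetSum _ fun r hr => integrable_finsetSum _ (hint r hr)]
        exact Finset.sum_congr rfl fun r hr => integral_finsetSum _ (hint r hr)
    _ ≤ ∑ r ∈ Finset.Icc 2 T, ∑ m ∈ durations T, 1.5 * √(K : ℝ) * ∫ ω : ℕ → RoundSeed K,
          1 / √(((r - 1 : ℕ) : ℝ) + 1 - episodeAt C₀ T ω (r - 1)) ∂(seedLaw P) :=
        Finset.sum_le_sum fun r hr => Finset.sum_le_sum (hterm r hr)
    _ = (durations T).card * (1.5 * √(K : ℝ)) * ∑ r ∈ Finset.Icc 2 T, ∫ ω : ℕ → RoundSeed K,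
          1 / √(((r - 1 : ℕ) : ℝ) + 1 - episodeAt C₀ T ω (r - 1)) ∂(seedLaw P) := by
        rw [Finset.mul_sum]
        refine Finset.sum_congr rfl fun r _ => ?_
        rw [Finset.sum_const, nsmul_eq_mul]; ring
    _ ≤ (3 * Real.log T) * (1.5 * √(K : ℝ)) * ∑ q ∈ Finset.Icc 1 T, ∫ ω : ℕ → RoundSeed K,
          1 / √((q : ℝ) + 1 - episodeAt C₀ T ω q) ∂(seedLaw P) := by
        have := card_durations_le hT
        gcongr
    _ = 4.5 * Real.log T * ∫ ω, replayRate C₀ T ω ∂(seedLaw P) := by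
        unfold replayRate
        rw [integral_const_mul, integral_finsetSum _ hrate]
        ring

/-! ### The regret bound -/

theorem dynamicRegret_le_horizon (hK : 1 ≤ K) (hμ : ∀ t a, μ t a ∈ Set.Icc (0 : ℝ) 1) :
    dynamicRegret (seedLaw P) T μ (metaArm C₀ T) ≤ T := by
  have := isProbabilityMeasure_seedLaw hK P
  rw [dynamicRegret_eq_integral P hK hμ]
  calc ∫ ω, ∑ t ∈ Finset.Icc 1 T, avgGap μ (armsAt C₀ T ω) t ∂(seedLaw P)
      ≤ ∫ _, (T : ℝ) ∂(seedLaw P) := by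
        refine integral_mono (integrable_finsetSum _ fun t ht =>
          integrable_avgGap P hK hμ (Finset.mem_Icc.1 ht).2) (integrable_const _) fun ω => ?_
        calc ∑ t ∈ Finset.Icc 1 T, avgGap μ (armsAt C₀ T ω) t ≤ ∑ t ∈ Finset.Icc 1 T, (1 : ℝ) :=
              Finset.sum_le_sum fun t _ => avgGap_le_one hμ t
          _ = T := by simp
    _ = T := by simp

theorem dynamicRegret_le_phaseSum (hK : 1 ≤ K) (hT : 2 ≤ T) (hC : 400 ≤ C₀)
    (hY : ∀ t, ∀ᵐ y ∂(P t), ∀ a, y a ∈ Set.Icc (0 : ℝ) 1) :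
    dynamicRegret (seedLaw P) T (meanReward P) (metaArm C₀ T) ≤
      (35 * (100 * √C₀ + 2000) + 10) * Real.log T ^ 3 * phaseSum T (meanReward P) := by
  have hprob := isProbabilityMeasure_seedLaw hK P
  have hμ : ∀ t a, meanReward P t a ∈ Set.Icc (0 : ℝ) 1 := fun t => integral_eval_mem (P t) (hY t)
  set L := Real.log T with hLdef
  have hL : 0.69 ≤ L := sixty_nine_le_log hT
  have hL3 : 0.328 ≤ L ^ 3 := by
    calc (0.328 : ℝ) ≤ 0.69 ^ 3 := by norm_num
      _ ≤ L ^ 3 := by gcongr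
  have hΦ := sqrt_mul_horizon_le_phaseSum (μ := meanReward P) (by omega : 1 ≤ T)
  set Φ := phaseSum T (meanReward P) with hΦdef
  have hK' : (1 : ℝ) ≤ K := by exact_mod_cast hK
  have hT' : (2 : ℝ) ≤ T := by exact_mod_cast hT
  have hΦK : √(K : ℝ) ≤ Φ := (Real.sqrt_le_sqrt (by nlinarith)).trans hΦ
  have hΦ1 : 1 ≤ Φ := (Real.one_le_sqrt.2 hK').trans hΦK
  have hsC := Real.sqrt_nonneg C₀
  rcases Nat.lt_or_ge T K with hKT | hKT
  · have h1 : (T : ℝ) ≤ √((K : ℝ) * T) := by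
      refine Real.le_sqrt_of_sq_le ?_
      have : (T : ℝ) ≤ K := by exact_mod_cast hKT.le
      nlinarith
    refine (dynamicRegret_le_horizon P hK hμ).trans ((h1.trans hΦ).trans ?_)
    have h2 : 1 ≤ (35 * (100 * √C₀ + 2000) + 10) * L ^ 3 := by nlinarith
    nlinarith
  set bad : Set (ℕ → RoundSeed K) :=
    {ω | ¬ Concentrated T (meanReward P) (armsAt C₀ T ω) (estAt C₀ T ω)} ∪
    {ω | ¬ ReplaysFound C₀ T (meanReward P) fun r e m => (ω r).2.2 (e, m) = true} with hbad
  -- the bad event need not be measurable, hence the measurable hull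
  set N := toMeasurable (seedLaw P) bad with hN
  have hNmeas : MeasurableSet N := measurableSet_toMeasurable _ _
  have hNreal : T * (seedLaw P).real N ≤ 3 := by
    have h1 : (seedLaw P) N ≤ ENNReal.ofReal (3 / T) := by
      rw [hN, measure_toMeasurable, hbad]
      refine (measure_union_le _ _).trans ((add_le_add
        (measure_not_concentrated_le P hK hKT hT hY)
        (measure_not_replaysFound_le P hK hKT hT hμ)).trans (le_of_eq ?_))
      rw [← ENNReal.ofReal_add (by positivity) (by positivity), ← add_div]
      norm_num
    have h2 : (seedLaw P).real N ≤ 3 / T := ENNReal.toReal_le_of_le_ofReal (by positivity) h1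
    rw [le_div_iff₀ (by linarith)] at h2
    linarith
  have hgood : ∀ ω ∉ N, Concentrated T (meanReward P) (armsAt C₀ T ω) (estAt C₀ T ω) ∧
      ReplaysFound C₀ T (meanReward P) fun r e m => (ω r).2.2 (e, m) = true := by
    intro ω hω
    have h1 : ω ∉ bad := fun h => hω (subset_toMeasurable _ _ h)
    simp only [hbad, Set.mem_union, Set.mem_ofPred_eq, not_or, not_not] at h1
    exact h1
  have hNint : ∀ c : ℝ, Integrable (N.indicator fun _ => c) (seedLaw P) := fun c =>
    (integrable_const c).indicator hNmeas
  have hNval : ∀ c : ℝ, ∫ ω, N.indicator (fun _ => c) ω ∂(seedLaw P) = (seedLaw P).real N * c :=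
    fun c => by rw [integral_indicator_const _ hNmeas, smul_eq_mul]
  have hrate : ∫ ω, replayRate C₀ T ω ∂(seedLaw P) ≤ 7 * Φ := by
    calc ∫ ω, replayRate C₀ T ω ∂(seedLaw P)
        ≤ ∫ ω, (4 * Φ + N.indicator (fun _ => √(K : ℝ) * T) ω) ∂(seedLaw P) := by
          refine integral_mono (integrable_replayRate P hK)
            ((integrable_const _).add (hNint _)) fun ω => ?_
          simp only
          by_cases hω : ω ∈ N
          · rw [Set.indicator_of_mem hω]
            linarith [(replayRate_bounds (C₀ := C₀) (T := T) ω).2]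
          · rw [Set.indicator_of_notMem hω, add_zero]
            exact sum_inv_sqrt_episode_le isRun hK hT hC hμ (hgood ω hω).1
      _ = 4 * Φ + (seedLaw P).real N * (√(K : ℝ) * T) := by
          rw [integral_add (integrable_const _) (hNint _), hNval]
          simp
      _ ≤ 7 * Φ := by
          have := mul_le_mul_of_nonneg_left hNreal (Real.sqrt_nonneg (K : ℝ))
          linarith
  have hcost : ∫ ω, replayCost C₀ T ω ∂(seedLaw P) ≤ 31.5 * L * Φ := by
    have h1 := integral_replayCost_le (C₀ := C₀) P hK hT
    have h2 := mul_le_mul_of_nonneg_left hrate (by linarith : 0 ≤ 4.5 * L)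
    linarith
  set c := 100 * √C₀ + 2000 with hc
  have hc0 : 0 ≤ c := by positivity
  have hcostint := integrable_replayCost (C₀ := C₀) (T := T) P hK
  have hmain : ∫ ω, ∑ t ∈ Finset.Icc 1 T, avgGap (meanReward P) (armsAt C₀ T ω) t ∂(seedLaw P) ≤
      c * L ^ 2 * (2 * Φ + 31.5 * L * Φ) + 3 := by
    have hint1 : Integrable (fun ω : ℕ → RoundSeed K =>
        c * L ^ 2 * (2 * Φ + replayCost C₀ T ω)) (seedLaw P) :=
      ((integrable_const _).add hcostint).const_mul _
    calc ∫ ω, ∑ t ∈ Finset.Icc 1 T, avgGap (meanReward P) (armsAt C₀ T ω) t ∂(seedLaw P)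
        ≤ ∫ ω, (c * L ^ 2 * (2 * Φ + replayCost C₀ T ω) + N.indicator (fun _ => (T : ℝ)) ω)
            ∂(seedLaw P) := by
          refine integral_mono (integrable_finsetSum _ fun t ht =>
            integrable_avgGap P hK hμ (Finset.mem_Icc.1 ht).2) (hint1.add (hNint _)) fun ω => ?_
          have hcost0 : 0 ≤ replayCost C₀ T ω :=
            (Finset.sum_nonneg fun _ _ => Real.sqrt_nonneg _).trans (sum_replayLen_le_replayCost ω)
          simp only
          by_cases hω : ω ∈ N
          · rw [Set.indicator_of_mem hω]
            have h1 : ∑ t ∈ Finset.Icc 1 T, avgGap (meanReward P) (armsAt C₀ T ω) t ≤ T := by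
              calc _ ≤ ∑ t ∈ Finset.Icc 1 T, (1 : ℝ) :=
                    Finset.sum_le_sum fun t _ => avgGap_le_one hμ t
                _ = T := by simp
            have h2 : 0 ≤ c * L ^ 2 * (2 * Φ + replayCost C₀ T ω) := by positivity
            linarith
          · rw [Set.indicator_of_notMem hω, add_zero]
            refine (sum_avgGap_le isRun hK hKT hT hC hμ (hgood ω hω).1 (hgood ω hω).2
              fun r m h2 _ hm hon => le_replayLen h2 hm hon).trans ?_
            have := sum_replayLen_le_replayCost (C₀ := C₀) (T := T) ω
            gcongr
      _ = c * L ^ 2 * (2 * Φ + ∫ ω, replayCost C₀ T ω ∂(seedLaw P)) +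
            (seedLaw P).real N * T := by
          rw [integral_add hint1 (hNint _), hNval, integral_const_mul,
            integral_add (integrable_const _) hcostint]
          simp
      _ ≤ c * L ^ 2 * (2 * Φ + 31.5 * L * Φ) + 3 := by
          have : (seedLaw P).real N * T ≤ 3 := by linarith
          gcongr
  rw [dynamicRegret_eq_integral P hK hμ]
  refine hmain.trans ?_
  have h1 : c * L ^ 2 * (2 * Φ + 31.5 * L * Φ) ≤ c * L ^ 2 * (35 * L * Φ) := by
    gcongr
    nlinarith
  have h2 : 3 ≤ 10 * L ^ 3 * Φ := by nlinarith
  calc c * L ^ 2 * (2 * Φ + 31.5 * L * Φ) + 3 ≤ c * L ^ 2 * (35 * L * Φ) + 10 * L ^ 3 * Φ := by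
        linarith
    _ = (35 * c + 10) * L ^ 3 * Φ := by ring

end

end MetaBandit

theorem theorem1 :
    ∃ c : ℝ, 0 < c ∧ ∀ C₀ : ℝ, c ≤ C₀ → ∃ C : ℝ, 0 < C ∧
      ∀ (K T : ℕ), 1 ≤ K → 2 ≤ T →
      ∀ (P : ℕ → Measure (Fin K → ℝ)) [∀ t, IsProbabilityMeasure (P t)],
        (∀ t, ∀ᵐ y ∂(P t), ∀ a, y a ∈ Set.Icc (0 : ℝ) 1) →
        MetaBandit.dynamicRegret (MetaBandit.seedLaw P) T (MetaBandit.meanReward P)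
            (MetaBandit.metaArm C₀ T)
          ≤ C * Real.log T ^ 3 *
            ∑ i ∈ Finset.range (MetaBandit.numShifts T (MetaBandit.meanReward P) + 1),
              √((K : ℝ) *
                ((MetaBandit.shiftTime T (MetaBandit.meanReward P) (i + 1) : ℝ)
                  - (MetaBandit.shiftTime T (MetaBandit.meanReward P) i : ℝ))) := by
  refine ⟨400, by norm_num, fun C₀ hC => ⟨35 * (100 * √C₀ + 2000) + 10, by positivity, ?_⟩⟩
  intro K T hK hT P _ hY
  exact MetaBandit.dynamicRegret_le_phaseSum P hK hT hC hY
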